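/- **Conventions.** Let $\mathbb N=\{0,1,2,\dots\}$. The Hilbert space of $k$ modes is $\ell^2(\mathbb N^k)$ with the Fock basis $|\ell\rangle$, $\ell\in\mathbb N^k$. The Bargmann function of a vector $\varphi$ is $F_\varphi(z)=\sum_{\ell}\varphi_\ell\, z^\ell/\sqrt{\ell!}$, $z\in\mathbb C^k$, and that of a unitary $U$ is $F_U(z,w)=e^{(\|z\|^2+\|w\|^2)/2}\langle z^*|U|w\rangle$, where $|w\rangle=e^{-\|w\|^2/2}\sum_\ell \frac{w^\ell}{\sqrt{\ell!}}|\ell\rangle$ is a coherent state. If $F(\zeta)=c\exp(\tfrac12\zeta^{\mathrm T}A\zeta+\zeta^{\mathrm T}b)$ with $A=A^{\mathrm T}$, then $(A,b,c)$ are the *Abc parameters*; for a unitary, $\zeta=(z,w)$ (output, then input). A *pure Gaussian state* is a unit vector that has Abc parameters. A *Gaussian unitary* is a unitary $U$ with $a_iU=\sum_l\big((S_1)_{il}\,Ua_l+(S_2)_{il}\,Ua_l^\dagger\big)+\gamma_iU$ and $a_i^\dagger U=\sum_l\big((S_2^*)_{il}\,Ua_l+(S_1^*)_{il}\,Ua_l^\dagger\big)+\gamma_i^*U$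 (on the Fock states), where $S_1S_1^\dagger-S_2S_2^\dagger=\mathbb 1$ and $S_1S_2^{\mathrm T}=S_2S_1^{\mathrm T}$, i.e. it acts on phase space by an affine symplectic map. Here $^*$ is the entrywise complex conjugate. For $q\in\mathbb N$ let $J^m_q=\{j\in\mathbb N^m:\sum_i j_i\le q\}$, and let $\|k\|_1=\sum_i k_i$. **Theorem.** Let $m,n\in\mathbb N$ and let $|\psi\rangle$ be a pure Gaussian state of $m+n$ modes. 1. There are an $m$-mode Gaussian unitary $U$ and an $(m+n)$-mode pure Gaussian state $|\psi_{\rm core}\rangle$ with $$|\psi\rangle=(U\otimes\mathbb 1)|\psi_{\rm core}\rangle=(U\otimes\mathbb 1)\sum_{k\in\mathbb N^n}|{\rm core}_k\rangle|k\rangle=(U\otimes\mathbb 1)\sum_{k\in\mathbb N^n}\Big(\sum_{j\in J^m_{\|k\|_1}}a_{j,k}|j\rangle\Big)|k\rangle ,\qquad a_{j,k}\in\mathbb C,$$ where $|{\rm core}_k\rangle=(\mathbb 1\otimes\langle k|)|\psi_{\rm core}\rangle$. So projecting the last $n$ modes of $|\psi_{\rm core}\rangle$ onto a Fock state $|k\rangle$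 leaves a vector with Fock support in $J^m_{\|k\|_1}$. Call $(U,|\psi_{\rm core}\rangle)$ a stellar decomposition of $|\psi\rangle$. 2. Let $(A,b,c)$ be the Abc parameters of $|\psi\rangle$, with $A=\begin{bmatrix}x&R^{\mathrm T}\\R&y\end{bmatrix}$ and $b=\begin{bmatrix}u\\v\end{bmatrix}$ in blocks of sizes $m,n$. Put $H=\mathbb 1-x^*x$ and $t=x^*u+u^*$. Then $H$ has a positive definite square root $\sqrt H$. For every $\Gamma\in\mathbb C^{m\times m}$ with $\Gamma^\dagger\Gamma=H$ (for instance $\Gamma=\sqrt H$, for which the lower right block of $A_U$ below is $-x^*$), and for all $c_U,c_{\rm core}\in\mathbb C$ with $|c_U|=\det(H)^{1/4}\exp\!\big(-\tfrac12\operatorname{Re}(u^{\mathrm T}H^{-1}t)\big)$ and $c_U\,c_{\rm core}=c$, there is a stellar decomposition $(U,|\psi_{\rm core}\rangle)$ of $|\psi\rangle$ with Abc parameters $$A_U=\begin{bmatrix}x&\Gamma^{\mathrm T}\\ \Gamma&-(\Gamma^\dagger)^{-1}x^*\Gamma^{\mathrm T}\end{bmatrix},\quad b_U=\begin{bmatrix}u\\-(\Gamma^\dagger)^{-1}t\end{bmatrix},\quad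 c_U,$$ $$A_{\rm core}=\begin{bmatrix}0&(R\Gamma^{-1})^{\mathrm T}\\R\Gamma^{-1}&y+RH^{-1}x^*R^{\mathrm T}\end{bmatrix},\quad b_{\rm core}=\begin{bmatrix}0\\v+RH^{-1}t\end{bmatrix},\quad c_{\rm core}.$$ 3. Such parameters can be computed in time $O((m+n)^3)$: there are a single program and a constant $K$ such that, for all $m,n$ and all $|\psi\rangle$, the program, given $m,n,A,b,c$, outputs the Abc parameters $(A_U,b_U,c_U)$ and $(A_{\rm core},b_{\rm core},c_{\rm core})$ of a stellar decomposition of $|\psi\rangle$, of the form in part 2 for some $\Gamma$ with $\Gamma^\dagger\Gamma=H$, and takes at most $K(m+n)^3$ steps if $m+n\ge1$. Here a program runs on a random access machine with registers for natural numbers and arrays of exact complex numbers; index arithmetic ($+$, $-$), field operations, complex conjugation, and the square root and exponential of real numbers have unit cost. -/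

import Mathlib

open scoped Matrix ComplexOrder

noncomputable section

namespace Stellar

/-! ## Fock space -/

/-- The Hilbert space of a bosonic system with one mode for every element of `ι`, in the Fock
(photon-number) basis: square-summable families of amplitudes indexed by the tuples `ι → ℕ`. -/
abbrev Fock (ι : Type) [Fintype ι] : Type := lp (fun _ : ι → ℕ => ℂ) 2

/-- The Fock state `|k⟩`. -/
def ket {ι : Type} [Fintype ι] [DecidableEq ι] (k : ι → ℕ) : Fock ι :=
  lp.single 2 k (1 : ℂ)

/-- The vector `a_i |k⟩ = √k_i |k - 1_i⟩`. -/
def lowerKet {ι : Type} [Fintype ι] [DecidableEq ι] (i : ι) (k : ι → ℕ) : Fock ι :=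
  ((Real.sqrt (k i) : ℝ) : ℂ) • ket (Function.update k i (k i - 1))

/-- The vector `a_i† |k⟩ = √(k_i + 1) |k + 1_i⟩`. -/
def raiseKet {ι : Type} [Fintype ι] [DecidableEq ι] (i : ι) (k : ι → ℕ) : Fock ι :=
  ((Real.sqrt (k i + 1) : ℝ) : ℂ) • ket (Function.update k i (k i + 1))

/-- The amplitudes of `a_i φ` (which is a vector of the Hilbert space iff they are
square-summable, i.e. iff `φ` lies in the domain of `a_i`). -/
def annihilate {ι : Type} [Fintype ι] [DecidableEq ι] (i : ι) (φ : Fock ι) : (ι → ℕ) → ℂ :=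
  fun j => ((Real.sqrt (j i + 1) : ℝ) : ℂ) * φ (Function.update j i (j i + 1))

/-- The amplitudes of `a_i† φ` (which is a vector of the Hilbert space iff they are
square-summable, i.e. iff `φ` lies in the domain of `a_i†`). -/
def create {ι : Type} [Fintype ι] [DecidableEq ι] (i : ι) (φ : Fock ι) : (ι → ℕ) → ℂ :=
  fun j => ((Real.sqrt (j i) : ℝ) : ℂ) * φ (Function.update j i (j i - 1))

/-! ## Bargmann functions and Abc parametrizations -/

/-- The Bargmann function `z ^ k / √(k!)` of the Fock state `|k⟩`. -/
def fockMonomial {ι : Type} [Fintype ι] (z : ι → ℂ) (k : ι → ℕ) : ℂ :=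
  ∏ i, z i ^ k i / ((Real.sqrt ((k i).factorial : ℝ) : ℝ) : ℂ)

theorem summable_fockMonomial_sq {ι : Type} [Fintype ι] (z : ι → ℂ) :
    Summable fun k : ι → ℕ => ‖fockMonomial z k‖ ^ 2 := by
  classical
  have hterm : ∀ k : ι → ℕ,
      ‖fockMonomial z k‖ ^ 2 = ∏ i, ((‖z i‖ ^ 2) ^ k i / ((k i).factorial : ℝ)) := by
    intro k
    rw [fockMonomial, norm_prod, ← Finset.prod_pow]
    refine Finset.prod_congr rfl fun i _ => ?_
    rw [norm_div, norm_pow, div_pow, Complex.norm_real, Real.norm_eq_abs, sq_abs,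
      Real.sq_sqrt (Nat.cast_nonneg _), ← pow_mul, ← pow_mul, mul_comm]
  refine summable_of_sum_le (c := ∏ i, Real.exp (‖z i‖ ^ 2)) (fun k => by positivity) ?_
  intro s
  have hsub : s ⊆ Fintype.piFinset fun i => s.image fun k => k i := by
    intro k hk
    rw [Fintype.mem_piFinset]
    exact fun i => Finset.mem_image_of_mem (fun k : ι → ℕ => k i) hk
  calc ∑ k ∈ s, ‖fockMonomial z k‖ ^ 2
      ≤ ∑ k ∈ Fintype.piFinset fun i => s.image fun k => k i, ‖fockMonomial z k‖ ^ 2 :=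
        Finset.sum_le_sum_of_subset_of_nonneg hsub fun _ _ _ => by positivity
    _ = ∑ k ∈ Fintype.piFinset fun i => s.image fun k => k i,
          ∏ i, ((‖z i‖ ^ 2) ^ k i / ((k i).factorial : ℝ)) :=
        Finset.sum_congr rfl fun k _ => hterm k
    _ = ∏ i, ∑ q ∈ s.image fun k => k i, ((‖z i‖ ^ 2) ^ q / (q.factorial : ℝ)) :=
        (Finset.prod_univ_sum (fun i => s.image fun k => k i)
          fun i q => ((‖z i‖ ^ 2) ^ q / (q.factorial : ℝ))).symm
    _ ≤ ∏ i, Real.exp (‖z i‖ ^ 2) := by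
        refine Finset.prod_le_prod (fun i _ => Finset.sum_nonneg fun _ _ => by positivity) ?_
        intro i _
        rw [Real.exp_eq_exp_ℝ, NormedSpace.exp_eq_tsum_div]
        exact (Real.summable_pow_div_factorial _).sum_le_tsum _ fun _ _ => by positivity

/-- The rescaled coherent state `exp(‖w‖² / 2) |w⟩ = ∑_k w ^ k / √(k!) |k⟩`. -/
def bargmannVector {ι : Type} [Fintype ι] (w : ι → ℂ) : Fock ι :=
  ⟨fockMonomial w, memℓp_gen (by simpa using summable_fockMonomial_sq w)⟩

/-- `F` is the Bargmann function `F(z) = exp(‖z‖² / 2) ⟨z*|φ⟩ = ∑_k φ_k z ^ k / √(k!)` of `φ`. -/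
def IsBargmannFunction {ι : Type} [Fintype ι] (φ : Fock ι) (F : (ι → ℂ) → ℂ) : Prop :=
  ∀ z, HasSum (fun k => φ k * fockMonomial z k) (F z)

/-- The Gaussian function `c exp(zᵀ A z / 2 + zᵀ b)`. -/
def gaussian {ι : Type} [Fintype ι] (A : Matrix ι ι ℂ) (b : ι → ℂ) (c : ℂ) (z : ι → ℂ) : ℂ :=
  c * Complex.exp (1 / 2 * (z ⬝ᵥ (A *ᵥ z)) + z ⬝ᵥ b)

/-- `(A, b, c)` is the Abc parametrization of the vector `φ`. -/
def IsKetAbc {ι : Type} [Fintype ι] (φ : Fock ι) (A : Matrix ι ι ℂ) (b : ι → ℂ) (c : ℂ) : Prop :=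
  A.IsSymm ∧ IsBargmannFunction φ (gaussian A b c)

/-- `(A, b, c)` is the Abc parametrization of `U`, whose Bargmann function is
`F(z, w) = exp((‖z‖² + ‖w‖²) / 2) ⟨z*|U|w⟩`, in output-input order: `Sum.inl` indexes the output
variables `z`, `Sum.inr` the input variables `w`. -/
def IsUnitaryAbc {ι : Type} [Fintype ι] (U : Fock ι ≃ₗᵢ[ℂ] Fock ι)
    (A : Matrix (ι ⊕ ι) (ι ⊕ ι) ℂ) (b : ι ⊕ ι → ℂ) (c : ℂ) : Prop :=
  A.IsSymm ∧
    ∀ w, IsBargmannFunction (U (bargmannVector w)) fun z => gaussian A b c (Sum.elim z w)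

/-- Pure Gaussian states: unit vectors whose Bargmann function is Gaussian. -/
def IsGaussianState {ι : Type} [Fintype ι] (φ : Fock ι) : Prop :=
  ‖φ‖ = 1 ∧ ∃ A b c, IsKetAbc φ A b c

/-- Gaussian unitaries: the unitaries that act on the ladder operators (equivalently, on the
quadratures) by an affine symplectic transformation,
`a_i U = ∑_l (S₁_il U a_l + S₂_il U a_l†) + γ_i U` and
`a_i† U = ∑_l (S₂*_il U a_l + S₁*_il U a_l†) + γ*_i U`.
The two equations between `S₁` and `S₂` say that the real form of the matrix
`[[S₁, S₂], [S₂*, S₁*]]` is symplectic. -/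
def IsGaussianUnitary {ι : Type} [Fintype ι] [DecidableEq ι] (U : Fock ι ≃ₗᵢ[ℂ] Fock ι) : Prop :=
  ∃ (S₁ S₂ : Matrix ι ι ℂ) (γ : ι → ℂ),
    S₁ * S₁ᴴ - S₂ * S₂ᴴ = 1 ∧ S₁ * S₂ᵀ = S₂ * S₁ᵀ ∧
    (∀ i k, annihilate i (U (ket k)) =
      ⇑(U (∑ l, (S₁ i l • lowerKet l k + S₂ i l • raiseKet l k) + γ i • ket k))) ∧
    (∀ i k, create i (U (ket k)) =
      ⇑(U (∑ l, (star (S₂ i l) • lowerKet l k + star (S₁ i l) • raiseKet l k)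
        + star (γ i) • ket k)))

/-! ## Bipartite systems

The modes of `M` are indexed by `ι` (`Sum.inl`), those of `N` by `κ` (`Sum.inr`). -/

theorem summable_sq {ι : Type} [Fintype ι] (φ : Fock ι) : Summable fun k => ‖φ k‖ ^ 2 := by
  simpa using (lp.memℓp φ).summable (by norm_num)

theorem summable_sq_prod {ι κ : Type} [Fintype ι] [Fintype κ] (ψ : Fock (ι ⊕ κ)) :
    Summable fun p : (κ → ℕ) × (ι → ℕ) => ‖ψ (Sum.elim p.2 p.1)‖ ^ 2 :=
  (summable_sq ψ).comp_injective (i := fun p : (κ → ℕ) × (ι → ℕ) => Sum.elim p.2 p.1) <| by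
    rintro ⟨k, j⟩ ⟨k₁, j₁⟩ h
    have h1 : j = j₁ := funext fun i => by simpa using congrFun h (Sum.inl i)
    have h2 : k = k₁ := funext fun i => by simpa using congrFun h (Sum.inr i)
    rw [h1, h2]

/-- The (unnormalized) vector `(1 ⊗ ⟨k|) ψ` on `M` left by projecting `N` onto `|k⟩`. -/
def project {ι κ : Type} [Fintype ι] [Fintype κ] (k : κ → ℕ) (ψ : Fock (ι ⊕ κ)) : Fock ι :=
  ⟨fun j => ψ (Sum.elim j k), memℓp_gen (by simpa using (summable_sq_prod ψ).prod_factor k)⟩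

theorem norm_sq_eq_tsum {ι : Type} [Fintype ι] (φ : Fock ι) :
    ‖φ‖ ^ 2 = ∑' k, ‖φ k‖ ^ 2 := by
  have h := lp.norm_rpow_eq_tsum (p := 2) (by norm_num) φ
  simpa using h

theorem summable_of_slices {ι κ : Type} [Fintype ι] [Fintype κ] (f : (κ → ℕ) → Fock ι)
    (hf : Summable fun k => ‖f k‖ ^ 2) :
    Summable fun l : ι ⊕ κ → ℕ => ‖f (l ∘ Sum.inr) (l ∘ Sum.inl)‖ ^ 2 := by
  have h : Summable fun p : (κ → ℕ) × (ι → ℕ) => ‖f p.1 p.2‖ ^ 2 := by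
    rw [summable_prod_of_nonneg fun p => by positivity]
    exact ⟨fun k => summable_sq (f k), by simpa only [norm_sq_eq_tsum] using hf⟩
  refine h.comp_injective (i := fun l : ι ⊕ κ → ℕ => (l ∘ Sum.inr, l ∘ Sum.inl)) ?_
  intro l₁ l₂ h12
  obtain ⟨h2, h1⟩ := Prod.mk.inj h12
  funext s
  rcases s with i | i
  · exact congrFun h1 i
  · exact congrFun h2 i

theorem summable_norm_project {ι κ : Type} [Fintype ι] [Fintype κ] (ψ : Fock (ι ⊕ κ)) :
    Summable fun k : κ → ℕ => ‖project k ψ‖ ^ 2 := by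
  simp only [norm_sq_eq_tsum]
  exact (summable_sq_prod ψ).prod

/-- The product vector `φ ⊗ χ`. -/
def tensor {ι κ : Type} [Fintype ι] [Fintype κ] (φ : Fock ι) (χ : Fock κ) : Fock (ι ⊕ κ) :=
  ⟨fun l => χ (l ∘ Sum.inr) * φ (l ∘ Sum.inl), memℓp_gen (by
    have h := summable_of_slices (fun k => χ k • φ) (by
      simpa only [norm_smul, mul_pow] using (summable_sq χ).mul_right (‖φ‖ ^ 2))
    simpa using h)⟩

/-- The vector `(U ⊗ 1) ψ`: the operator `U` acts on every slice `(1 ⊗ ⟨k|) ψ`. -/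
def applyFirst {ι κ : Type} [Fintype ι] [Fintype κ] (U : Fock ι ≃ₗᵢ[ℂ] Fock ι)
    (ψ : Fock (ι ⊕ κ)) : Fock (ι ⊕ κ) :=
  ⟨fun l => U (project (l ∘ Sum.inr) ψ) (l ∘ Sum.inl), memℓp_gen (by
    have h := summable_of_slices (fun k => U (project k ψ)) (by
      simpa only [LinearIsometryEquiv.norm_map] using summable_norm_project ψ)
    simpa using h)⟩

/-! ## The decomposition -/

/-- The set `J_q` of the tuples of non-negative integers with sum at most `q`. -/
def tuplesUpTo (ι : Type) [Fintype ι] [DecidableEq ι] (q : ℕ) : Finset (ι → ℕ) :=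
  (Fintype.piFinset fun _ => Finset.range (q + 1)).filter fun j => ∑ i, j i ≤ q

/-- `ψ = (U ⊗ 1) core` with a Gaussian unitary `U` on `M` and a Gaussian state
`core = ∑_k |core_k⟩ |k⟩`, `|core_k⟩ = ∑_{j ∈ J_{‖k‖₁}} a_{j,k} |j⟩`, where `|core_k⟩` is the result
of projecting the modes `N` of `core` onto `|k⟩`. -/
def IsStellarDecomposition {ι κ : Type} [Fintype ι] [DecidableEq ι] [Fintype κ] [DecidableEq κ]
    (ψ : Fock (ι ⊕ κ)) (U : Fock ι ≃ₗᵢ[ℂ] Fock ι) (core : Fock (ι ⊕ κ)) : Prop :=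
  IsGaussianUnitary U ∧ IsGaussianState core ∧ ψ = applyFirst U core ∧
    HasSum (fun k : κ → ℕ => tensor (project k core) (ket k)) core ∧
    ∃ a : (ι → ℕ) → (κ → ℕ) → ℂ, ∀ k : κ → ℕ,
      project k core = ∑ j ∈ tuplesUpTo ι (∑ i, k i), a j k • ket j

/-- The Abc parameters of a unitary on `M` (output-input order) and of a vector on `MN`. -/
structure AbcPair (ι κ : Type) where
  AU : Matrix (ι ⊕ ι) (ι ⊕ ι) ℂ
  bU : ι ⊕ ι → ℂ
  cU : ℂ
  AC : Matrix (ι ⊕ κ) (ι ⊕ κ) ℂ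
  bC : ι ⊕ κ → ℂ
  cC : ℂ

/-- The six entries of `d` are the Abc parameters of the two parts of a stellar decomposition
of `ψ`. -/
def AbcPair.Decomposes {ι κ : Type} [Fintype ι] [DecidableEq ι] [Fintype κ] [DecidableEq κ]
    (d : AbcPair ι κ) (ψ : Fock (ι ⊕ κ)) : Prop :=
  ∃ (U : Fock ι ≃ₗᵢ[ℂ] Fock ι) (core : Fock (ι ⊕ κ)),
    IsStellarDecomposition ψ U core ∧
      IsUnitaryAbc U d.AU d.bU d.cU ∧ IsKetAbc core d.AC d.bC d.cC

/-- The matrix `1 - x* x`, where `x` is the block of `A` on `M` and `x*` its entrywise conjugate. -/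
def gram {ι κ : Type} [Fintype ι] [DecidableEq ι] (A : Matrix (ι ⊕ κ) (ι ⊕ κ) ℂ) :
    Matrix ι ι ℂ :=
  1 - A.toBlocks₁₁.map star * A.toBlocks₁₁

/-- The explicit Abc parameters, with `A = [[x, Rᵀ], [R, y]]`, `b = (u, v)`, `H = 1 - x* x` and a
matrix `Γ` with `Γᴴ Γ = H`. The phase of `c` may be split arbitrarily. -/
def AbcPair.Explicit {ι κ : Type} [Fintype ι] [DecidableEq ι] [Fintype κ]
    (d : AbcPair ι κ) (A : Matrix (ι ⊕ κ) (ι ⊕ κ) ℂ) (b : ι ⊕ κ → ℂ) (c : ℂ)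
    (Γ : Matrix ι ι ℂ) : Prop :=
  let x := A.toBlocks₁₁
  let R := A.toBlocks₂₁
  let y := A.toBlocks₂₂
  let u : ι → ℂ := b ∘ Sum.inl
  let v : κ → ℂ := b ∘ Sum.inr
  let H := gram A
  let t : ι → ℂ := x.map star *ᵥ u + star u
  Γᴴ * Γ = H ∧
  d.AU = Matrix.fromBlocks x Γᵀ Γ (-(Γᴴ⁻¹ * x.map star * Γᵀ)) ∧
  d.bU = Sum.elim u (-(Γᴴ⁻¹ *ᵥ t)) ∧
  ‖d.cU‖ = Real.sqrt (Real.sqrt H.det.re) * Real.exp (-(1 / 2) * (u ⬝ᵥ (H⁻¹ *ᵥ t)).re) ∧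
  d.AC = Matrix.fromBlocks 0 (R * Γ⁻¹)ᵀ (R * Γ⁻¹) (y + R * H⁻¹ * x.map star * Rᵀ) ∧
  d.bC = Sum.elim (0 : ι → ℂ) (v + R *ᵥ (H⁻¹ *ᵥ t)) ∧
  d.cU * d.cC = c

/-! ## The machine model

A random access machine over the complex numbers. A program has finitely many registers for natural
numbers (loop counters and indices) and finitely many two-dimensional arrays of complex numbers.
Every operation has unit cost. -/

/-- The memory: `reg r` is the content of the register `r`, and `mem a i j` is the entry in row `i`
and column `j` of the array `a`. -/
structure Store where
  reg : ℕ → ℕ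
  mem : ℕ → ℕ → ℕ → ℂ

/-- Index expressions. -/
inductive IdxExpr where
  | lit (q : ℕ)
  | reg (r : ℕ)
  | add (e f : IdxExpr)
  | sub (e f : IdxExpr)

/-- The value of an index expression (subtraction is truncated). -/
def IdxExpr.eval (σ : Store) : IdxExpr → ℕ
  | lit q => q
  | reg r => σ.reg r
  | add e f => e.eval σ + f.eval σ
  | sub e f => e.eval σ - f.eval σ

/-- The number of operations in an index expression. -/
def IdxExpr.cost : IdxExpr → ℕ
  | lit _ => 1
  | reg _ => 1
  | add e f => e.cost + f.cost + 1
  | sub e f => e.cost + f.cost + 1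

/-- Arithmetic expressions: integer constants, array entries, field operations, complex
conjugation, and the square root and exponential of real numbers. -/
inductive NumExpr where
  | lit (q : ℕ)
  | get (a : ℕ) (i j : IdxExpr)
  | add (e f : NumExpr)
  | sub (e f : NumExpr)
  | mul (e f : NumExpr)
  | div (e f : NumExpr)
  | conj (e : NumExpr)
  | sqrt (e : NumExpr)
  | exp (e : NumExpr)

/-- The value of an arithmetic expression (`sqrt` and `exp` act on the real part of their
argument). -/
def NumExpr.eval (σ : Store) : NumExpr → ℂ
  | lit q => (q : ℂ)
  | get a i j => σ.mem a (i.eval σ) (j.eval σ)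
  | add e f => e.eval σ + f.eval σ
  | sub e f => e.eval σ - f.eval σ
  | mul e f => e.eval σ * f.eval σ
  | div e f => e.eval σ / f.eval σ
  | conj e => star (e.eval σ)
  | sqrt e => ((Real.sqrt (e.eval σ).re : ℝ) : ℂ)
  | exp e => ((Real.exp (e.eval σ).re : ℝ) : ℂ)

/-- The number of operations in an arithmetic expression. -/
def NumExpr.cost : NumExpr → ℕ
  | lit _ => 1
  | get _ i j => i.cost + j.cost + 1
  | add e f => e.cost + f.cost + 1
  | sub e f => e.cost + f.cost + 1
  | mul e f => e.cost + f.cost + 1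
  | div e f => e.cost + f.cost + 1
  | conj e => e.cost + 1
  | sqrt e => e.cost + 1
  | exp e => e.cost + 1

/-- Programs: assignment to a register, assignment to an array entry, sequential composition,
and the loop `for r = 0, …, e - 1 do body`. -/
inductive Program where
  | assign (r : ℕ) (e : IdxExpr)
  | store (a : ℕ) (i j : IdxExpr) (e : NumExpr)
  | seq (p q : Program)
  | loop (r : ℕ) (e : IdxExpr) (body : Program)

/-- The memory after the assignment of `q` to the register `r`. -/
def Store.setReg (σ : Store) (r q : ℕ) : Store :=
  { σ with reg := Function.update σ.reg r q }

/-- The memory after the assignment of `x` to the entry `(i, j)` of the array `a`. -/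
def Store.setMem (σ : Store) (a i j : ℕ) (x : ℂ) : Store :=
  { σ with mem := fun a₁ i₁ j₁ => if a₁ = a ∧ i₁ = i ∧ j₁ = j then x else σ.mem a₁ i₁ j₁ }

/-- Execution: the final memory and the number of steps. The bound of a loop is evaluated once, and
every iteration costs one step in addition to the steps of the body. -/
def Program.run : Program → Store → Store × ℕ
  | assign r e, σ => (σ.setReg r (e.eval σ), e.cost + 1)
  | store a i j e, σ =>
      (σ.setMem a (i.eval σ) (j.eval σ) (e.eval σ), i.cost + j.cost + e.cost + 1)
  | seq p q, σ => ((q.run (p.run σ).1).1, (p.run σ).2 + (q.run (p.run σ).1).2)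
  | loop r e body, σ =>
      Nat.rec (motive := fun _ => Store × ℕ) (σ, e.cost + 1)
        (fun i s => ((body.run (s.1.setReg r i)).1, s.2 + (body.run (s.1.setReg r i)).2 + 1))
        (e.eval σ)

/-- The row (or column) number of an index of a block matrix: the first block comes first. -/
def position {m n : ℕ} : Fin m ⊕ Fin n → ℕ :=
  Sum.elim (fun i => (i : ℕ)) fun i => m + (i : ℕ)

/-- The matrix in the array `a`. -/
def Store.matrix (σ : Store) (a m n : ℕ) : Matrix (Fin m ⊕ Fin n) (Fin m ⊕ Fin n) ℂ :=
  fun i j => σ.mem a (position i) (position j)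

/-- The vector in the first column of the array `a`. -/
def Store.vector (σ : Store) (a m n : ℕ) : Fin m ⊕ Fin n → ℂ :=
  fun i => σ.mem a (position i) 0

/-- The memory `σ` holds the input: the numbers of modes in the registers `0`, `1`, and the Abc
parameters in the arrays `0`, `1`, `2`. The rest of the memory is arbitrary. -/
def Store.HoldsInput (σ : Store) (m n : ℕ) (A : Matrix (Fin m ⊕ Fin n) (Fin m ⊕ Fin n) ℂ)
    (b : Fin m ⊕ Fin n → ℂ) (c : ℂ) : Prop :=
  σ.reg 0 = m ∧ σ.reg 1 = n ∧ σ.matrix 0 m n = A ∧ σ.vector 1 m n = b ∧ σ.mem 2 0 0 = c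

/-- The output: two Abc triples in the arrays `3`, …, `8`. -/
def Store.output (σ : Store) (m n : ℕ) : AbcPair (Fin m) (Fin n) where
  AU := σ.matrix 3 m m
  bU := σ.vector 4 m m
  cU := σ.mem 5 0 0
  AC := σ.matrix 6 m n
  bC := σ.vector 7 m n
  cC := σ.mem 8 0 0

end Stellar

end

open scoped Matrix ComplexOrder

noncomputable section

namespace Stellar

/-! ## Bargmann functions: uniqueness -/

/-! Bargmann functions reduce the theorem to the algebra of Gaussian functions. A vector is
determined by its Bargmann function (`HasExpansion.eq_zero`), whose value at `z` is an overlap with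
the coherent vector at `z*`. So coherent vectors are total, and a unitary may be prescribed by its
values on them, provided overlaps are preserved and an adjoint is given in the same way
(`exists_unitary_of_inner`).

Fix the variables `y` of the last `n` modes. As a function of `z`, the Bargmann function of `ψ` is
Gaussian with matrix `x` and linear term `u + Rᵀ y`. A unitary `U` with upper blocks `x`, `Γᵀ` and
linear term `u` sends the rescaled coherent vector at `w` to a Gaussian with the same matrix `x` and
linear term `u + Γᵀ w`. With `w = (R Γ⁻¹)ᵀ y` the two agree up to a factor depending on `y` only.
Hence `U⁻¹` turns the slices of `ψ` into multiples of coherent vectors: the core has Bargmann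
function `exp(zᵀ (R Γ⁻¹)ᵀ y)` times a Gaussian in `y`, and its parameters can be read off
(`AbcPair.Explicit.decomposes`). The equation `∂F/∂z_i = ((R Γ⁻¹)ᵀ y)_i F` then says that every
photon in the first modes is paid for by one in the last modes, which bounds the Fock support
(`apply_eq_zero_of_isKetAbc`).

It remains to construct `U`. The symmetric matrix `x` is `V D Vᵀ` with `V` unitary and `D` real
diagonal (`exists_takagi`). Normalized coherent states tend weakly to zero along rays, which forces
`Re zᵀ x z < ‖z‖²` (`re_dotProduct_mulVec_lt`), so `|d_i| < 1` and `H = V* (1 - D²) Vᵀ` is positive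
definite. Squeezers with parameters `d` come from Gaussian averages of coherent vectors
(`exists_squeezer`). Composing them with passive unitaries and a displacement reaches every `Γ` with
`Γᴴ Γ = H` (`exists_unitary_isUnitaryAbc`). The first-order differential equations of a Gaussian
kernel in its output and input variables yield the symplectic action on the ladder operators
(`isGaussianUnitary_of_isUnitaryAbc`).

For the algorithm any `Γ` will do, so the Cholesky factor replaces the Hermitian square root. The
row recursion applied to `[H, 1]` returns `[Γ, (Γᴴ)⁻¹]`; all else is a fixed number of matrix
products and scalar operations. The program is assembled from passes that each fill one block by
sums, so that its correctness becomes a list of equations for the final memory. -/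

theorem eq_zero_of_hasSum_pow_zero {a : ℕ → ℂ} (h : ∀ t : ℂ, HasSum (fun n => a n * t ^ n) 0) :
    a = 0 := by
  have hp : HasFPowerSeriesAt (0 : ℂ → ℂ) (FormalMultilinearSeries.ofScalars ℂ a) 0 := by
    refine ⟨1, ?_, by simp, ?_⟩
    · refine FormalMultilinearSeries.le_radius_of_summable (r := 1) _ ?_
      have := (h 1).summable.norm
      simpa [FormalMultilinearSeries.ofScalars_norm] using this
    · intro y _
      have := h y
      simpa [FormalMultilinearSeries.ofScalars_apply_eq, mul_comm] using this
  funext n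
  have h0 : (FormalMultilinearSeries.ofScalars ℂ a).coeff n = 0 := by
    rw [hp.eq_zero]
    rfl
  simpa [FormalMultilinearSeries.coeff_ofScalars] using h0

/-- `f` is the family of coefficients of the entire function `F` in the basis `z ^ k / √(k!)`. -/
def HasExpansion {ι : Type} [Fintype ι] (f : (ι → ℕ) → ℂ) (F : (ι → ℂ) → ℂ) : Prop :=
  ∀ z, HasSum (fun k => f k * fockMonomial z k) (F z)

section

variable {ι κ : Type} [Fintype ι] [Fintype κ]

theorem fockMonomial_eq (z : ι → ℂ) (k : ι → ℕ) :
    fockMonomial z k = (∏ i, z i ^ k i) * ∏ i, (((Real.sqrt ((k i).factorial : ℝ))⁻¹ : ℝ) : ℂ) := by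
  simp [fockMonomial, div_eq_mul_inv, Finset.prod_mul_distrib]

theorem fockMonomial_smul (t : ℂ) (z : ι → ℂ) (k : ι → ℕ) :
    fockMonomial (t • z) k = t ^ (∑ i, k i) * fockMonomial z k := by
  rw [fockMonomial_eq, fockMonomial_eq, ← mul_assoc, ← Finset.prod_pow_eq_pow_sum,
    ← Finset.prod_mul_distrib]
  simp [mul_pow, Finset.prod_mul_distrib]

theorem inv_sqrt_factorial_prod_ne_zero (k : ι → ℕ) :
    (∏ i, (((Real.sqrt ((k i).factorial : ℝ))⁻¹ : ℝ) : ℂ)) ≠ 0 := by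
  rw [Finset.prod_ne_zero_iff]
  intro i _
  rw [Complex.ofReal_ne_zero]
  have : 0 < Real.sqrt ((k i).factorial : ℝ) :=
    Real.sqrt_pos.2 (by exact_mod_cast Nat.factorial_pos _)
  positivity

theorem finite_setOf_sum_eq (q : ℕ) : {k : ι → ℕ | ∑ i, k i = q}.Finite := by
  classical
  refine Set.Finite.subset (Fintype.piFinset fun _ : ι => Finset.range (q + 1)).finite_toSet ?_
  intro k hk
  rw [Finset.mem_coe, Fintype.mem_piFinset]
  intro i
  have := Finset.single_le_sum (f := k) (fun _ _ => Nat.zero_le _) (Finset.mem_univ i)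
  rw [Finset.mem_range]
  have hk' : ∑ i, k i = q := hk
  omega

theorem hasSum_fiber_sum_eq (q : ℕ) (g : (ι → ℕ) → ℂ) :
    HasSum (fun k : {k : ι → ℕ // ∑ i, k i = q} => g k)
      (∑ k ∈ (finite_setOf_sum_eq (ι := ι) q).toFinset, g k) := by
  have : Fintype {k : ι → ℕ // ∑ i, k i = q} := (finite_setOf_sum_eq (ι := ι) q).fintype
  rw [Finset.sum_subtype (p := fun k : ι → ℕ => ∑ i, k i = q) _ (by simp) g]
  exact hasSum_fintype _

/-- Along a line `t ↦ t • z` the expansion becomes a power series in `t` whose coefficients are the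
homogeneous parts at `z`. These vanish for all `z`, so they are zero polynomials, and the weights `1
/ √(k!)` are nonzero. -/
theorem HasExpansion.eq_zero {f : (ι → ℕ) → ℂ} (h : HasExpansion f 0) : f = 0 := by
  classical
  have hpoly : ∀ (q : ℕ) (z : ι → ℂ),
      ∑ k ∈ (finite_setOf_sum_eq (ι := ι) q).toFinset, f k * fockMonomial z k = 0 := by
    intro q z
    refine congrFun (eq_zero_of_hasSum_pow_zero (a := fun q =>
      ∑ k ∈ (finite_setOf_sum_eq (ι := ι) q).toFinset, f k * fockMonomial z k) fun t => ?_) q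
    -- Regrouping by total degree is legitimate because the sum is unconditional.
    have h1 : HasSum (fun p : Σ q, {k : ι → ℕ // ∑ i, k i = q} =>
        f p.2 * fockMonomial (t • z) p.2) 0 :=
      (Equiv.sigmaFiberEquiv fun k : ι → ℕ => ∑ i, k i).hasSum_iff.2 (h (t • z))
    refine HasSum.sigma h1 fun q => ?_
    convert! hasSum_fiber_sum_eq q fun k => f k * fockMonomial (t • z) k using 1
    rw [Finset.sum_mul]
    refine Finset.sum_congr rfl fun k hk => ?_
    rw [Set.Finite.mem_toFinset] at hk
    have hk' : ∑ i, k i = q := hk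
    rw [fockMonomial_smul, hk']
    ring
  funext k₀
  set q := ∑ i, k₀ i with hq
  let S := (finite_setOf_sum_eq (ι := ι) q).toFinset
  let w : (ι → ℕ) → ℂ := fun k => f k * ∏ i, (((Real.sqrt ((k i).factorial : ℝ))⁻¹ : ℝ) : ℂ)
  have hP : (∑ k ∈ S, MvPolynomial.monomial (Finsupp.equivFunOnFinite.symm k) (w k)) = 0 := by
    refine MvPolynomial.funext fun z => ?_
    rw [map_sum, map_zero, ← hpoly q z]
    refine Finset.sum_congr rfl fun k _ => ?_
    rw [MvPolynomial.eval_monomial, fockMonomial_eq, Finsupp.prod_fintype _ _ (by simp)]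
    simp [w]
    ring
  have hc := congrArg (MvPolynomial.coeff (Finsupp.equivFunOnFinite.symm k₀)) hP
  rw [MvPolynomial.coeff_sum, MvPolynomial.coeff_zero, Finset.sum_eq_single k₀] at hc
  · rw [MvPolynomial.coeff_monomial, if_pos rfl] at hc
    exact (mul_eq_zero.1 hc).resolve_right (inv_sqrt_factorial_prod_ne_zero k₀)
  · intro k _ hk
    rw [MvPolynomial.coeff_monomial, if_neg]
    simpa using hk
  · intro hk
    simp [S, hq] at hk

theorem HasExpansion.ext {f g : (ι → ℕ) → ℂ} {F : (ι → ℂ) → ℂ} (hf : HasExpansion f F)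
    (hg : HasExpansion g F) : f = g := by
  refine sub_eq_zero.1 (HasExpansion.eq_zero (f := f - g) fun z => ?_)
  have := (hf z).sub (hg z)
  simpa [sub_mul] using this

/-! ## Coherent vectors -/

theorem fockMonomial_star (z : ι → ℂ) (k : ι → ℕ) :
    fockMonomial (star z) k = star (fockMonomial z k) := by
  simp [fockMonomial]

/-- The reproducing property. The conjugate compensates the antilinearity of the inner product in
its first argument, and the resulting uniqueness makes coherent vectors total. -/
theorem hasSum_bargmannVector (φ : Fock ι) (z : ι → ℂ) :
    HasSum (fun k => φ k * fockMonomial z k) (inner ℂ (bargmannVector (star z)) φ) := by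
  have := lp.hasSum_inner (𝕜 := ℂ) (bargmannVector (star z)) φ
  simpa [bargmannVector, fockMonomial_star] using this

theorem isBargmannFunction_iff {φ : Fock ι} {F : (ι → ℂ) → ℂ} :
    IsBargmannFunction φ F ↔ ∀ z, inner ℂ (bargmannVector (star z)) φ = F z :=
  ⟨fun h z => (hasSum_bargmannVector φ z).unique (h z), fun h z => h z ▸ hasSum_bargmannVector φ z⟩

theorem eq_zero_of_inner_bargmannVector {φ : Fock ι}
    (h : ∀ z, inner ℂ (bargmannVector z) φ = 0) : φ = 0 := by
  have : HasExpansion (⇑φ) 0 := fun z => by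
    simpa [h] using hasSum_bargmannVector φ z
  exact lp.ext this.eq_zero

theorem eq_of_inner_bargmannVector {φ χ : Fock ι}
    (h : ∀ z, inner ℂ (bargmannVector z) φ = inner ℂ (bargmannVector z) χ) : φ = χ :=
  sub_eq_zero.1 (eq_zero_of_inner_bargmannVector fun z => by rw [inner_sub_right, h, sub_self])

theorem IsBargmannFunction.ext {φ χ : Fock ι} {F : (ι → ℂ) → ℂ} (hφ : IsBargmannFunction φ F)
    (hχ : IsBargmannFunction χ F) : φ = χ :=
  lp.ext (HasExpansion.ext hφ hχ)

end

/-! ### Overlaps and totality of coherent vectors -/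

section

variable {ι κ : Type} [Fintype ι] [Fintype κ]

theorem summable_norm_pi_prod {f : ι → ℕ → ℂ} (hf : ∀ i, Summable (f i)) :
    Summable fun k : ι → ℕ => ‖∏ i, f i (k i)‖ := by
  classical
  refine summable_of_sum_le (c := ∏ i, ∑' n, ‖f i n‖) (fun k => norm_nonneg _) fun s => ?_
  have hsub : s ⊆ Fintype.piFinset fun i => s.image fun k => k i := by
    intro k hk
    rw [Fintype.mem_piFinset]
    exact fun i => Finset.mem_image_of_mem (fun k : ι → ℕ => k i) hk
  have h1 : ∑ k ∈ s, ‖∏ i, f i (k i)‖ ≤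
      ∑ k ∈ Fintype.piFinset fun i => s.image fun k => k i, ∏ i, ‖f i (k i)‖ := by
    simp only [norm_prod]
    exact Finset.sum_le_sum_of_subset_of_nonneg hsub fun _ _ _ =>
      Finset.prod_nonneg fun _ _ => norm_nonneg _
  have h2 := Finset.prod_univ_sum (fun i => s.image fun k => k i) fun i q => ‖f i q‖
  refine h1.trans (h2.symm.le.trans ?_)
  exact Finset.prod_le_prod (fun i _ => Finset.sum_nonneg fun _ _ => norm_nonneg _) fun i _ =>
    (hf i).norm.sum_le_tsum _ fun _ _ => norm_nonneg _

/-- The product family is absolutely summable, so its sum may be computed along the exhausting cubes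
`{0, …, N - 1}^ι`, on which it factors. -/
theorem hasSum_pi_prod {f : ι → ℕ → ℂ} {a : ι → ℂ} (hf : ∀ i, HasSum (f i) (a i)) :
    HasSum (fun k : ι → ℕ => ∏ i, f i (k i)) (∏ i, a i) := by
  classical
  have hs := (summable_norm_pi_prod fun i => (hf i).summable).of_norm.hasSum
  have hT : Filter.Tendsto (fun N : ℕ => Fintype.piFinset fun _ : ι => Finset.range N)
      Filter.atTop Filter.atTop := by
    refine Filter.tendsto_atTop_finset_of_monotone ?_ ?_
    · intro N M h
      exact Fintype.piFinset_subset _ _ fun _ => Finset.range_mono h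
    · intro k
      refine ⟨(∑ i, k i) + 1, ?_⟩
      rw [Fintype.mem_piFinset]
      intro i
      have := Finset.single_le_sum (f := k) (fun _ _ => Nat.zero_le _) (Finset.mem_univ i)
      rw [Finset.mem_range]
      omega
  have h1 := hs.comp hT
  have h2 : Filter.Tendsto (fun N : ℕ => ∏ i, ∑ n ∈ Finset.range N, f i n) Filter.atTop
      (nhds (∏ i, a i)) :=
    tendsto_finsetProd _ fun i _ => (hf i).tendsto_sum_nat
  have h3 := tendsto_nhds_unique h1 (h2.congr fun N => by
    rw [Finset.prod_univ_sum]
    rfl)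
  rwa [← h3]

theorem inner_bargmannVector_bargmannVector (z w : ι → ℂ) :
    inner ℂ (bargmannVector z) (bargmannVector w) = Complex.exp (star z ⬝ᵥ w) := by
  refine (lp.hasSum_inner (𝕜 := ℂ) (bargmannVector z) (bargmannVector w)).unique ?_
  rw [dotProduct, Complex.exp_sum]
  have h : ∀ i, HasSum (fun n : ℕ => (star z i * w i) ^ n / (n.factorial : ℂ))
      (Complex.exp (star z i * w i)) := fun i => by
    rw [Complex.exp_eq_exp_ℂ]
    exact NormedSpace.expSeries_div_hasSum_exp (star z i * w i)
  convert! hasSum_pi_prod h using 2 with k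
  simp only [bargmannVector, fockMonomial, RCLike.inner_apply, map_prod]
  rw [← Finset.prod_mul_distrib]
  refine Finset.prod_congr rfl fun i _ => ?_
  have hs : ((Real.sqrt ((k i).factorial : ℝ) : ℝ) : ℂ) *
      ((Real.sqrt ((k i).factorial : ℝ) : ℝ) : ℂ)
      = (k i).factorial := by
    rw [← Complex.ofReal_mul, Real.mul_self_sqrt (Nat.cast_nonneg _)]
    simp
  rw [← hs]
  simp [mul_pow, div_mul_div_comm, mul_comm]

theorem norm_bargmannVector_sq (w : ι → ℂ) :
    ‖bargmannVector w‖ ^ 2 = Real.exp (∑ i, ‖w i‖ ^ 2) := by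
  have h := inner_bargmannVector_bargmannVector w w
  rw [inner_self_eq_norm_sq_to_K] at h
  have e : star w ⬝ᵥ w = ((∑ i, ‖w i‖ ^ 2 : ℝ) : ℂ) := by
    simp only [dotProduct, Pi.star_apply, RCLike.star_def, Complex.conj_mul']
    push_cast
    rfl
  rw [e] at h
  refine Complex.ofReal_injective ?_
  rw [Complex.ofReal_exp, ← h]
  exact Complex.ofReal_pow _ _

theorem norm_bargmannVector (w : ι → ℂ) :
    ‖bargmannVector w‖ = Real.exp (1 / 2 * ∑ i, ‖w i‖ ^ 2) := by
  rw [← sq_eq_sq₀ (norm_nonneg _) (Real.exp_pos _).le, norm_bargmannVector_sq, ← Real.exp_nat_mul]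
  congr 1
  push_cast
  ring

/-- A vector orthogonal to all coherent vectors has Bargmann function zero. The form with
`Finsupp.linearCombination` is the one needed to extend maps by continuity. -/
theorem denseRange_linearCombination_bargmannVector :
    DenseRange (Finsupp.linearCombination ℂ (bargmannVector (ι := ι))) := by
  have h : (Submodule.span ℂ (Set.range (bargmannVector (ι := ι)))).topologicalClosure = ⊤ := by
    rw [Submodule.topologicalClosure_eq_top_iff, Submodule.eq_bot_iff]
    intro φ hφ
    exact eq_zero_of_inner_bargmannVector fun z =>
      (Submodule.mem_orthogonal _ _).1 hφ _ (Submodule.subset_span ⟨z, rfl⟩)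
  rw [← Finsupp.range_linearCombination] at h
  have h2 := Submodule.dense_iff_topologicalClosure_eq_top.2 h
  exact h2

/-! ## Unitaries from their action on coherent vectors -/

/-- The norm of a finite combination depends only on the Gram matrix. This makes `e a ↦ G a` well
defined and isometric on the span. -/
theorem inner_linearCombination {α E F : Type*} [NormedAddCommGroup E] [InnerProductSpace ℂ E]
    [NormedAddCommGroup F] [InnerProductSpace ℂ F] {e : α → E} {G : α → F}
    (h : ∀ a b, inner ℂ (G a) (G b) = inner ℂ (e a) (e b)) (p : α →₀ ℂ) :
    ‖Finsupp.linearCombination ℂ G p‖ = ‖Finsupp.linearCombination ℂ e p‖ := by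
  rw [@norm_eq_sqrt_re_inner ℂ, @norm_eq_sqrt_re_inner ℂ]
  simp only [Finsupp.linearCombination_apply, Finsupp.sum, sum_inner, inner_sum, inner_smul_left,
    inner_smul_right, h]

theorem exists_isometry_of_inner {G : (ι → ℂ) → Fock ι}
    (h : ∀ z w, inner ℂ (G z) (G w) = inner ℂ (bargmannVector z) (bargmannVector w)) :
    ∃ V : Fock ι →L[ℂ] Fock ι, (∀ φ, ‖V φ‖ = ‖φ‖) ∧ ∀ w, V (bargmannVector w) = G w := by
  have hd := denseRange_linearCombination_bargmannVector (ι := ι)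
  have hb : ∃ C, ∀ p, ‖Finsupp.linearCombination ℂ G p‖ ≤
      C * ‖Finsupp.linearCombination ℂ (bargmannVector (ι := ι)) p‖ :=
    ⟨1, fun p => by rw [one_mul, inner_linearCombination h]⟩
  refine ⟨(Finsupp.linearCombination ℂ G).extendOfNorm
    (Finsupp.linearCombination ℂ (bargmannVector (ι := ι))), ?_, fun w => ?_⟩
  · refine hd.induction ?_ (isClosed_eq (by fun_prop) continuous_norm)
    rintro _ ⟨p, rfl⟩
    rw [LinearMap.extendOfNorm_eq hd hb, inner_linearCombination h]
  · have := LinearMap.extendOfNorm_eq hd hb (Finsupp.single w 1)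
    simpa using this

/-- Preserved overlaps give only isometries `V` and `W`. By `hadj` they are adjoint to each other,
first against coherent vectors and then by density everywhere; two isometries adjoint to each other
are mutually inverse. -/
theorem exists_unitary_of_inner {G G' : (ι → ℂ) → Fock ι}
    (h : ∀ z w, inner ℂ (G z) (G w) = inner ℂ (bargmannVector z) (bargmannVector w))
    (h' : ∀ z w, inner ℂ (G' z) (G' w) = inner ℂ (bargmannVector z) (bargmannVector w))
    (hadj : ∀ z w, inner ℂ (bargmannVector z) (G w) = inner ℂ (G' z) (bargmannVector w)) :
    ∃ U : Fock ι ≃ₗᵢ[ℂ] Fock ι, (∀ w, U (bargmannVector w) = G w) ∧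
      ∀ w, U.symm (bargmannVector w) = G' w := by
  obtain ⟨V, hV, hVe⟩ := exists_isometry_of_inner h
  obtain ⟨W, hW, hWe⟩ := exists_isometry_of_inner h'
  let V₁ : Fock ι →ₗᵢ[ℂ] Fock ι := ⟨V.toLinearMap, hV⟩
  let W₁ : Fock ι →ₗᵢ[ℂ] Fock ι := ⟨W.toLinearMap, hW⟩
  have hVW : ∀ z φ, inner ℂ (bargmannVector z) (V φ) = inner ℂ (W (bargmannVector z)) φ := by
    intro z
    refine denseRange_linearCombination_bargmannVector.induction ?_
      (isClosed_eq (by fun_prop) (by fun_prop))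
    rintro _ ⟨p, rfl⟩
    simp only [Finsupp.linearCombination_apply, Finsupp.sum, inner_sum, map_sum, map_smul,
      inner_smul_right, hVe, hWe, hadj]
  have hWV : ∀ z φ, inner ℂ (bargmannVector z) (W φ) = inner ℂ (V (bargmannVector z)) φ := by
    intro z
    refine denseRange_linearCombination_bargmannVector.induction ?_
      (isClosed_eq (by fun_prop) (by fun_prop))
    rintro _ ⟨p, rfl⟩
    simp only [Finsupp.linearCombination_apply, Finsupp.sum, inner_sum, map_sum, map_smul,
      inner_smul_right, hVe, hWe]
    refine Finset.sum_congr rfl fun w _ => ?_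
    rw [← inner_conj_symm, ← hadj, inner_conj_symm]
  have hleft : ∀ φ, W (V φ) = φ := fun φ => eq_of_inner_bargmannVector fun z => by
    rw [hWV]
    exact V₁.inner_map_map _ _
  have hright : ∀ φ, V (W φ) = φ := fun φ => eq_of_inner_bargmannVector fun z => by
    rw [hVW]
    exact W₁.inner_map_map _ _
  refine ⟨⟨LinearEquiv.ofLinearMap V.toLinearMap W.toLinearMap (LinearMap.ext hright)
    (LinearMap.ext hleft), hV⟩, hVe, fun w => hWe w⟩

end

/-! ## Ladder operators on expansions -/

theorem raise_injective {ι : Type} [DecidableEq ι] (i : ι) :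
    Function.Injective fun j : ι → ℕ => Function.update j i (j i + 1) := by
  intro j₁ j₂ h
  funext l
  have hl := congrFun h l
  by_cases hli : l = i
  · subst hli
    simpa using hl
  · simpa [hli] using hl

theorem mem_range_raise {ι : Type} [DecidableEq ι] {i : ι} {k : ι → ℕ} (hk : k i ≠ 0) :
    k ∈ Set.range fun j : ι → ℕ => Function.update j i (j i + 1) :=
  ⟨Function.update k i (k i - 1), by simp [Nat.sub_add_cancel (Nat.pos_of_ne_zero hk)]⟩

theorem dotProduct_mulVec_comm_of_isSymm {ι : Type} [Fintype ι] {A : Matrix ι ι ℂ}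
    (hA : A.IsSymm) (v w : ι → ℂ) :
    v ⬝ᵥ (A *ᵥ w) = w ⬝ᵥ (A *ᵥ v) := by
  rw [Matrix.dotProduct_mulVec, dotProduct_comm, ← Matrix.mulVec_transpose, hA.eq]

section

variable {ι : Type} [Fintype ι] [DecidableEq ι]

/-- The amplitudes of `a_i f`. -/
def lowerCoeff (i : ι) (f : (ι → ℕ) → ℂ) (j : ι → ℕ) : ℂ :=
  ((Real.sqrt (j i + 1) : ℝ) : ℂ) * f (Function.update j i (j i + 1))

/-- The amplitudes of `a_i† f`. -/
def raiseCoeff (i : ι) (f : (ι → ℕ) → ℂ) (j : ι → ℕ) : ℂ :=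
  ((Real.sqrt (j i) : ℝ) : ℂ) * f (Function.update j i (j i - 1))

theorem fockMonomial_update (z : ι → ℂ) (k : ι → ℕ) (i : ι) (t : ℂ) (n : ℕ) :
    fockMonomial (Function.update z i t) (Function.update k i n) =
      t ^ n / ((Real.sqrt (n.factorial : ℝ) : ℝ) : ℂ) *
        ∏ l ∈ Finset.univ.erase i, z l ^ k l / ((Real.sqrt ((k l).factorial : ℝ) : ℝ) : ℂ) := by
  rw [fockMonomial, ← Finset.mul_prod_erase _ _ (Finset.mem_univ i)]
  congr 1
  · simp
  · refine Finset.prod_congr rfl fun l hl => ?_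
    rw [Function.update_of_ne (Finset.ne_of_mem_erase hl),
      Function.update_of_ne (Finset.ne_of_mem_erase hl)]

theorem sqrt_succ_factorial (n : ℕ) : ((Real.sqrt ((n + 1).factorial : ℝ) : ℝ) : ℂ) =
    ((Real.sqrt (n + 1) : ℝ) : ℂ) * ((Real.sqrt (n.factorial : ℝ) : ℝ) : ℂ) := by
  rw [Nat.factorial_succ, Nat.cast_mul, Real.sqrt_mul (Nat.cast_nonneg _)]
  push_cast
  rfl

theorem sqrt_succ_ne_zero (n : ℕ) : ((Real.sqrt (n + 1) : ℝ) : ℂ) ≠ 0 :=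
  Complex.ofReal_ne_zero.2 (Real.sqrt_pos.2 (by positivity)).ne'

theorem sqrt_succ_mul_self (n : ℕ) :
    ((Real.sqrt (n + 1) : ℝ) : ℂ) * ((Real.sqrt (n + 1) : ℝ) : ℂ) = n + 1 := by
  rw [← Complex.ofReal_mul, Real.mul_self_sqrt (by positivity)]
  simp

theorem sqrt_factorial_ne_zero (n : ℕ) : ((Real.sqrt (n.factorial : ℝ) : ℝ) : ℂ) ≠ 0 :=
  Complex.ofReal_ne_zero.2 (Real.sqrt_pos.2 (by exact_mod_cast Nat.factorial_pos _)).ne'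

theorem sqrt_mul_fockMonomial_raise (z : ι → ℂ) (j : ι → ℕ) (i : ι) :
    ((Real.sqrt (j i + 1) : ℝ) : ℂ) * fockMonomial z (Function.update j i (j i + 1)) =
      z i * fockMonomial z j := by
  have h1 := fockMonomial_update z j i (z i) (j i + 1)
  have h2 := fockMonomial_update z j i (z i) (j i)
  simp only [Function.update_eq_self] at h1 h2
  rw [h1, h2, sqrt_succ_factorial]
  have := sqrt_succ_ne_zero (j i)
  have := sqrt_factorial_ne_zero (j i)
  field_simp
  ring

/-- Creation operators act on Bargmann functions as multiplication by the variables. -/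
theorem HasExpansion.raise {f : (ι → ℕ) → ℂ} {F : (ι → ℂ) → ℂ} (h : HasExpansion f F) (i : ι) :
    HasExpansion (raiseCoeff i f) fun z => z i * F z := by
  intro z
  -- Indices outside the range of `j ↦ j + 1_i` have `k i = 0`; there the factor `√0` vanishes,
  -- which also disposes of the truncated subtraction.
  refine ((raise_injective i).hasSum_iff fun k hk => ?_).1 ?_
  · have hk0 : k i = 0 := by
      by_contra h0
      exact hk (mem_range_raise h0)
    simp [raiseCoeff, hk0]
  · convert! (h z).mul_left (z i) using 2 with j
    have := sqrt_mul_fockMonomial_raise z j i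
    simp only [Function.comp_apply, raiseCoeff, Function.update_self, Nat.add_sub_cancel,
      Function.update_idem, Function.update_eq_self, Nat.cast_add, Nat.cast_one]
    linear_combination f j * this

/-- Annihilation operators act as partial derivatives, since the entire series may be differentiated
term by term. -/
theorem HasExpansion.lower {f : (ι → ℕ) → ℂ} {F : (ι → ℂ) → ℂ} (h : HasExpansion f F) (i : ι) :
    HasExpansion (lowerCoeff i f) fun z => deriv (fun t => F (Function.update z i t)) (z i) := by
  intro z
  have hupd : ∀ (k : ι → ℕ) (t : ℂ),
      fockMonomial (Function.update z i t) k =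
        t ^ k i / ((Real.sqrt ((k i).factorial : ℝ) : ℝ) : ℂ) *
          ∏ l ∈ Finset.univ.erase i, z l ^ k l / ((Real.sqrt ((k l).factorial : ℝ) : ℝ) : ℂ) :=
        fun k t => by
    simpa only [Function.update_eq_self] using fockMonomial_update z k i t (k i)
  have hF : (fun t => F (Function.update z i t)) =
      fun t => ∑' k, f k * fockMonomial (Function.update z i t) k :=
    funext fun t => (h _).tsum_eq.symm
  -- On the disc of radius `‖z i‖ + 1` the terms are dominated by the norms of the terms at the
  -- boundary point `t = ‖z i‖ + 1`, where the expansion converges.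
  have hsum := Complex.hasSum_deriv_of_summable_norm
    (F := fun k t => f k * fockMonomial (Function.update z i t) k)
    (U := Metric.ball 0 (‖z i‖ + 1)) (z := z i)
    (h (Function.update z i ((‖z i‖ + 1 : ℝ) : ℂ))).summable.norm
    (fun k => by
      simp only [hupd]
      fun_prop)
    Metric.isOpen_ball
    (fun k t ht => by
      simp only [hupd, norm_mul, norm_div, norm_pow, Complex.norm_real]
      rw [mem_ball_zero_iff] at ht
      rw [Real.norm_of_nonneg (by positivity : 0 ≤ ‖z i‖ + 1)]
      gcongr)
    (by simp)
  beta_reduce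
  rw [hF]
  -- Terms with `k i = 0` do not depend on `t`, so only shifted indices contribute to the
  -- derivative.
  have hsum' := ((raise_injective i).hasSum_iff fun k hk => ?_).2 hsum
  · convert! hsum' using 2 with j
    have h2 : ∀ t, fockMonomial (Function.update z i t) (Function.update j i (j i + 1)) = _ :=
      fun t => fockMonomial_update z j i t (j i + 1)
    have h3 := fockMonomial_update z j i (z i) (j i)
    simp only [Function.update_eq_self] at h3
    simp only [Function.comp_apply, h2, lowerCoeff, h3]
    rw [deriv_const_mul_field, deriv_mul_const_field, deriv_div_const, deriv_pow_field,
      sqrt_succ_factorial]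
    have := sqrt_succ_ne_zero (j i)
    have := sqrt_factorial_ne_zero (j i)
    have h4 := sqrt_succ_mul_self (j i)
    field_simp
    push_cast
    rw [pow_two, h4]
    simp
    ring
  · have hk0 : k i = 0 := by
      by_contra h0
      exact hk (mem_range_raise h0)
    simp [hupd, hk0]

theorem deriv_gaussian {A : Matrix ι ι ℂ} (hA : A.IsSymm) (b : ι → ℂ) (c : ℂ) (z : ι → ℂ) (i : ι) :
    deriv (fun t => gaussian A b c (Function.update z i t)) (z i) =
      ((A *ᵥ z) i + b i) * gaussian A b c z := by
  have h : ∀ t, gaussian A b c (Function.update z i t) = c * Complex.exp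
      (1 / 2 * (z ⬝ᵥ (A *ᵥ z)) + z ⬝ᵥ b + (t - z i) * ((A *ᵥ z) i + b i)
        + 1 / 2 * (t - z i) ^ 2 * A i i) := by
    intro t
    have e : Function.update z i t = z + Pi.single i (t - z i) := by
      funext l
      by_cases hl : l = i
      · subst hl
        simp
      · simp [hl]
    rw [gaussian, e, Matrix.mulVec_add, add_dotProduct, dotProduct_add, dotProduct_add,
      dotProduct_mulVec_comm_of_isSymm hA z (Pi.single i (t - z i)), add_dotProduct,
      single_dotProduct, single_dotProduct, single_dotProduct]
    simp only [Matrix.mulVec_single, Pi.smul_apply, Matrix.col_apply, MulOpposite.smul_eq_mul_unop,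
      MulOpposite.unop_op]
    congr 2
    ring
  simp only [h]
  have hd : HasDerivAt (fun t => 1 / 2 * (z ⬝ᵥ (A *ᵥ z)) + z ⬝ᵥ b + (t - z i) * ((A *ᵥ z) i + b i)
        + 1 / 2 * (t - z i) ^ 2 * A i i) ((A *ᵥ z) i + b i) (z i) := by
    have h1 := (hasDerivAt_id (z i)).sub_const (z i)
    have h2 := ((h1.mul_const ((A *ᵥ z) i + b i)).const_add (1 / 2 * (z ⬝ᵥ (A *ᵥ z)) + z ⬝ᵥ b)).add
      (((h1.pow 2).const_mul (1 / 2)).mul_const (A i i))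
    convert! h2 using 1
    simp
  rw [(hd.cexp.const_mul c).deriv, gaussian]
  simp
  ring

/-- The differential equation `∂_i F = ((A z)_i + b_i) F` of a Gaussian function in terms of its
coefficients. -/
theorem HasExpansion.lowerCoeff_gaussian {f : (ι → ℕ) → ℂ} {A : Matrix ι ι ℂ} (hA : A.IsSymm)
    {b : ι → ℂ} {c : ℂ} (h : HasExpansion f (gaussian A b c)) (i : ι) (j : ι → ℕ) :
    lowerCoeff i f j = ∑ l, A i l * raiseCoeff l f j + b i * f j := by
  refine congrFun (HasExpansion.ext (h.lower i)
    (g := fun j => ∑ l, A i l * raiseCoeff l f j + b i * f j) fun z => ?_) j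
  have h1 := (hasSum_sum (s := Finset.univ) fun l _ => (h.raise l z).mul_left (A i l)).add
    ((h z).mul_left (b i))
  simp only [deriv_gaussian hA]
  convert! h1 using 1
  · funext k
    rw [add_mul, Finset.sum_mul]
    simp only [mul_assoc]
  · simp only [Matrix.mulVec, dotProduct, add_mul, Finset.sum_mul, mul_assoc]

end

/-! ## The Autonne–Takagi factorization -/

section

variable {E : Type*} [NormedAddCommGroup E] [InnerProductSpace ℂ E] [FiniteDimensional ℂ E]

/-- With the real part of the inner product, an antilinear map with this symmetry is a symmetric
real-linear operator. The real spectral theorem supplies a real eigenvalue. -/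
theorem exists_conjugate_eigenvector [Nontrivial E] (C : E →ₛₗ[starRingEnd ℂ] E)
    (hC : ∀ v w, inner ℂ v (C w) = inner ℂ w (C v)) :
    ∃ (v : E) (r : ℝ), ‖v‖ = 1 ∧ C v = (r : ℂ) • v := by
  let _ : InnerProductSpace ℝ E := InnerProductSpace.rclikeToReal ℂ E
  let T : E →ₗ[ℝ] E :=
    { toFun := C
      map_add' := C.map_add
      map_smul' := fun r v => by
        have := C.map_smulₛₗ (r : ℂ) v
        simpa using this }
  have hT : T.IsSymmetric := fun v w => by
    have h1 : inner ℝ (C v) w = (inner ℂ (C v) w).re := rfl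
    have h2 : inner ℝ v (C w) = (inner ℂ v (C w)).re := rfl
    change inner ℝ (C v) w = inner ℝ v (C w)
    rw [h1, h2, hC, ← inner_conj_symm, Complex.conj_re]
  have hpos : 0 < Module.finrank ℝ E := Module.finrank_pos
  have h := hT.apply_eigenvectorBasis rfl ⟨0, hpos⟩
  exact ⟨hT.eigenvectorBasis rfl ⟨0, hpos⟩, hT.eigenvalues rfl ⟨0, hpos⟩,
    (hT.eigenvectorBasis rfl).orthonormal.1 _, by
      rw [Complex.coe_smul]
      exact h⟩

end

/-- Induction on the dimension: if `C v = r v` and `w ⟂ v`, then `⟨v, C w⟩ = ⟨w, C v⟩ = r ⟨w, v⟩ =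
0`, so the complex orthogonal complement of `v` is invariant. -/
theorem exists_orthonormal_conjugate_eigenvectors (n : ℕ) :
    ∀ (E : Type) [NormedAddCommGroup E] [InnerProductSpace ℂ E] [FiniteDimensional ℂ E]
      (C : E →ₛₗ[starRingEnd ℂ] E), Module.finrank ℂ E = n →
      (∀ v w, inner ℂ v (C w) = inner ℂ w (C v)) →
      ∃ (e : Fin n → E) (d : Fin n → ℝ), Orthonormal ℂ e ∧ ∀ i, C (e i) = (d i : ℂ) • e i := by
  induction n with
  | zero =>
    intro E _ _ _ C _ _
    exact ⟨Fin.elim0, Fin.elim0, ⟨fun i => i.elim0, fun i => i.elim0⟩, fun i => i.elim0⟩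
  | succ n ih =>
    intro E _ _ _ C hn hC
    have : Nontrivial E := Module.nontrivial_of_finrank_pos (R := ℂ) (by omega)
    obtain ⟨v, r, hv, hCv⟩ := exists_conjugate_eigenvector C hC
    have hv0 : v ≠ 0 := fun h => by simp [h] at hv
    let K := (Submodule.span ℂ {v})ᗮ
    have hK : ∀ w ∈ K, C w ∈ K := by
      intro w hw
      rw [Submodule.mem_orthogonal_singleton_iff_inner_right] at hw ⊢
      rw [hC, hCv, inner_smul_right, ← inner_conj_symm, hw]
      simp
    let C' : K →ₛₗ[starRingEnd ℂ] K :=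
      { toFun := fun w => ⟨C w, hK w w.2⟩
        map_add' := fun _ _ => Subtype.ext (by simp)
        map_smul' := fun _ _ => Subtype.ext (by simp) }
    have : Fact (Module.finrank ℂ E = n + 1) := ⟨hn⟩
    obtain ⟨e, d, he, hd⟩ := ih K C' (Submodule.finrank_orthogonal_span_singleton hv0)
      fun a b => hC (a : E) (b : E)
    refine ⟨Fin.cons v fun i => (e i : E), Fin.cons r d, ?_, ?_⟩
    · rw [orthonormal_iff_ite] at he ⊢
      have hin : ∀ i, inner ℂ v (e i : E) = 0 := fun i =>
        Submodule.mem_orthogonal_singleton_iff_inner_right.1 (e i).2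
      intro i j
      refine Fin.cases ?_ (fun i => ?_) i <;> refine Fin.cases ?_ (fun j => ?_) j
      · simp [inner_self_eq_norm_sq_to_K, hv]
      · simpa [Fin.succ_ne_zero, eq_comm] using hin j
      · simp only [Fin.cons_succ, Fin.cons_zero, Fin.succ_ne_zero, if_false]
        rw [← inner_conj_symm, hin, map_zero]
      · simpa using he i j
    · intro i
      refine Fin.cases (by simpa using hCv) (fun i => ?_) i
      simpa [C'] using congrArg Subtype.val (hd i)

/-- Every complex symmetric matrix is `V D Vᵀ` with a unitary `V` and a real diagonal `D`. -/
theorem exists_takagi {ι : Type} [Fintype ι] [DecidableEq ι] {x : Matrix ι ι ℂ} (hx : x.IsSymm) :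
    ∃ (V : Matrix ι ι ℂ) (d : ι → ℝ), Vᴴ * V = 1 ∧
      x = V * Matrix.diagonal (fun i => (d i : ℂ)) * Vᵀ := by
  -- For the antilinear map `w ↦ (x w)*` the symmetry condition is exactly the symmetry of `x`.
  let C : EuclideanSpace ℂ ι →ₛₗ[starRingEnd ℂ] EuclideanSpace ℂ ι :=
    { toFun := fun w => WithLp.toLp 2 (star (x *ᵥ w.ofLp))
      map_add' := fun v w => by simp [Matrix.mulVec_add]
      map_smul' := fun c w => by
        simp only [WithLp.ofLp_smul, Matrix.mulVec_smul, star_smul]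
        rfl }
  have hC : ∀ v w, inner ℂ v (C w) = inner ℂ w (C v) := by
    intro v w
    simp only [C, LinearMap.coe_mk, AddHom.coe_mk, EuclideanSpace.inner_eq_star_dotProduct]
    rw [Matrix.star_dotProduct_star, Matrix.star_dotProduct_star,
      dotProduct_mulVec_comm_of_isSymm hx]
  obtain ⟨e, d, he, hd⟩ := exists_orthonormal_conjugate_eigenvectors (Fintype.card ι) _ C
    (by simp) hC
  let q := Fintype.equivFin ι
  -- The eigenvectors are conjugated because `(x e)* = d e` means `x e = d e*`, that is, `x V* = V
  -- D`.
  let V : Matrix ι ι ℂ := Matrix.of fun i j => star (e (q j) i)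
  have hV : Vᴴ * V = 1 := by
    ext i j
    have := (orthonormal_iff_ite.1 he) (q j) (q i)
    rw [EuclideanSpace.inner_eq_star_dotProduct] at this
    rw [Matrix.mul_apply, Matrix.one_apply]
    simpa [V, dotProduct, eq_comm] using this
  refine ⟨V, fun i => d (q i), hV, ?_⟩
  have hV2 : V.map star * Vᵀ = 1 := by
    have h1 : (V * Vᴴ)ᵀ = 1 := by rw [mul_eq_one_comm.1 hV, Matrix.transpose_one]
    rw [Matrix.transpose_mul] at h1
    simpa [Matrix.conjTranspose, Matrix.transpose_map] using h1
  have hxV : x * V.map star = V * Matrix.diagonal (fun i => (d (q i) : ℂ)) := by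
    ext i j
    have := congrArg (fun w : EuclideanSpace ℂ ι => star (w i)) (hd (q j))
    simp only [C, LinearMap.coe_mk, AddHom.coe_mk, Pi.star_apply, star_star, PiLp.smul_apply,
      smul_eq_mul, star_mul] at this
    rw [Matrix.mul_diagonal, Matrix.mul_apply]
    simpa [V, Matrix.mulVec, dotProduct] using this
  calc x = x * (V.map star * Vᵀ) := by rw [hV2, mul_one]
    _ = _ := by rw [← mul_assoc, hxV]

/-! ## Strict positivity for normalizable Gaussian functions -/

theorem tendsto_pow_mul_exp_neg_mul_sq {a : ℝ} (ha : 0 < a) (q : ℕ) :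
    Filter.Tendsto (fun t : ℝ => t ^ q * Real.exp (-(a * t ^ 2))) Filter.atTop (nhds 0) := by
  refine squeeze_zero' ?_ ?_ (Real.tendsto_pow_mul_exp_neg_atTop_nhds_zero q)
  · filter_upwards [Filter.eventually_ge_atTop 0] with t ht
    positivity
  · filter_upwards [Filter.eventually_ge_atTop 0, Filter.eventually_ge_atTop (1 / a)] with t ht ht'
    have : t ≤ a * t ^ 2 := by
      rw [div_le_iff₀ ha] at ht'
      nlinarith
    gcongr

section

variable {ι : Type} [Fintype ι]

theorem sum_norm_sq_pos {z : ι → ℂ} (hz : z ≠ 0) : 0 < ∑ i, ‖z i‖ ^ 2 := by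
  obtain ⟨i, hi⟩ := Function.ne_iff.1 hz
  have : 0 < ‖z i‖ ^ 2 := by
    have := norm_pos_iff.2 hi
    positivity
  exact this.trans_le (Finset.single_le_sum (f := fun i => ‖z i‖ ^ 2) (fun _ _ => by positivity)
    (Finset.mem_univ i))

/-- Normalized coherent states tend weakly to `0` along every ray. -/
theorem tendsto_inner_bargmannVector (φ : Fock ι) {z : ι → ℂ} (hz : z ≠ 0) :
    Filter.Tendsto (fun t : ℝ => Real.exp (-(1 / 2 * (∑ i, ‖z i‖ ^ 2) * t ^ 2)) *
      ‖(inner ℂ (bargmannVector ((t : ℂ) • z)) φ : ℂ)‖) Filter.atTop (nhds 0) := by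
  classical
  have ha : 0 < 1 / 2 * ∑ i, ‖z i‖ ^ 2 := by
    have := sum_norm_sq_pos hz
    positivity
  have hnorm : ∀ t : ℝ, Real.exp (-(1 / 2 * (∑ i, ‖z i‖ ^ 2) * t ^ 2)) *
      ‖bargmannVector ((t : ℂ) • z)‖ = 1 := by
    intro t
    rw [norm_bargmannVector, ← Real.exp_add, Real.exp_eq_one_iff]
    simp only [Pi.smul_apply, smul_eq_mul, norm_mul, Complex.norm_real, mul_pow, Real.norm_eq_abs,
      sq_abs, ← Finset.mul_sum]
    ring
  rw [Metric.tendsto_atTop']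
  intro ε hε
  -- Approximate `φ` within `ε / 2` by finitely many Fock components. Their overlaps grow
  -- polynomially in `t` and are killed by the Gaussian factor; the remainder is controlled by
  -- Cauchy–Schwarz, as the coherent states are normalized.
  have hsum := lp.hasSum_single (E := fun _ : ι → ℕ => ℂ) (p := 2) (by norm_num) φ
  obtain ⟨s, hs⟩ := (Metric.tendsto_nhds.1 hsum (ε / 2) (by positivity)).exists
  have hfin : Filter.Tendsto (fun t : ℝ => Real.exp (-(1 / 2 * (∑ i, ‖z i‖ ^ 2) * t ^ 2)) *
      ∑ k ∈ s, ‖t‖ ^ (∑ i, k i) * (‖φ k‖ * ‖fockMonomial z k‖)) Filter.atTop (nhds 0) := by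
    generalize 1 / 2 * ∑ i, ‖z i‖ ^ 2 = A at ha ⊢
    have h0 : Filter.Tendsto (fun t : ℝ => ∑ k ∈ s, Real.exp (-(A * t ^ 2)) *
        (‖t‖ ^ (∑ i, k i) * (‖φ k‖ * ‖fockMonomial z k‖))) Filter.atTop
        (nhds (∑ k ∈ s, (0 : ℝ))) := by
      refine tendsto_finsetSum _ fun k _ => ?_
      have := (tendsto_pow_mul_exp_neg_mul_sq ha (∑ i, k i)).mul_const
        (‖φ k‖ * ‖fockMonomial z k‖)
      rw [zero_mul] at this
      refine this.congr' ?_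
      filter_upwards [Filter.eventually_ge_atTop 0] with t ht
      rw [Real.norm_of_nonneg ht]
      ring
    simp only [Finset.mul_sum]
    rwa [Finset.sum_const_zero] at h0
  obtain ⟨T, hT⟩ := (Metric.tendsto_atTop'.1 hfin) (ε / 2) (by positivity)
  refine ⟨T, fun t ht => ?_⟩
  have h1 := hT t ht
  rw [Real.dist_eq, sub_zero] at h1 ⊢
  rw [abs_of_nonneg (by positivity)] at h1 ⊢
  have h2 : (inner ℂ (bargmannVector ((t : ℂ) • z)) φ : ℂ) =
      inner ℂ (bargmannVector ((t : ℂ) • z)) (∑ k ∈ s, lp.single 2 k (φ k)) +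
      inner ℂ (bargmannVector ((t : ℂ) • z)) (φ - ∑ k ∈ s, lp.single 2 k (φ k)) := by
    rw [← inner_add_right]
    simp
  have h3 : ‖(inner ℂ (bargmannVector ((t : ℂ) • z)) (∑ k ∈ s, lp.single 2 k (φ k)) : ℂ)‖ ≤
      ∑ k ∈ s, ‖t‖ ^ (∑ i, k i) * (‖φ k‖ * ‖fockMonomial z k‖) := by
    rw [inner_sum]
    refine (norm_sum_le _ _).trans (Finset.sum_le_sum fun k _ => le_of_eq ?_)
    rw [lp.inner_single_right]
    simp only [bargmannVector, RCLike.inner_apply, norm_mul, RCLike.norm_conj, fockMonomial_smul,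
      norm_pow, Complex.norm_real]
    ring
  have h4 : ‖(inner ℂ (bargmannVector ((t : ℂ) • z)) (φ - ∑ k ∈ s, lp.single 2 k (φ k)) : ℂ)‖ ≤
      ‖bargmannVector ((t : ℂ) • z)‖ * (ε / 2) := by
    refine (norm_inner_le_norm _ _).trans ?_
    rw [dist_comm, dist_eq_norm] at hs
    gcongr
  rw [h2]
  set g := Real.exp (-(1 / 2 * (∑ i, ‖z i‖ ^ 2) * t ^ 2)) with hg
  have hg0 : 0 < g := Real.exp_pos _
  have hn := hnorm t
  have h6 := mul_le_mul_of_nonneg_left ((norm_add_le _ _).trans (add_le_add h3 h4)) hg0.le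
  rw [mul_add, ← mul_assoc g ‖bargmannVector _‖, hn] at h6
  linarith

/-- If the inequality failed at `z`, the overlap of `φ` with the normalized coherent state at `t z*`
would have modulus at least `‖c‖` for all `t ≥ 0`, against the weak convergence to zero. Weak
convergence, unlike mere boundedness, excludes equality too. -/
theorem re_dotProduct_mulVec_lt {φ : Fock ι} {x : Matrix ι ι ℂ} {u : ι → ℂ} {c : ℂ} (hc : c ≠ 0)
    (h : IsBargmannFunction φ (gaussian x u c)) {z : ι → ℂ} (hz : z ≠ 0) :
    (z ⬝ᵥ (x *ᵥ z)).re < ∑ i, ‖z i‖ ^ 2 := by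
  -- The quadratic form is even, so the sign of `z` can be chosen to make the linear term harmless.
  wlog hr : 0 ≤ (z ⬝ᵥ u).re generalizing z with H
  · have := H (z := -z) (neg_ne_zero.2 hz) (by
      rw [neg_dotProduct, Complex.neg_re]
      linarith)
    simpa [Matrix.mulVec_neg] using this
  by_contra! hge
  have hlim := tendsto_inner_bargmannVector φ (z := star z) (by simpa using hz)
  have hle : ∀ᶠ t : ℝ in Filter.atTop, ‖c‖ ≤
      Real.exp (-(1 / 2 * (∑ i, ‖star z i‖ ^ 2) * t ^ 2)) *
        ‖(inner ℂ (bargmannVector ((t : ℂ) • star z)) φ : ℂ)‖ := by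
    filter_upwards [Filter.eventually_ge_atTop 0] with t ht
    have e := isBargmannFunction_iff.1 h ((t : ℂ) • z)
    rw [star_smul, RCLike.star_def, Complex.conj_ofReal] at e
    rw [e, gaussian, norm_mul, Complex.norm_exp, mul_left_comm, ← Real.exp_add]
    refine le_mul_of_one_le_right (norm_nonneg _) (Real.one_le_exp ?_)
    simp only [Matrix.mulVec_smul, dotProduct_smul, smul_dotProduct, smul_eq_mul, Pi.star_apply,
      norm_star]
    have e1 : (1 / 2 * ((t : ℂ) * ((t : ℂ) * z ⬝ᵥ (x *ᵥ z))) + (t : ℂ) * z ⬝ᵥ u).re =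
        1 / 2 * (t * (t * (z ⬝ᵥ (x *ᵥ z)).re)) + t * (z ⬝ᵥ u).re := by
      rw [Complex.add_re, Complex.re_ofReal_mul, ← Complex.re_ofReal_mul, ← Complex.re_ofReal_mul,
        ← Complex.re_ofReal_mul]
      simp
    rw [e1]
    have := mul_le_mul_of_nonneg_left hge (sq_nonneg t)
    have := mul_nonneg ht hr
    nlinarith
  have := ge_of_tendsto hlim hle
  exact hc (norm_le_zero_iff.1 this)

/-- The unit vector `z = V* (s e_i)` gives `zᵀ x z = s² d_i`. The choices `s = 1` and `s = i` bound
`d_i` and `-d_i`. -/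
theorem abs_lt_one_of_takagi [DecidableEq ι] {φ : Fock ι} {V : Matrix ι ι ℂ} {d : ι → ℝ}
    {u : ι → ℂ} {c : ℂ} (hc : c ≠ 0) (hV : Vᴴ * V = 1)
    (h : IsBargmannFunction φ
      (gaussian (V * Matrix.diagonal (fun i => (d i : ℂ)) * Vᵀ) u c)) (i : ι) : |d i| < 1 := by
  have hV2 : Vᵀ * V.map star = 1 := by
    have h1 := congrArg Matrix.transpose hV
    rw [Matrix.transpose_mul, Matrix.transpose_one] at h1
    simpa [Matrix.conjTranspose, Matrix.transpose_map] using h1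
  have key : ∀ s : ℂ, ‖s‖ = 1 → s * (s * (d i : ℂ)) = ((s * (s * (d i : ℂ))).re : ℂ) →
      (s * (s * (d i : ℂ))).re < 1 := by
    intro s hs _
    have hVz : Vᵀ *ᵥ (V.map star *ᵥ Pi.single i s) = Pi.single i s := by
      rw [Matrix.mulVec_mulVec, hV2, Matrix.one_mulVec]
    have hz : V.map star *ᵥ Pi.single i s ≠ 0 := by
      intro h0
      rw [h0, Matrix.mulVec_zero] at hVz
      have := congrFun hVz i
      rw [Pi.zero_apply, Pi.single_eq_same] at this
      rw [← this, norm_zero] at hs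
      exact zero_ne_one hs
    have h1 := re_dotProduct_mulVec_lt hc h hz
    have h2 : (V.map star *ᵥ Pi.single i s) ⬝ᵥ
        ((V * Matrix.diagonal (fun i => (d i : ℂ)) * Vᵀ) *ᵥ (V.map star *ᵥ Pi.single i s)) =
        s * (s * (d i : ℂ)) := by
      rw [← Matrix.mulVec_mulVec, hVz, ← Matrix.mulVec_mulVec, Matrix.dotProduct_mulVec,
        ← Matrix.mulVec_transpose, hVz]
      simp
    have h3 : ((∑ j, ‖(V.map star *ᵥ Pi.single i s) j‖ ^ 2 : ℝ) : ℂ) = 1 := by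
      have e1 : ((∑ j, ‖(V.map star *ᵥ Pi.single i s) j‖ ^ 2 : ℝ) : ℂ) =
          star (V.map star *ᵥ Pi.single i s) ⬝ᵥ (V.map star *ᵥ Pi.single i s) := by
        simp only [dotProduct, Pi.star_apply, RCLike.star_def, Complex.conj_mul']
        push_cast
        rfl
      have e2 : (V.map star)ᴴ = Vᵀ := by
        ext
        simp
      rw [e1, Matrix.star_mulVec, ← Matrix.dotProduct_mulVec, e2, hVz]
      simp [Complex.conj_mul', hs]
    rw [h2] at h1
    rwa [show (∑ j, ‖(V.map star *ᵥ Pi.single i s) j‖ ^ 2 : ℝ) = 1 by exact_mod_cast h3] at h1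
  have k1 := key 1 (by simp) (by simp)
  have k2 := key Complex.I (by simp) (by simp [← mul_assoc])
  rw [abs_lt]
  simp [← mul_assoc] at k1 k2
  constructor <;> linarith

end

/-! ## Multimode squeezers -/

open MeasureTheory ProbabilityTheory in
theorem integral_cexp_quadratic_gaussianReal {p : ℝ} (hp : p < 1 / 2) (q r : ℂ) :
    ∫ ξ : ℝ, Complex.exp (p * ξ ^ 2 + q * ξ + r) ∂(gaussianReal 0 1) =
      ((Real.sqrt (1 - 2 * p))⁻¹ : ℝ) * Complex.exp (q ^ 2 / (2 * (1 - 2 * p)) + r) := by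
  have h1 : 0 < 1 / 2 - p := by linarith
  have h2 : ∀ ξ : ℝ, gaussianPDFReal 0 1 ξ • Complex.exp (p * ξ ^ 2 + q * ξ + r) =
      ((Real.sqrt (2 * Real.pi))⁻¹ : ℝ) *
        Complex.exp (((p - 1 / 2 : ℝ) : ℂ) * ξ ^ 2 + q * ξ + r) := by
    intro ξ
    rw [gaussianPDFReal, Complex.real_smul, Complex.ofReal_mul, mul_assoc, Complex.ofReal_exp,
      ← Complex.exp_add]
    simp only [NNReal.coe_one, mul_one, sub_zero]
    congr 2
    push_cast
    ring
  rw [integral_gaussianReal_eq_integral_smul one_ne_zero]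
  simp only [h2]
  rw [integral_const_mul, integral_cexp_quadratic (by simpa using hp)]
  have e1 : (Real.pi : ℂ) / -((p - 1 / 2 : ℝ) : ℂ) = ((Real.pi / (1 / 2 - p) : ℝ) : ℂ) := by
    push_cast
    ring
  have e2 : (1 / 2 : ℂ) = ((1 / 2 : ℝ) : ℂ) := by push_cast; ring
  rw [e1, e2, ← Complex.ofReal_cpow (by positivity), ← mul_assoc, ← Complex.ofReal_mul,
    ← Real.sqrt_eq_rpow, ← Real.sqrt_inv, ← Real.sqrt_mul (by positivity), ← Real.sqrt_inv]
  have h3 : (1 - 2 * (p : ℂ)) ≠ 0 := by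
    have : (1 - 2 * p : ℝ) ≠ 0 := by linarith
    exact_mod_cast this
  have h4 : ((p : ℂ) - 1 / 2) ≠ 0 := by
    have : (p - 1 / 2 : ℝ) ≠ 0 := by linarith
    simpa using Complex.ofReal_ne_zero.2 this
  congr 2
  · congr 2
    field_simp
  · push_cast
    have : (4 * ((p : ℂ) - 1 / 2)) = -(2 * (1 - 2 * p)) := by ring
    rw [this]
    field_simp
    ring

-- The integral of a non-integrable function is zero by convention, whereas the computed value is
-- not.
open MeasureTheory ProbabilityTheory in
theorem integrable_cexp_quadratic_gaussianReal {p : ℝ} (hp : p < 1 / 2) (q r : ℂ) :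
    Integrable (fun ξ : ℝ => Complex.exp (p * ξ ^ 2 + q * ξ + r)) (gaussianReal 0 1) := by
  refine Integrable.of_integral_ne_zero ?_
  rw [integral_cexp_quadratic_gaussianReal hp]
  have : 0 < Real.sqrt (1 - 2 * p) := Real.sqrt_pos.2 (by linarith)
  exact mul_ne_zero (Complex.ofReal_ne_zero.2 (by positivity)) (Complex.exp_ne_zero _)

section

variable {ι : Type} [Fintype ι]

/-- The distance between coherent vectors is an explicit continuous function of the overlaps.
Continuity provides the measurability needed for vector-valued integrals. -/
theorem continuous_bargmannVector : Continuous (bargmannVector (ι := ι)) := by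
  rw [continuous_iff_continuousAt]
  intro w₀
  rw [ContinuousAt, tendsto_iff_norm_sub_tendsto_zero]
  have h : ∀ w, ‖bargmannVector w - bargmannVector w₀‖ = Real.sqrt
      (Real.exp (∑ i, ‖w i‖ ^ 2) - 2 * (Complex.exp (star w ⬝ᵥ w₀)).re
        + Real.exp (∑ i, ‖w₀ i‖ ^ 2)) := by
    intro w
    rw [← norm_bargmannVector_sq, ← norm_bargmannVector_sq, ← inner_bargmannVector_bargmannVector]
    have := @norm_sub_sq ℂ _ _ _ _ (bargmannVector w) (bargmannVector w₀)
    rw [← Real.sqrt_sq (norm_nonneg _), this]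
    rfl
  have hc : Continuous fun w : ι → ℂ => Real.sqrt
      (Real.exp (∑ i, ‖w i‖ ^ 2) - 2 * (Complex.exp (star w ⬝ᵥ w₀)).re
        + Real.exp (∑ i, ‖w₀ i‖ ^ 2)) := by
    unfold dotProduct
    fun_prop
  have h0 := hc.tendsto w₀
  rw [← h w₀, sub_self, norm_zero] at h0
  exact h0.congr fun w => (h w).symm

open MeasureTheory ProbabilityTheory

/-- The average of the coherent vectors at `b + κ ξ` over standard normal variables `ξ`. -/
def gaussianAverage (κ b : ι → ℂ) : Fock ι :=
  ∫ ξ : ι → ℝ, bargmannVector (fun i => b i + κ i * ξ i) ∂(Measure.pi fun _ => gaussianReal 0 1)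

/-- The norm of the integrand is the product of the factors `exp(‖b_i + κ_i ξ_i‖² / 2)`, which the
standard normal density beats because `‖κ_i‖ < 1`. -/
theorem integrable_bargmannVector {κ : ι → ℂ} (hκ : ∀ i, ‖κ i‖ ^ 2 < 1) (b : ι → ℂ) :
    Integrable (fun ξ : ι → ℝ => bargmannVector (fun i => b i + κ i * ξ i))
      (Measure.pi fun _ => gaussianReal 0 1) := by
  have hcont : Continuous fun ξ : ι → ℝ => bargmannVector (fun i => b i + κ i * ξ i) :=
    continuous_bargmannVector.comp (by fun_prop)
  have h1 : ∀ i, Integrable (fun t : ℝ => Real.exp (1 / 2 * ‖b i + κ i * t‖ ^ 2))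
      (gaussianReal 0 1) := by
    intro i
    have h := (integrable_cexp_quadratic_gaussianReal (p := 1 / 2 * ‖κ i‖ ^ 2)
      (by linarith [hκ i]) ((star (b i) * κ i).re : ℝ) ((1 / 2 * ‖b i‖ ^ 2 : ℝ) : ℂ)).norm
    refine h.congr (Filter.Eventually.of_forall fun t => ?_)
    beta_reduce
    rw [Complex.norm_exp]
    congr 1
    have e : ‖b i + κ i * t‖ ^ 2 =
        ‖κ i‖ ^ 2 * t ^ 2 + 2 * (star (b i) * κ i).re * t + ‖b i‖ ^ 2 := by
      simp only [← Complex.normSq_eq_norm_sq, Complex.normSq_apply, Complex.add_re, Complex.mul_re,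
        Complex.add_im, Complex.mul_im, Complex.ofReal_re, Complex.ofReal_im, RCLike.star_def,
        Complex.conj_re, Complex.conj_im]
      ring
    rw [e]
    norm_cast
    ring
  have h2 := Integrable.fintype_prod (μ := fun _ : ι => gaussianReal 0 1) h1
  refine h2.mono' hcont.aestronglyMeasurable (Filter.Eventually.of_forall fun ξ => ?_)
  rw [norm_bargmannVector, Finset.mul_sum, Real.exp_sum]

theorem inner_gaussianAverage_right {κ : ι → ℂ} (hκ : ∀ i, ‖κ i‖ ^ 2 < 1) (b : ι → ℂ)
    (φ : Fock ι) : inner ℂ φ (gaussianAverage κ b) =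
      ∫ ξ : ι → ℝ, inner ℂ φ (bargmannVector (fun i => b i + κ i * ξ i))
        ∂(Measure.pi fun _ => gaussianReal 0 1) :=
  ((innerSL ℂ φ).integral_comp_comm (integrable_bargmannVector hκ b)).symm

/-- The moment generating function `E exp(s ξ) = exp(s² / 2)` produces the quadratic term `κ_i²` of
a squeezed vector. A complex `κ_i` allows this to be any number of modulus below one, in particular
a negative one. -/
theorem inner_bargmannVector_gaussianAverage {κ : ι → ℂ} (hκ : ∀ i, ‖κ i‖ ^ 2 < 1)
    (z b : ι → ℂ) : inner ℂ (bargmannVector z) (gaussianAverage κ b) =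
      ∏ i, Complex.exp (star (z i) * b i + 1 / 2 * κ i ^ 2 * star (z i) ^ 2) := by
  rw [inner_gaussianAverage_right hκ]
  have h : ∀ ξ : ι → ℝ, inner ℂ (bargmannVector z) (bargmannVector (fun i => b i + κ i * ξ i)) =
      ∏ i, Complex.exp ((0 : ℝ) * ξ i ^ 2 + (star (z i) * κ i) * ξ i + star (z i) * b i) := by
    intro ξ
    rw [inner_bargmannVector_bargmannVector, dotProduct, Complex.exp_sum]
    refine Finset.prod_congr rfl fun i _ => ?_
    congr 1
    simp only [Pi.star_apply, Complex.ofReal_zero]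
    ring
  simp only [h]
  rw [integral_fintype_prod_eq_prod (fun i (t : ℝ) =>
    Complex.exp ((0 : ℝ) * t ^ 2 + (star (z i) * κ i) * t + star (z i) * b i))]
  refine Finset.prod_congr rfl fun i _ => ?_
  rw [integral_cexp_quadratic_gaussianReal (by norm_num)]
  simp only [mul_zero, sub_zero, Real.sqrt_one, inv_one, Complex.ofReal_one, one_mul,
    Complex.ofReal_zero]
  congr 1
  ring

theorem inner_gaussianAverage_gaussianAverage {κ : ι → ℂ} {d : ι → ℝ} (hd : ∀ i, |d i| < 1)
    (hκ : ∀ i, κ i ^ 2 = d i) (b b' : ι → ℂ) :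
    inner ℂ (gaussianAverage κ b') (gaussianAverage κ b) =
      ∏ i, (((Real.sqrt (1 - d i ^ 2))⁻¹ : ℝ) : ℂ) * Complex.exp ((star (b' i) * b i
        + 1 / 2 * d i * star (b' i) ^ 2 + 1 / 2 * d i * b i ^ 2) / (1 - d i ^ 2)) := by
  have hκ1 : ∀ i, ‖κ i‖ ^ 2 < 1 := fun i => by
    rw [← norm_pow, hκ, Complex.norm_real]
    exact hd i
  have hκ' : ∀ i, star (κ i) ^ 2 = d i := fun i => by
    rw [← star_pow, hκ]
    simp
  rw [← inner_conj_symm, inner_gaussianAverage_right hκ1, ← integral_conj]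
  simp only [inner_conj_symm]
  have h : ∀ η : ι → ℝ, inner ℂ (bargmannVector (fun i => b' i + κ i * η i)) (gaussianAverage κ b) =
      ∏ i, Complex.exp ((1 / 2 * d i ^ 2 : ℝ) * η i ^ 2 +
        (star (κ i) * (b i + d i * star (b' i))) * η i
        + (star (b' i) * b i + 1 / 2 * d i * star (b' i) ^ 2)) := by
    intro η
    rw [inner_bargmannVector_gaussianAverage hκ1]
    refine Finset.prod_congr rfl fun i _ => ?_
    congr 1
    rw [star_add, star_mul', show star (η i : ℂ) = η i from Complex.conj_ofReal _]
    push_cast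
    linear_combination (1 / 2 * (star (b' i) + star (κ i) * η i) ^ 2) * hκ i
      + 1 / 2 * d i * η i ^ 2 * hκ' i
  simp only [h]
  rw [integral_fintype_prod_eq_prod (fun i (t : ℝ) =>
    Complex.exp ((1 / 2 * d i ^ 2 : ℝ) * t ^ 2 +
        (star (κ i) * (b i + d i * star (b' i))) * t
        + (star (b' i) * b i + 1 / 2 * d i * star (b' i) ^ 2)))]
  refine Finset.prod_congr rfl fun i _ => ?_
  have hd2 : d i ^ 2 < 1 := (sq_lt_one_iff_abs_lt_one _).2 (hd i)
  rw [integral_cexp_quadratic_gaussianReal (by linarith)]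
  have h3 : (1 - (d i : ℂ) ^ 2) ≠ 0 := by
    have : (1 - d i ^ 2 : ℝ) ≠ 0 := by linarith
    exact_mod_cast this
  congr 2
  · congr 3
    ring
  · rw [mul_pow, hκ']
    push_cast
    have e : (1 - 2 * (1 / 2 * (d i : ℂ) ^ 2)) = 1 - (d i : ℂ) ^ 2 := by ring
    rw [e]
    field_simp
    ring

/-- The Bargmann function of the multimode squeezer with parameters `d`. -/
def squeezeKernel (d : ι → ℝ) (z w : ι → ℂ) : ℂ :=
  ∏ i, (((Real.sqrt (Real.sqrt (1 - d i ^ 2))) : ℝ) : ℂ) *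
    Complex.exp (1 / 2 * d i * z i ^ 2 + ((Real.sqrt (1 - d i ^ 2) : ℝ) : ℂ) * z i * w i
      - 1 / 2 * d i * w i ^ 2)

/-- The squeezed vector at `w` averages coherent vectors centred at `√(1 - d²) w`. Its overlaps then
have exponent `z* w + d (z*² + w²) / 2`, and the weight `exp(-d w² / 2)` removes the second summand,
while the fourth roots cancel the normalization `1 / √(1 - d²)`. -/
theorem exists_squeezed_vectors {d : ι → ℝ} (hd : ∀ i, |d i| < 1) :
    ∃ G : (ι → ℂ) → Fock ι,
      (∀ z w, inner ℂ (bargmannVector z) (G w) = squeezeKernel d (star z) w) ∧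
      ∀ z w, inner ℂ (G z) (G w) = inner ℂ (bargmannVector z) (bargmannVector w) := by
  choose κ hκ using fun i => IsAlgClosed.exists_pow_nat_eq (d i : ℂ) two_pos
  have hκ1 : ∀ i, ‖κ i‖ ^ 2 < 1 := fun i => by
    rw [← norm_pow, hκ, Complex.norm_real]
    exact hd i
  refine ⟨fun w => (∏ i, (((Real.sqrt (Real.sqrt (1 - d i ^ 2))) : ℝ) : ℂ) *
    Complex.exp (-(1 / 2 * d i * w i ^ 2))) •
      gaussianAverage κ (fun i => ((Real.sqrt (1 - d i ^ 2) : ℝ) : ℂ) * w i), ?_, ?_⟩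
  · intro z w
    rw [inner_smul_right, inner_bargmannVector_gaussianAverage hκ1, ← Finset.prod_mul_distrib]
    refine Finset.prod_congr rfl fun i _ => ?_
    rw [mul_assoc, ← Complex.exp_add, hκ]
    congr 2
    simp only [Pi.star_apply]
    ring
  · intro z w
    rw [inner_smul_right, inner_smul_left, inner_gaussianAverage_gaussianAverage hd hκ, map_prod,
      ← Finset.prod_mul_distrib, ← Finset.prod_mul_distrib, inner_bargmannVector_bargmannVector,
      dotProduct, Complex.exp_sum]
    refine Finset.prod_congr rfl fun i _ => ?_
    have hd2 : 0 < 1 - d i ^ 2 := sub_pos.2 ((sq_lt_one_iff_abs_lt_one _).2 (hd i))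
    have h3 : (1 - (d i : ℂ) ^ 2) ≠ 0 := by
      have : (1 - d i ^ 2 : ℝ) ≠ 0 := by linarith
      exact_mod_cast this
    have hs : 0 < Real.sqrt (1 - d i ^ 2) := Real.sqrt_pos.2 hd2
    have e1 : (((Real.sqrt (Real.sqrt (1 - d i ^ 2))) : ℝ) : ℂ) *
        (((Real.sqrt (Real.sqrt (1 - d i ^ 2))) : ℝ) : ℂ) *
        (((Real.sqrt (1 - d i ^ 2))⁻¹ : ℝ) : ℂ) = 1 := by
      rw [← Complex.ofReal_mul, Real.mul_self_sqrt hs.le, ← Complex.ofReal_mul,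
        mul_inv_cancel₀ hs.ne', Complex.ofReal_one]
    have e2 : ((Real.sqrt (1 - d i ^ 2) : ℝ) : ℂ) ^ 2 = 1 - (d i : ℂ) ^ 2 := by
      rw [← Complex.ofReal_pow, Real.sq_sqrt hd2.le]
      push_cast
      rfl
    have e3 : star ((Real.sqrt (1 - d i ^ 2) : ℝ) : ℂ) = ((Real.sqrt (1 - d i ^ 2) : ℝ) : ℂ) :=
      Complex.conj_ofReal _
    have e4 : (starRingEnd ℂ) (-(1 / 2 * (d i : ℂ) * z i ^ 2)) =
        -(1 / 2 * (d i : ℂ) * star (z i) ^ 2) := by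
      simp [Complex.conj_ofNat]
    rw [map_mul, Complex.conj_ofReal, ← Complex.exp_conj, e4]
    have e5 : ∀ a b c x y v : ℂ, a * x * (a * y) * (b * v) = a * a * b * (x * y * v) :=
      fun _ _ _ _ _ _ => by ring
    rw [mul_left_comm, ← mul_assoc, e5 _ _ 0, e1, one_mul, ← Complex.exp_add, ← Complex.exp_add]
    congr 1
    rw [star_mul', e3]
    simp only [mul_pow, Pi.star_apply]
    field_simp
    rw [e2]
    field_simp
    ring

/-- The inverse squeezer has parameters `-d`: conjugating the kernel and exchanging its arguments
changes the sign of `d`. -/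
theorem exists_squeezer {d : ι → ℝ} (hd : ∀ i, |d i| < 1) :
    ∃ S : Fock ι ≃ₗᵢ[ℂ] Fock ι, ∀ z w,
      inner ℂ (bargmannVector z) (S (bargmannVector w)) = squeezeKernel d (star z) w := by
  obtain ⟨G, hG, hGG⟩ := exists_squeezed_vectors hd
  obtain ⟨G', hG', hGG'⟩ := exists_squeezed_vectors (d := -d) (by simpa using hd)
  obtain ⟨S, hS, -⟩ := exists_unitary_of_inner hGG hGG' fun z w => by
    rw [← inner_conj_symm (G' z), hG, hG', squeezeKernel, squeezeKernel, map_prod]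
    refine Finset.prod_congr rfl fun i _ => ?_
    rw [map_mul, Complex.conj_ofReal, ← Complex.exp_conj]
    simp only [map_add, map_sub, map_mul, map_pow, map_div₀, map_one, map_ofNat,
      Complex.conj_ofReal, Pi.neg_apply, Complex.ofReal_neg, neg_sq, Pi.star_apply,
      RCLike.star_def, Complex.conj_conj, map_neg]
    congr 2
    ring
  exact ⟨S, fun z w => by rw [hS, hG]⟩

end

/-! ## Gaussian unitaries with prescribed parameters -/

theorem conjTranspose_eq_map_star {ι : Type} {A : Matrix ι ι ℂ} (hA : A.IsSymm) :
    Aᴴ = A.map star := by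
  rw [Matrix.conjTranspose, hA.eq]

theorem map_star_mul {ι κ μ : Type} [Fintype κ] (A : Matrix ι κ ℂ) (B : Matrix κ μ ℂ) :
    (A * B).map star = A.map star * B.map star :=
  Matrix.map_mul (f := starRingEnd ℂ)

theorem map_star_transpose {ι κ : Type} (A : Matrix ι κ ℂ) : Aᵀ.map star = Aᴴ := rfl

theorem map_star_conjTranspose {ι κ : Type} (A : Matrix ι κ ℂ) : Aᴴ.map star = Aᵀ := by
  ext
  simp

theorem map_star_map_star {ι κ : Type} (A : Matrix ι κ ℂ) : (A.map star).map star = A := by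
  ext
  simp

theorem map_star_diagonal_ofReal {ι : Type} [DecidableEq ι] (d : ι → ℝ) :
    (Matrix.diagonal fun i => (d i : ℂ)).map star = Matrix.diagonal fun i => (d i : ℂ) := by
  rw [Matrix.diagonal_map (star_zero ℂ)]
  congr 1
  funext i
  exact Complex.conj_ofReal _

/-- The positive square root of `1 - d²`, as a diagonal matrix. -/
def coDiagonal {ι : Type} [DecidableEq ι] (d : ι → ℝ) : Matrix ι ι ℂ :=
  Matrix.diagonal fun i => ((Real.sqrt (1 - d i ^ 2) : ℝ) : ℂ)

theorem posDef_coDiagonal {ι : Type} [DecidableEq ι] {d : ι → ℝ} (hd : ∀ i, |d i| < 1) :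
    (coDiagonal d).PosDef := by
  rw [coDiagonal, Matrix.posDef_diagonal_iff]
  intro i
  have hd2 : 0 < 1 - d i ^ 2 := sub_pos.2 ((sq_lt_one_iff_abs_lt_one _).2 (hd i))
  exact_mod_cast Real.sqrt_pos.2 hd2

section

variable {ι : Type} [Fintype ι]

theorem exists_passive [DecidableEq ι] {Q : Matrix ι ι ℂ} (hQ : Qᴴ * Q = 1) :
    ∃ P : Fock ι ≃ₗᵢ[ℂ] Fock ι, (∀ w, P (bargmannVector w) = bargmannVector (Q *ᵥ w)) ∧
      ∀ w, P.symm (bargmannVector w) = bargmannVector (Qᴴ *ᵥ w) := by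
  have hQ' := mul_eq_one_comm.1 hQ
  refine exists_unitary_of_inner (G := fun w => bargmannVector (Q *ᵥ w))
    (G' := fun w => bargmannVector (Qᴴ *ᵥ w)) ?_ ?_ ?_ <;> intro z w <;>
    simp only [inner_bargmannVector_bargmannVector]
  · rw [Matrix.star_mulVec, ← Matrix.dotProduct_mulVec, Matrix.mulVec_mulVec, hQ, Matrix.one_mulVec]
  · rw [Matrix.star_mulVec, ← Matrix.dotProduct_mulVec, Matrix.mulVec_mulVec,
      Matrix.conjTranspose_conjTranspose, hQ', Matrix.one_mulVec]
  · rw [Matrix.star_mulVec, Matrix.conjTranspose_conjTranspose, ← Matrix.dotProduct_mulVec]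

/-- The exponent completes the square in the overlaps of the shifted vectors; the adjoint shifts by
`-α`. The phase `θ` later absorbs the free phase of `c_U`. -/
theorem exists_displacement (α : ι → ℂ) {θ : ℂ} (hθ : ‖θ‖ = 1) :
    ∃ D : Fock ι ≃ₗᵢ[ℂ] Fock ι, ∀ w, D (bargmannVector w) =
      (θ * Complex.exp (-(1 / 2 * (star α ⬝ᵥ α)) - star α ⬝ᵥ w)) • bargmannVector (w + α) := by
  have hθ' : star θ * θ = 1 := by
    rw [RCLike.star_def, Complex.conj_mul', hθ]
    simp
  have hα : (starRingEnd ℂ) (star α ⬝ᵥ α) = star α ⬝ᵥ α := by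
    rw [← RCLike.star_def, ← Matrix.star_dotProduct]
  have hs : ∀ v w : ι → ℂ, (starRingEnd ℂ) (star v ⬝ᵥ w) = star w ⬝ᵥ v := fun v w => by
    rw [← RCLike.star_def, ← Matrix.star_dotProduct]
  have e : ∀ a b p q r : ℂ, a * p * (b * q * r) = a * b * (p * q * r) :=
    fun _ _ _ _ _ => by ring
  obtain ⟨D, hD, -⟩ := exists_unitary_of_inner
    (G := fun w : ι → ℂ =>
      (θ * Complex.exp (-(1 / 2 * (star α ⬝ᵥ α)) - star α ⬝ᵥ w)) • bargmannVector (w + α))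
    (G' := fun w : ι → ℂ =>
      (star θ * Complex.exp (-(1 / 2 * (star α ⬝ᵥ α)) + star α ⬝ᵥ w)) • bargmannVector (w - α))
    (fun z w => by
      rw [inner_smul_left, inner_smul_right, map_mul, ← Complex.exp_conj]
      simp only [inner_bargmannVector_bargmannVector, star_add, add_dotProduct, dotProduct_add,
        map_sub, map_neg, map_mul, hα, hs, map_div₀, map_one, Complex.conj_ofNat]
      rw [e, ← RCLike.star_def, hθ', one_mul, ← Complex.exp_add, ← Complex.exp_add]
      congr 1
      ring)
    (fun z w => by
      rw [inner_smul_left, inner_smul_right, map_mul, ← Complex.exp_conj]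
      simp only [inner_bargmannVector_bargmannVector, star_sub, sub_dotProduct, dotProduct_sub,
        map_add, map_neg, map_mul, hα, hs, map_div₀, map_one, Complex.conj_ofNat]
      rw [e, ← RCLike.star_def, star_star, mul_comm θ, hθ', one_mul, ← Complex.exp_add,
        ← Complex.exp_add]
      congr 1
      ring)
    (fun z w => by
      rw [inner_smul_left, inner_smul_right, map_mul, ← Complex.exp_conj]
      simp only [inner_bargmannVector_bargmannVector, star_sub, sub_dotProduct, dotProduct_add,
        map_add, map_neg, map_mul, hα, hs, map_div₀, map_one, Complex.conj_ofNat]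
      rw [← RCLike.star_def, star_star, mul_assoc, mul_assoc, ← Complex.exp_add, ← Complex.exp_add]
      congr 2
      ring)
  exact ⟨D, hD⟩

theorem squeezeKernel_eq [DecidableEq ι] (d : ι → ℝ) (z w : ι → ℂ) :
    squeezeKernel d z w = (∏ i, (((Real.sqrt (Real.sqrt (1 - d i ^ 2))) : ℝ) : ℂ)) *
      Complex.exp (1 / 2 * (z ⬝ᵥ (Matrix.diagonal (fun i => (d i : ℂ)) *ᵥ z))
        + z ⬝ᵥ (Matrix.diagonal (fun i => ((Real.sqrt (1 - d i ^ 2) : ℝ) : ℂ)) *ᵥ w)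
        - 1 / 2 * (w ⬝ᵥ (Matrix.diagonal (fun i => (d i : ℂ)) *ᵥ w))) := by
  rw [squeezeKernel, Finset.prod_mul_distrib, ← Complex.exp_sum]
  congr 2
  simp only [dotProduct, Matrix.mulVec_diagonal, Finset.mul_sum, ← Finset.sum_add_distrib,
    ← Finset.sum_sub_distrib]
  refine Finset.sum_congr rfl fun i _ => ?_
  ring

theorem dotProduct_transpose_mulVec (A : Matrix ι ι ℂ) (v w : ι → ℂ) :
    (Aᵀ *ᵥ v) ⬝ᵥ w = v ⬝ᵥ (A *ᵥ w) := by
  rw [Matrix.mulVec_transpose, ← Matrix.dotProduct_mulVec]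

theorem star_transpose_mulVec (A : Matrix ι ι ℂ) (v : ι → ℂ) : star (Aᵀ *ᵥ v) = Aᴴ *ᵥ star v := by
  rw [Matrix.star_mulVec, ← Matrix.mulVec_transpose]
  rfl

variable [DecidableEq ι]

/-- `1 - x* x`, with `x*` the entrywise conjugate. -/
def conjGram (x : Matrix ι ι ℂ) : Matrix ι ι ℂ := 1 - x.map star * x

theorem transpose_mul_map_star_of_unitary {V : Matrix ι ι ℂ} (hV : Vᴴ * V = 1) :
    Vᵀ * V.map star = 1 := by
  have h1 := congrArg Matrix.transpose hV
  rwa [Matrix.transpose_mul, Matrix.transpose_one, Matrix.conjTranspose_transpose] at h1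

theorem conjGram_takagi {V : Matrix ι ι ℂ} {d : ι → ℝ} (hV : Vᴴ * V = 1) :
    conjGram (V * Matrix.diagonal (fun i => (d i : ℂ)) * Vᵀ) =
      V.map star * Matrix.diagonal (fun i => ((1 - d i ^ 2 : ℝ) : ℂ)) * Vᵀ := by
  have h2 := mul_eq_one_comm.1 (transpose_mul_map_star_of_unitary hV)
  have h3 : (Matrix.diagonal (fun i => ((1 - d i ^ 2 : ℝ) : ℂ))) = 1 -
      Matrix.diagonal (fun i => (d i : ℂ)) * Matrix.diagonal (fun i => (d i : ℂ)) := by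
    rw [Matrix.diagonal_mul_diagonal, ← Matrix.diagonal_one, Matrix.diagonal_sub]
    congr 1
    funext i
    push_cast
    ring
  rw [conjGram, map_star_mul, map_star_mul, map_star_diagonal_ofReal, map_star_transpose, h3,
    mul_sub, sub_mul, mul_one, h2]
  congr 1
  rw [← mul_assoc, ← mul_assoc, mul_assoc _ Vᴴ, hV, mul_one]
  simp only [mul_assoc]

theorem coDiagonal_mul_self {d : ι → ℝ} (hd : ∀ i, |d i| < 1) :
    coDiagonal d * coDiagonal d = Matrix.diagonal (fun i => ((1 - d i ^ 2 : ℝ) : ℂ)) := by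
  rw [coDiagonal, Matrix.diagonal_mul_diagonal]
  congr 1
  funext i
  have hd2 : 0 < 1 - d i ^ 2 := sub_pos.2 ((sq_lt_one_iff_abs_lt_one _).2 (hd i))
  rw [← Complex.ofReal_mul, Real.mul_self_sqrt hd2.le]

theorem coDiagonal_mul_diagonal (d : ι → ℝ) :
    coDiagonal d * Matrix.diagonal (fun i => (d i : ℂ)) =
      Matrix.diagonal (fun i => (d i : ℂ)) * coDiagonal d := by
  simp only [coDiagonal, Matrix.diagonal_mul_diagonal, mul_comm]

theorem det_conjGram_takagi {V : Matrix ι ι ℂ} {d : ι → ℝ} (hV : Vᴴ * V = 1) :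
    (conjGram (V * Matrix.diagonal (fun i => (d i : ℂ)) * Vᵀ)).det =
      ((∏ i, (1 - d i ^ 2) : ℝ) : ℂ) := by
  have h := congrArg Matrix.det (transpose_mul_map_star_of_unitary hV)
  rw [Matrix.det_mul, Matrix.det_one] at h
  rw [conjGram_takagi hV, Matrix.det_mul, Matrix.det_mul, mul_comm, ← mul_assoc, h, one_mul,
    Matrix.det_diagonal]
  push_cast
  rfl

theorem posDef_of_takagi {V : Matrix ι ι ℂ} {D : Matrix ι ι ℂ} (hV : Vᴴ * V = 1) (hD : D.PosDef) :
    (V.map star * D * Vᵀ).PosDef := by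
  have h : (Vᵀ)ᴴ = V.map star := by
    ext
    simp
  rw [← h]
  refine hD.conjTranspose_mul_mul_same ?_
  have : IsUnit (Vᵀ) := .of_mul_eq_one _ (transpose_mul_map_star_of_unitary hV)
  exact Matrix.mulVec_injective_of_isUnit this

/-- The unitary is a displacement by `α`, then the passive `Wᵀ`, the squeezer with parameters `d`,
and the passive `V`. With `E = √(1 - D²)` the matrices `Γ` and `E Vᵀ` have the same Gram matrix, so
`Γ = W E Vᵀ` with `W` unitary. The kernel then has cross block `V E Wᵀ = Γᵀ` and lower right block
`-W D Wᵀ`. -/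
theorem exists_unitary_isUnitaryAbc {V : Matrix ι ι ℂ} {d : ι → ℝ} (hV : Vᴴ * V = 1)
    (hd : ∀ i, |d i| < 1) {x Γ : Matrix ι ι ℂ}
    (hx : x = V * Matrix.diagonal (fun i => (d i : ℂ)) * Vᵀ) (hΓ : Γᴴ * Γ = conjGram x)
    (u : ι → ℂ) {c : ℂ} (hc : ‖c‖ = Real.sqrt (Real.sqrt (conjGram x).det.re) *
      Real.exp (-(1 / 2) * (u ⬝ᵥ ((conjGram x)⁻¹ *ᵥ (x.map star *ᵥ u + star u))).re)) :
    ∃ U : Fock ι ≃ₗᵢ[ℂ] Fock ι, IsUnitaryAbc U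
      (Matrix.fromBlocks x Γᵀ Γ (-(Γᴴ⁻¹ * x.map star * Γᵀ)))
      (Sum.elim u (-(Γᴴ⁻¹ *ᵥ (x.map star *ᵥ u + star u)))) c := by
  set D : Matrix ι ι ℂ := Matrix.diagonal (fun i => (d i : ℂ)) with hD
  set E := coDiagonal d with hE
  have hVV := transpose_mul_map_star_of_unitary hV
  have hEpos := posDef_coDiagonal hd
  have hEH : Eᴴ = E := hEpos.isHermitian
  have hEu : IsUnit E := hEpos.isUnit
  have hET : Eᵀ = E := Matrix.diagonal_transpose _
  have hDT : Dᵀ = D := Matrix.diagonal_transpose _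
  have hDs : D.map star = D := map_star_diagonal_ofReal d
  have hED : E * D = D * E := coDiagonal_mul_diagonal d
  have hΓ₀H : (E * Vᵀ)ᴴ = V.map star * E := by
    rw [Matrix.conjTranspose_mul, hEH]
    rfl
  have hH : conjGram x = (E * Vᵀ)ᴴ * (E * Vᵀ) := by
    rw [hx, conjGram_takagi hV, ← coDiagonal_mul_self hd, hΓ₀H]
    simp only [mul_assoc, ← hE]
  set Γ₀ := E * Vᵀ with hΓ₀
  have hΓ₀u : IsUnit Γ₀.det := by
    rw [← Matrix.isUnit_iff_isUnit_det]
    exact hEu.mul (.of_mul_eq_one _ hVV)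
  set W := Γ * Γ₀⁻¹ with hWdef
  have hWΓ : Γ = W * Γ₀ := by rw [hWdef, mul_assoc, Matrix.nonsing_inv_mul _ hΓ₀u, mul_one]
  have hW : Wᴴ * W = 1 := by
    rw [hWdef, Matrix.conjTranspose_mul, mul_assoc, ← mul_assoc Γᴴ, hΓ, hH,
      Matrix.conjTranspose_nonsing_inv, mul_assoc, Matrix.mul_nonsing_inv _ hΓ₀u, mul_one,
      Matrix.nonsing_inv_mul]
    rw [Matrix.det_conjTranspose]
    exact hΓ₀u.star
  clear_value W
  have hWW := mul_eq_one_comm.1 hW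
  have hWu : IsUnit W.det := by
    rw [← Matrix.isUnit_iff_isUnit_det]
    exact .of_mul_eq_one _ hWW
  have hΓu : IsUnit Γ.det := by
    rw [hWΓ, Matrix.det_mul]
    exact hWu.mul hΓ₀u
  have hΓHu : IsUnit (Γᴴ).det := by
    rw [Matrix.det_conjTranspose]
    exact hΓu.star
  have hΓTu : IsUnit (Γᵀ).det := by rwa [Matrix.det_transpose]
  have hΓT : Γᵀ = V * E * Wᵀ := by
    rw [hWΓ, hΓ₀, Matrix.transpose_mul, Matrix.transpose_mul, Matrix.transpose_transpose, hET]
  have hxs : x.map star = V.map star * D * Vᴴ := by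
    rw [hx, map_star_mul, map_star_mul, hDs, map_star_transpose]
  have hs : Γᴴ⁻¹ * x.map star * Γᵀ = W * D * Wᵀ := by
    have h1 : Γᴴ * (W * D * Wᵀ) = x.map star * Γᵀ := by
      rw [hxs, hΓT, hWΓ, Matrix.conjTranspose_mul, hΓ₀H]
      calc V.map star * E * Wᴴ * (W * D * Wᵀ) = V.map star * (E * (Wᴴ * W) * D) * Wᵀ := by
            simp only [mul_assoc]
        _ = V.map star * (D * (Vᴴ * V) * E) * Wᵀ := by rw [hW, hV, mul_one, mul_one, hED]
        _ = _ := by simp only [mul_assoc]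
    rw [mul_assoc, ← h1, ← mul_assoc, Matrix.nonsing_inv_mul _ hΓHu, one_mul]
  -- The linear term of the output variables is `V E Wᵀ α = Γᵀ α`, which has to equal `u`.
  set α := (Γᵀ)⁻¹ *ᵥ u with hα
  have hΓα : Γᵀ *ᵥ α = u := by
    rw [hα, Matrix.mulVec_mulVec, Matrix.mul_nonsing_inv _ hΓTu, Matrix.one_mulVec]
  set b := Γᴴ⁻¹ *ᵥ (x.map star *ᵥ u + star u) with hb
  have hbα : b = (W * D * Wᵀ) *ᵥ α + star α := by
    rw [hb, Matrix.mulVec_add, ← hs]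
    congr 1
    · rw [← hΓα, Matrix.mulVec_mulVec, Matrix.mulVec_mulVec, mul_assoc]
    · rw [← hΓα, star_transpose_mulVec, Matrix.mulVec_mulVec, Matrix.nonsing_inv_mul _ hΓHu,
        Matrix.one_mulVec]
  have hub : u ⬝ᵥ ((conjGram x)⁻¹ *ᵥ (x.map star *ᵥ u + star u)) = α ⬝ᵥ b := by
    rw [← hΓ, Matrix.mul_inv_rev, ← Matrix.mulVec_mulVec, ← hb]
    nth_rw 1 [← hΓα]
    rw [dotProduct_transpose_mulVec, Matrix.mulVec_mulVec, Matrix.mul_nonsing_inv _ hΓu,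
      Matrix.one_mulVec]
  have hprod : ∏ i, Real.sqrt (Real.sqrt (1 - d i ^ 2)) =
      Real.sqrt (Real.sqrt (conjGram x).det.re) := by
    rw [hx, det_conjGram_takagi hV, Complex.ofReal_re, Real.sqrt_prod, Real.sqrt_prod]
    · exact fun i _ => Real.sqrt_nonneg _
    · exact fun i _ => sub_nonneg.2 ((sq_le_one_iff_abs_le_one _).2 (hd i).le)
  set N := Real.sqrt (Real.sqrt (conjGram x).det.re) with hN
  have hNpos : 0 < N := by
    rw [← hprod]
    exact Finset.prod_pos fun i _ => Real.sqrt_pos.2 (Real.sqrt_pos.2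
      (sub_pos.2 ((sq_lt_one_iff_abs_lt_one _).2 (hd i))))
  have hN0 : (N : ℂ) ≠ 0 := Complex.ofReal_ne_zero.2 hNpos.ne'
  -- The squeezer contributes `N`, and displacement and squeezing together contribute `exp(-αᵀ b /
  -- 2)`. The prescribed modulus of `c` is exactly what makes the quotient a phase.
  set θ := c / (N * Complex.exp (-(1 / 2 * (α ⬝ᵥ b)))) with hθ
  have hθ1 : ‖θ‖ = 1 := by
    rw [hθ, norm_div, hc, norm_mul, Complex.norm_exp, Complex.norm_real,
      Real.norm_of_nonneg hNpos.le,
      hub, div_eq_one_iff_eq (mul_ne_zero hNpos.ne' (Real.exp_pos _).ne')]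
    congr 2
    rw [Complex.neg_re, neg_mul, ← Complex.re_ofReal_mul]
    push_cast
    rfl
  have hcθ : c = θ * N * Complex.exp (-(1 / 2 * (α ⬝ᵥ b))) := by
    rw [hθ, mul_assoc, div_mul_cancel₀]
    exact mul_ne_zero hN0 (Complex.exp_ne_zero _)
  have hWT : (Wᵀ)ᴴ * Wᵀ = 1 := by
    have h1 := transpose_mul_map_star_of_unitary (V := Wᴴ) (by
      rw [Matrix.conjTranspose_conjTranspose, hWW])
    rwa [map_star_conjTranspose] at h1
  obtain ⟨S, hS⟩ := exists_squeezer hd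
  obtain ⟨PV, hPV, hPV'⟩ := exists_passive hV
  obtain ⟨PW, hPW, -⟩ := exists_passive hWT
  obtain ⟨T, hT⟩ := exists_displacement α hθ1
  refine ⟨((T.trans PW).trans S).trans PV, ?_, fun w => isBargmannFunction_iff.2 fun z => ?_⟩
  · rw [hs]
    refine Matrix.IsSymm.fromBlocks ?_ rfl ?_
    · rw [hx, Matrix.IsSymm, Matrix.transpose_mul, Matrix.transpose_mul, Matrix.transpose_transpose,
        hDT, mul_assoc]
    · rw [Matrix.IsSymm, Matrix.transpose_neg, Matrix.transpose_mul, Matrix.transpose_mul,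
        Matrix.transpose_transpose, hDT, mul_assoc]
  have hUw : (((T.trans PW).trans S).trans PV) (bargmannVector w) =
      (θ * Complex.exp (-(1 / 2 * (star α ⬝ᵥ α)) - star α ⬝ᵥ w)) •
        PV (S (bargmannVector (Wᵀ *ᵥ (w + α)))) := by
    simp only [LinearIsometryEquiv.trans_apply, hT, map_smul, hPW]
  have hz : star (Vᴴ *ᵥ star z) = Vᵀ *ᵥ z := by
    rw [← star_transpose_mulVec, star_star]
  have h1 : ((Vᵀ *ᵥ z) ⬝ᵥ (D *ᵥ (Vᵀ *ᵥ z))) = z ⬝ᵥ (x *ᵥ z) := by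
    rw [dotProduct_transpose_mulVec, Matrix.mulVec_mulVec, Matrix.mulVec_mulVec, hx, mul_assoc]
  have h2 : ((Vᵀ *ᵥ z) ⬝ᵥ (E *ᵥ (Wᵀ *ᵥ (w + α)))) = z ⬝ᵥ (Γᵀ *ᵥ w) + z ⬝ᵥ u := by
    rw [dotProduct_transpose_mulVec, Matrix.mulVec_mulVec, Matrix.mulVec_mulVec, ← hΓT,
      Matrix.mulVec_add, hΓα, dotProduct_add]
  have hWD : (W * D * Wᵀ).IsSymm := by
    rw [Matrix.IsSymm, Matrix.transpose_mul, Matrix.transpose_mul,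
        Matrix.transpose_transpose, hDT, mul_assoc]
  have h3 : ((Wᵀ *ᵥ (w + α)) ⬝ᵥ (D *ᵥ (Wᵀ *ᵥ (w + α)))) = w ⬝ᵥ ((W * D * Wᵀ) *ᵥ w) +
      2 * (w ⬝ᵥ ((W * D * Wᵀ) *ᵥ α)) + α ⬝ᵥ ((W * D * Wᵀ) *ᵥ α) := by
    rw [dotProduct_transpose_mulVec, Matrix.mulVec_mulVec, Matrix.mulVec_mulVec,
      Matrix.mulVec_add, dotProduct_add, add_dotProduct, add_dotProduct,
      dotProduct_mulVec_comm_of_isSymm hWD α w]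
    ring
  have h4 : w ⬝ᵥ (Γ *ᵥ z) = z ⬝ᵥ (Γᵀ *ᵥ w) := by
    rw [← dotProduct_transpose_mulVec, dotProduct_comm]
  rw [hUw, inner_smul_right, ← PV.symm_symm, ← PV.symm.inner_map_eq_flip, hPV', hS, hz,
    squeezeKernel_eq,
    ← hD, ← Complex.ofReal_prod, hprod, gaussian, Matrix.fromBlocks_mulVec]
  simp only [Sum.elim_comp_inl, Sum.elim_comp_inr, sumElim_dotProduct_sumElim, dotProduct_add]
  change _ * (_ * Complex.exp (1 / 2 * _ + _ ⬝ᵥ (E *ᵥ _) - _)) = _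
  rw [hs, hcθ, h1, h2, h3, h4, hbα]
  simp only [Matrix.neg_mulVec, dotProduct_neg, dotProduct_add]
  rw [mul_comm (N : ℂ), ← mul_assoc, mul_assoc θ, ← Complex.exp_add, mul_assoc (θ * (N : ℂ)),
    ← Complex.exp_add, mul_right_comm, dotProduct_comm (star α) w, dotProduct_comm (star α) α]
  congr 2
  ring

end

/-! ## Expansions in two groups of variables -/

section

variable {ι κ : Type} [Fintype ι] [Fintype κ]

/-- Absolute summability allows families that are merely bounded to be summed against the monomials.
In each mode the term is split as `((2‖z‖)^n / √(n!)) * 2^(-n)`, and the product of the two factors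
is dominated by the sum of their squares. -/
theorem summable_norm_fockMonomial (z : ι → ℂ) : Summable fun k => ‖fockMonomial z k‖ := by
  refine summable_norm_pi_prod (f := fun i n => z i ^ n / ((Real.sqrt (n.factorial : ℝ) : ℝ) : ℂ))
    fun i => ?_
  have h1 : Summable fun n : ℕ => (4 * ‖z i‖ ^ 2) ^ n / (n.factorial : ℝ) :=
    Real.summable_pow_div_factorial _
  have h2 : Summable fun n : ℕ => (1 / 4 : ℝ) ^ n :=
    summable_geometric_of_lt_one (by norm_num) (by norm_num)
  refine Summable.of_norm_bounded (h1.add h2) fun n => ?_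
  have hf : 0 < (n.factorial : ℝ) := by exact_mod_cast n.factorial_pos
  have e : ‖z i ^ n / ((Real.sqrt (n.factorial : ℝ) : ℝ) : ℂ)‖ =
      ((2 * ‖z i‖) ^ n / Real.sqrt n.factorial) * (1 / 2) ^ n := by
    rw [norm_div, norm_pow, Complex.norm_real, Real.norm_of_nonneg (Real.sqrt_nonneg _), mul_pow,
      div_mul_eq_mul_div, mul_right_comm, ← mul_pow]
    norm_num
  have e1 : (4 * ‖z i‖ ^ 2) ^ n / (n.factorial : ℝ) =
      ((2 * ‖z i‖) ^ n / Real.sqrt n.factorial) ^ 2 := by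
    rw [div_pow, Real.sq_sqrt hf.le, ← pow_mul, mul_comm n, pow_mul]
    ring
  have e2 : (1 / 4 : ℝ) ^ n = ((1 / 2) ^ n) ^ 2 := by
    rw [← pow_mul, mul_comm n, pow_mul]
    norm_num
  rw [e, e1, e2]
  nlinarith [sq_nonneg ((2 * ‖z i‖) ^ n / Real.sqrt n.factorial - (1 / 2) ^ n),
    sq_nonneg ((2 * ‖z i‖) ^ n / Real.sqrt n.factorial), sq_nonneg ((1 / 2 : ℝ) ^ n)]

theorem fockMonomial_sum (ζ : ι ⊕ κ → ℂ) (l : ι ⊕ κ → ℕ) : fockMonomial ζ l =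
    fockMonomial (ζ ∘ Sum.inl) (l ∘ Sum.inl) * fockMonomial (ζ ∘ Sum.inr) (l ∘ Sum.inr) := by
  rw [fockMonomial, Fintype.prod_sum_type]
  rfl

/-- A bounded family has an expansion in two groups of variables if it can be summed iteratively. -/
theorem hasExpansion_of_slices {f : (ι ⊕ κ → ℕ) → ℂ} {F : (ι ⊕ κ → ℂ) → ℂ}
    (hf : ∀ l, ‖f l‖ ≤ 1)
    (h : ∀ z y, ∃ g : (ι → ℕ) → ℂ,
      (∀ j, HasSum (fun k => f (Sum.elim j k) * fockMonomial y k) (g j)) ∧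
      HasSum (fun j => g j * fockMonomial z j) (F (Sum.elim z y))) : HasExpansion f F := by
  intro ζ
  obtain ⟨g, hg, hgF⟩ := h (ζ ∘ Sum.inl) (ζ ∘ Sum.inr)
  rw [Sum.elim_comp_inl_inr] at hgF
  -- Boundedness of the coefficients gives convergence of the joint sum, so the iterated sum must
  -- have the same value.
  have hs : Summable fun l => f l * fockMonomial ζ l := by
    refine Summable.of_norm_bounded (summable_norm_fockMonomial ζ) fun l => ?_
    rw [norm_mul]
    exact mul_le_of_le_one_left (norm_nonneg _) (hf l)
  have h1 := (Equiv.sumArrowEquivProdArrow ι κ ℕ).symm.hasSum_iff.2 hs.hasSum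
  have h2 := HasSum.prod_fiberwise h1 (g := fun j => g j * fockMonomial (ζ ∘ Sum.inl) j) fun j => by
    convert! (hg j).mul_right (fockMonomial (ζ ∘ Sum.inl) j) using 2 with k
    have e : (Equiv.sumArrowEquivProdArrow ι κ ℕ).symm (j, k) = Sum.elim j k := rfl
    simp only [Function.comp_apply, e, fockMonomial_sum, Sum.elim_comp_inl, Sum.elim_comp_inr]
    ring
  rw [hgF.unique h2]
  exact hs.hasSum

theorem norm_apply_le (φ : Fock ι) (k : ι → ℕ) : ‖φ k‖ ≤ ‖φ‖ :=
  lp.norm_apply_le_norm (by norm_num) φ k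

/-- Evaluation of an amplitude, as a continuous linear functional. -/
def evalCLM (j : ι → ℕ) : Fock ι →L[ℂ] ℂ :=
  lp.evalCLM ℂ (fun _ : ι → ℕ => ℂ) 2 j

theorem hasSum_smul_ket [DecidableEq ι] (φ : Fock ι) : HasSum (fun k => φ k • ket k) φ := by
  have h := lp.hasSum_single (E := fun _ : ι → ℕ => ℂ) (p := 2) (by norm_num) φ
  convert! h using 2 with k
  rw [ket, ← lp.single_smul]
  simp

theorem norm_ket [DecidableEq ι] (k : ι → ℕ) : ‖ket k‖ = 1 := by
  rw [ket, lp.norm_single (by norm_num)]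
  simp

/-! ## Gaussian unitaries from their Abc parameters -/

variable [DecidableEq ι]

/-- The matrix elements of a unitary. -/
def matrixElement (U : Fock ι ≃ₗᵢ[ℂ] Fock ι) (l : ι ⊕ ι → ℕ) : ℂ :=
  U (ket (l ∘ Sum.inr)) (l ∘ Sum.inl)

/-- The parameters give an expansion in the output variables for each fixed input. Expanding the
coherent input in Fock states under the continuous map `U` supplies the other half; matrix elements
of a unitary are bounded by one. -/
theorem hasExpansion_matrixElement {U : Fock ι ≃ₗᵢ[ℂ] Fock ι} {A : Matrix (ι ⊕ ι) (ι ⊕ ι) ℂ}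
    {b : ι ⊕ ι → ℂ} {c : ℂ} (h : IsUnitaryAbc U A b c) :
    HasExpansion (matrixElement U) (gaussian A b c) := by
  refine hasExpansion_of_slices (fun l => ?_) fun z w => ⟨fun j => U (bargmannVector w) j, ?_, ?_⟩
  · refine (norm_apply_le _ _).trans ?_
    rw [LinearIsometryEquiv.norm_map, norm_ket]
  · intro j
    have h1 := ((evalCLM j).comp (U.toContinuousLinearEquiv : Fock ι →L[ℂ] Fock ι)).hasSum
      (hasSum_smul_ket (bargmannVector w))
    convert! h1 using 2 with k
    have e : ((evalCLM j).comp (U.toContinuousLinearEquiv : Fock ι →L[ℂ] Fock ι)) (ket k) =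
      U (ket k) j := rfl
    rw [map_smul, e, smul_eq_mul, mul_comm]
    rfl
  · exact h.2 w z

theorem create_eq_raiseCoeff (U : Fock ι ≃ₗᵢ[ℂ] Fock ι) (i : ι) (j k : ι → ℕ) :
    create i (U (ket k)) j = raiseCoeff (Sum.inl i) (matrixElement U) (Sum.elim j k) := by
  simp only [create, raiseCoeff, matrixElement, Sum.elim_inl, Sum.update_elim_inl,
    Sum.elim_comp_inl, Sum.elim_comp_inr]

theorem annihilate_eq_lowerCoeff (U : Fock ι ≃ₗᵢ[ℂ] Fock ι) (i : ι) (j k : ι → ℕ) :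
    annihilate i (U (ket k)) j = lowerCoeff (Sum.inl i) (matrixElement U) (Sum.elim j k) := by
  simp only [annihilate, lowerCoeff, matrixElement, Sum.elim_inl, Sum.update_elim_inl,
    Sum.elim_comp_inl, Sum.elim_comp_inr]

/-- On the input side the roles are exchanged: `U a_l` is multiplication of the kernel by `w_l`, and
`U a_l†` is differentiation in `w_l`. -/
theorem unitary_lowerKet_apply (U : Fock ι ≃ₗᵢ[ℂ] Fock ι) (l : ι) (j k : ι → ℕ) :
    U (lowerKet l k) j = raiseCoeff (Sum.inr l) (matrixElement U) (Sum.elim j k) := by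
  simp only [lowerKet, map_smul, raiseCoeff, matrixElement, Sum.elim_inr, Sum.update_elim_inr,
    Sum.elim_comp_inl, Sum.elim_comp_inr]
  rfl

theorem unitary_raiseKet_apply (U : Fock ι ≃ₗᵢ[ℂ] Fock ι) (l : ι) (j k : ι → ℕ) :
    U (raiseKet l k) j = lowerCoeff (Sum.inr l) (matrixElement U) (Sum.elim j k) := by
  simp only [raiseKet, map_smul, lowerCoeff, matrixElement, Sum.elim_inr, Sum.update_elim_inr,
    Sum.elim_comp_inl, Sum.elim_comp_inr]
  rfl

theorem unitary_ladder_apply (U : Fock ι ≃ₗᵢ[ℂ] Fock ι) (p q : ι → ℂ) (r : ℂ) (j k : ι → ℕ) :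
    U (∑ l, (p l • lowerKet l k + q l • raiseKet l k) + r • ket k) j =
      p ⬝ᵥ (fun l => raiseCoeff (Sum.inr l) (matrixElement U) (Sum.elim j k)) +
      q ⬝ᵥ (fun l => lowerCoeff (Sum.inr l) (matrixElement U) (Sum.elim j k)) +
      matrixElement U (Sum.elim j k) * r := by
  simp only [← unitary_raiseKet_apply, ← unitary_lowerKet_apply]
  change evalCLM j (U _) = _
  simp only [map_add, map_sum, map_smul, dotProduct, Finset.sum_add_distrib, smul_eq_mul]
  congr 1
  exact mul_comm _ _

/-- The kernel satisfies `∂_z F = (x z + Γᵀ w + u) F` and `∂_w F = (Γ z + s w + b) F`.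
Multiplication by `z`, `w` and differentiation by `z`, `w` are `a† U`, `U a`, `a U`, `U a†`
respectively. Solving the second equation for `z F` and substituting in the first expresses `a† U`
and `a U` through `U a` and `U a†`; the relations between the blocks make the two sets of
coefficients conjugate and symplectic. -/
theorem isGaussianUnitary_of_isUnitaryAbc {U : Fock ι ≃ₗᵢ[ℂ] Fock ι} {x Γ s : Matrix ι ι ℂ}
    {u b : ι → ℂ} {c : ℂ} (h : IsUnitaryAbc U (Matrix.fromBlocks x Γᵀ Γ s) (Sum.elim u b) c)
    (hΓ : Γᴴ * Γ = conjGram x) (hΓu : IsUnit Γ.det) (hs : Γᴴ * s = -(x.map star * Γᵀ))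
    (hb : Γᴴ *ᵥ b = -(x.map star *ᵥ u + star u)) : IsGaussianUnitary U := by
  obtain ⟨hx, -, -, hsS⟩ := Matrix.isSymm_fromBlocks_iff.1 h.1
  set P := Γ⁻¹ with hP
  have hPΓ : P * Γ = 1 := Matrix.nonsing_inv_mul _ hΓu
  have hΓP : Γ * P = 1 := Matrix.mul_nonsing_inv _ hΓu
  clear_value P
  have hxH : xᴴ = x.map star := conjTranspose_eq_map_star hx
  have hxT : (x.map star)ᵀ = x.map star := by rw [← hxH, Matrix.conjTranspose_transpose, hxH]
  have one_star : (1 : Matrix ι ι ℂ).map star = 1 := by simp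
  have hΓPs : Γ.map star * P.map star = 1 := by rw [← map_star_mul, hΓP, one_star]
  have hPΓs : P.map star * Γ.map star = 1 := by rw [← map_star_mul, hPΓ, one_star]
  have hΓs : Γᵀ * Γ.map star = 1 - x * x.map star := by
    have := congrArg (fun M : Matrix ι ι ℂ => M.map star) hΓ
    simp only [map_star_mul, map_star_conjTranspose, conjGram] at this
    rw [this, Matrix.map_sub _ (fun a b => star_sub a b), one_star, map_star_mul, map_star_map_star]
  have hΓx : Γ * x.map star = -(s * Γ.map star) := by
    have := congrArg Matrix.transpose hs
    rw [Matrix.transpose_mul, hsS.eq, Matrix.transpose_neg, Matrix.transpose_mul,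
      Matrix.transpose_transpose, hxT, Matrix.conjTranspose_transpose] at this
    rw [this, neg_neg]
  have h1 : x.map star * P.map star = -(P * s) := by
    calc x.map star * P.map star = P * (Γ * x.map star) * P.map star := by
          rw [← mul_assoc, hPΓ, one_mul]
      _ = -(P * s * (Γ.map star * P.map star)) := by
          rw [hΓx, mul_neg, neg_mul]
          simp only [mul_assoc]
      _ = _ := by rw [hΓPs, mul_one]
  have h2 : Γᵀ - x * P * s = P.map star := by
    calc Γᵀ - x * P * s = Γᵀ + x * (x.map star * P.map star) := by
          rw [h1, mul_neg, mul_assoc, sub_eq_add_neg]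
      _ = (Γᵀ * Γ.map star + x * x.map star) * P.map star := by
          rw [add_mul, mul_assoc Γᵀ, hΓPs, mul_one, mul_assoc]
      _ = _ := by rw [hΓs, sub_add_cancel, one_mul]
  have hHinj : Function.Injective (conjGram x).mulVec := by
    rw [← hΓ]
    refine Matrix.mulVec_injective_of_isUnit (.mul ?_ (.of_mul_eq_one _ hΓP))
    exact (Matrix.isUnit_iff_isUnit_det _).2 (by
      rw [Matrix.det_conjTranspose]
      exact hΓu.star)
  have hstar : ∀ (M : Matrix ι ι ℂ) (v : ι → ℂ), star (M *ᵥ v) = M.map star *ᵥ star v := by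
    intro M v
    funext i
    simp [Matrix.mulVec, dotProduct]
  have hHb : conjGram x *ᵥ (-(P *ᵥ b)) = x.map star *ᵥ u + star u := by
    rw [← hΓ, Matrix.mulVec_neg, Matrix.mulVec_mulVec, mul_assoc, hΓP, mul_one, hb, neg_neg]
  -- The two constant terms are conjugate. It suffices to compare them after applying `conjGram x`,
  -- where `x* (1 - x x*) = (1 - x* x) x*` moves `x*` past the Gram matrix.
  have h3 : star (u - (x * P) *ᵥ b) = -(P *ᵥ b) := by
    apply hHinj
    have hb2 := congrArg star hHb
    rw [hstar, star_add, hstar, map_star_map_star, star_star, star_neg] at hb2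
    have e1 : (conjGram x).map star = 1 - x * x.map star := by
      rw [conjGram, Matrix.map_sub _ (fun a b => star_sub a b), one_star, map_star_mul,
        map_star_map_star]
    have e2 : conjGram x * x.map star = x.map star * (conjGram x).map star := by
      rw [e1, conjGram, sub_mul, mul_sub, one_mul, mul_one, mul_assoc]
    have e3 : star (u - (x * P) *ᵥ b) = star u + x.map star *ᵥ (-star (P *ᵥ b)) := by
      rw [star_sub, ← Matrix.mulVec_mulVec, hstar x, Matrix.mulVec_neg, sub_eq_add_neg]
    rw [e3, Matrix.mulVec_add, Matrix.mulVec_mulVec, e2, ← Matrix.mulVec_mulVec, hb2, hHb,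
      Matrix.mulVec_add, Matrix.mulVec_mulVec, conjGram, Matrix.sub_mulVec, Matrix.one_mulVec]
    abel
  have hG : conjGram x * (P * Pᴴ) = 1 := by
    rw [← hΓ, mul_assoc, ← mul_assoc Γ, hΓP, one_mul, ← Matrix.conjTranspose_mul, hPΓ,
      Matrix.conjTranspose_one]
  have hG' := mul_eq_one_comm.1 hG
  have hGs : (1 - x * x.map star) * (P.map star * Pᵀ) = 1 := by
    rw [← hΓs, mul_assoc, ← mul_assoc (Γ.map star), hΓPs, one_mul, ← Matrix.transpose_mul, hPΓ,
      Matrix.transpose_one]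
  have hGs' := mul_eq_one_comm.1 hGs
  have hxc : x * conjGram x = (1 - x * x.map star) * x := by
    rw [conjGram, mul_sub, sub_mul, one_mul, mul_one, mul_assoc]
  -- The intertwining `x (1 - x* x) = (1 - x x*) x` passes to the inverses `P Pᴴ` and `P* Pᵀ`.
  have hxG : x * (P * Pᴴ) = P.map star * Pᵀ * x := by
    calc x * (P * Pᴴ) = (P.map star * Pᵀ * (1 - x * x.map star)) * x * (P * Pᴴ) := by
          rw [hGs', one_mul]
      _ = P.map star * Pᵀ * (x * conjGram x) * (P * Pᴴ) := by rw [hxc]; simp only [mul_assoc]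
      _ = P.map star * Pᵀ * x * (conjGram x * (P * Pᴴ)) := by simp only [mul_assoc]
      _ = _ := by rw [hG, mul_one]
  -- These are the coefficients left in the equation for `a U` after eliminating `a† U`; `h2`
  -- rewrites `Γᵀ - x P s` as `P*`.
  refine ⟨P.map star, x * P, u - (x * P) *ᵥ b, ?_, ?_, ?_, ?_⟩
  · have e : (P.map star)ᴴ = Pᵀ := by
      ext
      simp
    rw [e, Matrix.conjTranspose_mul, hxH]
    calc P.map star * Pᵀ - x * P * (Pᴴ * x.map star)
        = P.map star * Pᵀ - x * (P * Pᴴ) * x.map star := by simp only [mul_assoc]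
      _ = P.map star * Pᵀ * (1 - x * x.map star) := by
          rw [hxG, mul_sub, mul_one]
          simp only [mul_assoc]
      _ = 1 := hGs'
  · have e : (P.map star)ᵀ = Pᴴ := rfl
    rw [e, Matrix.transpose_mul, hx.eq, ← mul_assoc, ← hxG, mul_assoc]
  all_goals
    intro i k
    funext j
    rw [unitary_ladder_apply]
    set f₀ := matrixElement U (Sum.elim j k)
    set R : ι → ℂ := fun l => raiseCoeff (Sum.inr l) (matrixElement U) (Sum.elim j k)
    set L : ι → ℂ := fun l => lowerCoeff (Sum.inr l) (matrixElement U) (Sum.elim j k) with hL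
    set C : ι → ℂ := fun l => raiseCoeff (Sum.inl l) (matrixElement U) (Sum.elim j k)
    have hlow := fun i => (hasExpansion_matrixElement h).lowerCoeff_gaussian h.1 i (Sum.elim j k)
    have hLC : L = Γ *ᵥ C + s *ᵥ R + f₀ • b := by
      funext l
      rw [hL]
      beta_reduce
      rw [hlow, Fintype.sum_sum_type]
      simp [Matrix.mulVec, dotProduct, R, C, f₀, mul_comm]
    -- Invertibility of `Γ` solves the input equation for `a† U`.
    have hC : C = P *ᵥ L - (P * s) *ᵥ R - f₀ • (P *ᵥ b) := by
      rw [hLC, Matrix.mulVec_add, Matrix.mulVec_add, Matrix.mulVec_mulVec, hPΓ, Matrix.one_mulVec,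
        Matrix.mulVec_mulVec, Matrix.mulVec_smul]
      abel
  · rw [annihilate_eq_lowerCoeff, hlow, Fintype.sum_sum_type]
    have e : ∑ l, Matrix.fromBlocks x Γᵀ Γ s (Sum.inl i) (Sum.inl l) *
          raiseCoeff (Sum.inl l) (matrixElement U) (Sum.elim j k) +
        ∑ l, Matrix.fromBlocks x Γᵀ Γ s (Sum.inl i) (Sum.inr l) *
          raiseCoeff (Sum.inr l) (matrixElement U) (Sum.elim j k) +
        Sum.elim u b (Sum.inl i) * f₀ = (x *ᵥ C + Γᵀ *ᵥ R + f₀ • u) i := by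
      simp [Matrix.mulVec, dotProduct, R, C, f₀, mul_comm]
    have e' : P.map star i ⬝ᵥ R + (x * P) i ⬝ᵥ L + f₀ * (u - (x * P) *ᵥ b) i =
        (P.map star *ᵥ R + (x * P) *ᵥ L + f₀ • (u - (x * P) *ᵥ b)) i := rfl
    refine e.trans (Eq.trans ?_ e'.symm)
    rw [hC, ← h2, Matrix.mulVec_sub, Matrix.mulVec_sub, Matrix.sub_mulVec, Matrix.mulVec_mulVec,
      Matrix.mulVec_mulVec, Matrix.mulVec_smul, Matrix.mulVec_mulVec, smul_sub, mul_assoc]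
    simp only [Pi.add_apply, Pi.sub_apply]
    ring
  · rw [create_eq_raiseCoeff]
    have e' : (fun l => star ((x * P) i l)) ⬝ᵥ R + (fun l => star (P.map star i l)) ⬝ᵥ L +
        f₀ * star ((u - (x * P) *ᵥ b) i) =
        ((x * P).map star *ᵥ R + (P.map star).map star *ᵥ L + f₀ • star (u - (x * P) *ᵥ b)) i := rfl
    refine Eq.trans (?_ : _ = C i) (Eq.trans ?_ e'.symm)
    · rfl
    · rw [hC, map_star_mul, h1, map_star_map_star, h3, Matrix.neg_mulVec, smul_neg]
      simp only [Pi.add_apply, Pi.sub_apply, Pi.neg_apply]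
      ring

end

/-! ## Operators on the first group of modes -/

section

variable {ι κ : Type} [Fintype ι] [Fintype κ]

theorem project_applyFirst (U : Fock ι ≃ₗᵢ[ℂ] Fock ι) (ψ : Fock (ι ⊕ κ)) (k : κ → ℕ) :
    project k (applyFirst U ψ) = U (project k ψ) := rfl

theorem apply_eq_project (ψ : Fock (ι ⊕ κ)) (l : ι ⊕ κ → ℕ) :
    ψ l = project (l ∘ Sum.inr) ψ (l ∘ Sum.inl) := by
  change _ = ψ (Sum.elim (l ∘ Sum.inl) (l ∘ Sum.inr))
  rw [Sum.elim_comp_inl_inr]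

theorem ext_project {φ χ : Fock (ι ⊕ κ)} (h : ∀ k, project k φ = project k χ) : φ = χ := by
  refine lp.ext (funext fun l => ?_)
  rw [apply_eq_project φ, apply_eq_project χ, h]

theorem applyFirst_symm (U : Fock ι ≃ₗᵢ[ℂ] Fock ι) (ψ : Fock (ι ⊕ κ)) :
    applyFirst U (applyFirst U.symm ψ) = ψ :=
  ext_project fun k => by rw [project_applyFirst, project_applyFirst, U.apply_symm_apply]

theorem norm_sq_eq_tsum_project (ψ : Fock (ι ⊕ κ)) : ‖ψ‖ ^ 2 = ∑' k : κ → ℕ, ‖project k ψ‖ ^ 2 := by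
  have h1 := (summable_sq_prod ψ).tsum_prod
  have h2 := (((Equiv.sumArrowEquivProdArrow ι κ ℕ).trans (Equiv.prodComm _ _)).symm).tsum_eq
    fun l => ‖ψ l‖ ^ 2
  rw [norm_sq_eq_tsum, ← h2]
  refine Eq.trans h1 (tsum_congr fun k => ?_)
  rw [norm_sq_eq_tsum]
  rfl

theorem norm_applyFirst (U : Fock ι ≃ₗᵢ[ℂ] Fock ι) (ψ : Fock (ι ⊕ κ)) :
    ‖applyFirst U ψ‖ = ‖ψ‖ := by
  rw [← sq_eq_sq₀ (norm_nonneg _) (norm_nonneg _), norm_sq_eq_tsum_project, norm_sq_eq_tsum_project]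
  simp only [project_applyFirst, LinearIsometryEquiv.norm_map]

theorem norm_project_le (ψ : Fock (ι ⊕ κ)) (k : κ → ℕ) : ‖project k ψ‖ ≤ ‖ψ‖ := by
  rw [← sq_le_sq₀ (norm_nonneg _) (norm_nonneg _), norm_sq_eq_tsum_project]
  exact (summable_norm_project ψ).le_tsum k fun _ _ => by positivity

/-- The vector `∑_k y ^ k / √(k!) (1 ⊗ ⟨k|) ψ`. -/
def partialBargmann (ψ : Fock (ι ⊕ κ)) (y : κ → ℂ) : Fock ι :=
  ∑' k, fockMonomial y k • project k ψ

theorem hasSum_partialBargmann (ψ : Fock (ι ⊕ κ)) (y : κ → ℂ) :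
    HasSum (fun k => fockMonomial y k • project k ψ) (partialBargmann ψ y) := by
  refine Summable.hasSum (Summable.of_norm_bounded
    ((summable_norm_fockMonomial y).mul_right ‖ψ‖) fun k => ?_)
  rw [norm_smul]
  exact mul_le_mul_of_nonneg_left (norm_project_le ψ k) (norm_nonneg _)

/-- Freezing the variables of the second group gives a vector of the first group alone, to which `U`
and the uniqueness of Bargmann functions apply. -/
theorem isBargmannFunction_partialBargmann {ψ : Fock (ι ⊕ κ)} {F : (ι ⊕ κ → ℂ) → ℂ}
    (h : IsBargmannFunction ψ F) (y : κ → ℂ) :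
    IsBargmannFunction (partialBargmann ψ y) fun z => F (Sum.elim z y) := by
  intro z
  have h1 := (Equiv.sumArrowEquivProdArrow ι κ ℕ).symm.hasSum_iff.2 (h (Sum.elim z y))
  refine HasSum.prod_fiberwise h1 fun j => ?_
  convert! ((evalCLM j).hasSum (hasSum_partialBargmann ψ y)).mul_right (fockMonomial z j) using 2
    with k
  have e : (Equiv.sumArrowEquivProdArrow ι κ ℕ).symm (j, k) = Sum.elim j k := rfl
  have e' : evalCLM j (project k ψ) = ψ (Sum.elim j k) := rfl
  simp only [Function.comp_apply, e, fockMonomial_sum, Sum.elim_comp_inl, Sum.elim_comp_inr,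
    map_smul, e', smul_eq_mul]
  ring

theorem hasSum_tensor_project [DecidableEq κ] (ψ : Fock (ι ⊕ κ)) :
    HasSum (fun k : κ → ℕ => tensor (project k ψ) (ket k)) ψ := by
  classical
  have h1 := ((Equiv.sumArrowEquivProdArrow ι κ ℕ).trans (Equiv.prodComm _ _)).symm.hasSum_iff.2
    (hasSum_smul_ket ψ)
  refine HasSum.prod_fiberwise h1 fun k => ?_
  have h2 := hasSum_smul_ket (tensor (project k ψ) (ket k))
  have hval : ∀ l : ι ⊕ κ → ℕ, tensor (project k ψ) (ket k) l =
      if l ∘ Sum.inr = k then ψ l else 0 := by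
    intro l
    change ket k (l ∘ Sum.inr) * project k ψ (l ∘ Sum.inl) = _
    rw [ket, lp.single_apply, Pi.single_apply]
    split_ifs with hl
    · rw [one_mul, apply_eq_project ψ l, hl]
    · rw [zero_mul]
  have hinj : Function.Injective fun j : ι → ℕ => (Sum.elim j k : ι ⊕ κ → ℕ) := by
    intro j₁ j₂ h
    have := congrArg (fun l : ι ⊕ κ → ℕ => l ∘ Sum.inl) h
    simpa using this
  have h3 := (hinj.hasSum_iff fun l hl => ?_).2 h2
  · convert! h3 using 2 with j
    simp only [Function.comp_apply, hval, Sum.elim_comp_inr, if_true]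
    rfl
  · rw [hval, if_neg, zero_smul]
    rintro rfl
    exact hl ⟨l ∘ Sum.inl, Sum.elim_comp_inl_inr l⟩

variable [DecidableEq ι] [DecidableEq κ]

theorem mem_tuplesUpTo {q : ℕ} {j : ι → ℕ} : j ∈ tuplesUpTo ι q ↔ ∑ i, j i ≤ q := by
  rw [tuplesUpTo, Finset.mem_filter, and_iff_right_iff_imp, Fintype.mem_piFinset]
  intro h i
  have := Finset.single_le_sum (f := j) (fun _ _ => Nat.zero_le _) (Finset.mem_univ i)
  rw [Finset.mem_range]
  omega

/-- If the upper left block and the upper part of the linear term vanish, the Fock support of the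
slices is bounded. -/
theorem apply_eq_zero_of_isKetAbc {φ : Fock (ι ⊕ κ)} {R : Matrix κ ι ℂ} {y : Matrix κ κ ℂ}
    {v : κ → ℂ} {c : ℂ} (h : IsKetAbc φ (Matrix.fromBlocks 0 Rᵀ R y) (Sum.elim 0 v) c) (q : ℕ) :
    ∀ (j : ι → ℕ) (k : κ → ℕ), ∑ i, j i = q → ∑ i, k i < q → φ (Sum.elim j k) = 0 := by
  induction q with
  | zero =>
    intro j k _ hk
    exact absurd hk (Nat.not_lt_zero _)
  | succ q ih =>
    intro j k hj hk
    obtain ⟨i, hi⟩ : ∃ i, j i ≠ 0 := by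
      by_contra! h0
      simp [h0] at hj
    have hs : ∑ l, Function.update j i (j i - 1) l = q := by
      have h1 := Finset.add_sum_erase Finset.univ j (Finset.mem_univ i)
      have h2 := Finset.add_sum_erase Finset.univ (Function.update j i (j i - 1))
        (Finset.mem_univ i)
      have h3 : ∑ l ∈ Finset.univ.erase i, Function.update j i (j i - 1) l =
          ∑ l ∈ Finset.univ.erase i, j l :=
        Finset.sum_congr rfl fun l hl => Function.update_of_ne (Finset.ne_of_mem_erase hl) _ _
      rw [h3, Function.update_self] at h2
      omega
    -- The equation is read at `j - 1_i`. The first block and the linear term vanish there, so the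
    -- amplitude at `(j, k)` is a combination of amplitudes at `(j - 1_i, k - 1_l)`: both totals
    -- drop by one, and the strict inequality persists.
    have hlow := HasExpansion.lowerCoeff_gaussian h.1 h.2 (Sum.inl i)
      (Sum.elim (Function.update j i (j i - 1)) k)
    rw [Fintype.sum_sum_type] at hlow
    have hz : ∀ l, raiseCoeff (Sum.inr l) φ (Sum.elim (Function.update j i (j i - 1)) k) = 0 := by
      intro l
      rw [raiseCoeff, Sum.elim_inr, Sum.update_elim_inr]
      by_cases hl : k l = 0
      · rw [hl, Nat.cast_zero, Real.sqrt_zero, Complex.ofReal_zero, zero_mul]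
      · rw [ih _ _ hs, mul_zero]
        have h1 := Finset.add_sum_erase Finset.univ k (Finset.mem_univ l)
        have h2 := Finset.add_sum_erase Finset.univ (Function.update k l (k l - 1))
          (Finset.mem_univ l)
        have h3 : ∑ l' ∈ Finset.univ.erase l, Function.update k l (k l - 1) l' =
            ∑ l' ∈ Finset.univ.erase l, k l' :=
          Finset.sum_congr rfl fun l hl => Function.update_of_ne (Finset.ne_of_mem_erase hl) _ _
        rw [h3, Function.update_self] at h2
        omega
    simp only [lowerCoeff, hz, Sum.elim_inl, Sum.update_elim_inl, Function.update_self,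
      Function.update_idem, Matrix.fromBlocks_apply₁₁, Matrix.zero_apply, zero_mul, mul_zero,
      Finset.sum_const_zero, add_zero, Pi.zero_apply] at hlow
    rw [Nat.sub_add_cancel (Nat.pos_of_ne_zero hi), Function.update_eq_self] at hlow
    exact (mul_eq_zero.1 hlow).resolve_left (sqrt_succ_ne_zero _)

theorem project_eq_sum_of_isKetAbc {φ : Fock (ι ⊕ κ)} {R : Matrix κ ι ℂ} {y : Matrix κ κ ℂ}
    {v : κ → ℂ} {c : ℂ} (h : IsKetAbc φ (Matrix.fromBlocks 0 Rᵀ R y) (Sum.elim 0 v) c)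
    (k : κ → ℕ) :
    project k φ = ∑ j ∈ tuplesUpTo ι (∑ i, k i), φ (Sum.elim j k) • ket j := by
  have h1 := hasSum_smul_ket (project k φ)
  refine h1.unique (hasSum_sum_of_ne_finset_zero fun j hj => ?_)
  rw [mem_tuplesUpTo, not_le] at hj
  have : project k φ j = 0 := apply_eq_zero_of_isKetAbc h _ j k rfl hj
  rw [this, zero_smul]

end

/-! ## The stellar decomposition -/

section

variable {ι κ : Type} [Fintype ι] [Fintype κ]

theorem IsKetAbc.c_ne_zero {ψ : Fock ι} {A : Matrix ι ι ℂ} {b : ι → ℂ} {c : ℂ} (hψ : ‖ψ‖ = 1)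
    (h : IsKetAbc ψ A b c) : c ≠ 0 := by
  rintro rfl
  have h0 : ψ = 0 := h.2.ext fun z => by simp [gaussian]
  simp [h0] at hψ

theorem gaussian_sum (A : Matrix (ι ⊕ κ) (ι ⊕ κ) ℂ) (hA : A.IsSymm) (b : ι ⊕ κ → ℂ) (c : ℂ)
    (z : ι → ℂ) (y : κ → ℂ) : gaussian A b c (Sum.elim z y) = c * Complex.exp
      (1 / 2 * (z ⬝ᵥ (A.toBlocks₁₁ *ᵥ z)) + z ⬝ᵥ (A.toBlocks₂₁ᵀ *ᵥ y) +
        1 / 2 * (y ⬝ᵥ (A.toBlocks₂₂ *ᵥ y)) + z ⬝ᵥ (b ∘ Sum.inl) + y ⬝ᵥ (b ∘ Sum.inr)) := by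
  have h12 : A.toBlocks₁₂ = A.toBlocks₂₁ᵀ := by
    ext i j
    exact hA.apply _ _
  have hb : b = Sum.elim (b ∘ Sum.inl) (b ∘ Sum.inr) := (Sum.elim_comp_inl_inr b).symm
  have h4 : y ⬝ᵥ (A.toBlocks₂₁ *ᵥ z) = z ⬝ᵥ (A.toBlocks₂₁ᵀ *ᵥ y) := by
    rw [Matrix.mulVec_transpose, dotProduct_comm z, ← Matrix.dotProduct_mulVec]
  rw [gaussian, ← Matrix.fromBlocks_toBlocks A, h12]
  nth_rw 1 [hb]
  simp only [Matrix.fromBlocks_mulVec, Sum.elim_comp_inl, Sum.elim_comp_inr,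
    sumElim_dotProduct_sumElim, dotProduct_add, Matrix.toBlocks_fromBlocks₁₁,
    Matrix.toBlocks_fromBlocks₂₁, Matrix.toBlocks_fromBlocks₂₂, h4]
  congr 2
  ring

variable [DecidableEq ι]

/-- At `y = 0` only the projection onto the vacuum of the last modes survives. It is a vector with
parameters `(x, u, c)` and `c ≠ 0`, so the strict bound applies to `x`. -/
theorem exists_takagi_of_isKetAbc [DecidableEq κ] {ψ : Fock (ι ⊕ κ)}
    {A : Matrix (ι ⊕ κ) (ι ⊕ κ) ℂ} {b : ι ⊕ κ → ℂ} {c : ℂ} (hψ : ‖ψ‖ = 1) (h : IsKetAbc ψ A b c) :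
    ∃ (V : Matrix ι ι ℂ) (d : ι → ℝ), Vᴴ * V = 1 ∧ (∀ i, |d i| < 1) ∧
      A.toBlocks₁₁ = V * Matrix.diagonal (fun i => (d i : ℂ)) * Vᵀ := by
  have hx : A.toBlocks₁₁.IsSymm := by
    ext i j
    exact h.1.apply _ _
  obtain ⟨V, d, hV, hd⟩ := exists_takagi hx
  refine ⟨V, d, hV, ?_, hd⟩
  have h0 := isBargmannFunction_partialBargmann h.2 0
  have e : (fun z : ι → ℂ => gaussian A b c (Sum.elim z 0)) =
      gaussian A.toBlocks₁₁ (b ∘ Sum.inl) c := by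
    funext z
    rw [gaussian_sum A h.1, gaussian]
    simp
  rw [e, hd] at h0
  exact abs_lt_one_of_takagi (h.c_ne_zero hψ) hV h0

theorem posDef_gram [DecidableEq κ] {ψ : Fock (ι ⊕ κ)}
    {A : Matrix (ι ⊕ κ) (ι ⊕ κ) ℂ} {b : ι ⊕ κ → ℂ} {c : ℂ} (hψ : ‖ψ‖ = 1) (h : IsKetAbc ψ A b c) :
    (gram A).PosDef := by
  obtain ⟨V, d, hV, hd, hx⟩ := exists_takagi_of_isKetAbc hψ h
  have e : gram A = conjGram A.toBlocks₁₁ := rfl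
  rw [e, hx, conjGram_takagi hV]
  refine posDef_of_takagi hV (Matrix.posDef_diagonal_iff.2 fun i => ?_)
  exact_mod_cast sub_pos.2 ((sq_lt_one_iff_abs_lt_one _).2 (hd i))

theorem exists_posDef_sqrt_gram [DecidableEq κ] {ψ : Fock (ι ⊕ κ)}
    {A : Matrix (ι ⊕ κ) (ι ⊕ κ) ℂ} {b : ι ⊕ κ → ℂ} {c : ℂ} (hψ : ‖ψ‖ = 1) (h : IsKetAbc ψ A b c) :
    ∃ Γ : Matrix ι ι ℂ, Γ.PosDef ∧ Γ * Γ = gram A := by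
  obtain ⟨V, d, hV, hd, hx⟩ := exists_takagi_of_isKetAbc hψ h
  refine ⟨V.map star * coDiagonal d * Vᵀ, posDef_of_takagi hV (posDef_coDiagonal hd), ?_⟩
  have e : gram A = conjGram A.toBlocks₁₁ := rfl
  rw [e, hx, conjGram_takagi hV, ← coDiagonal_mul_self hd]
  calc V.map star * coDiagonal d * Vᵀ * (V.map star * coDiagonal d * Vᵀ) =
      V.map star * (coDiagonal d * (Vᵀ * V.map star) * coDiagonal d) * Vᵀ := by
        simp only [mul_assoc]
    _ = _ := by rw [transpose_mul_map_star_of_unitary hV, mul_one]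

/-- The core is `U⁻¹ ψ`, slice by slice. Its Abc parameters follow from `hΦ`, and their vanishing
blocks give the support condition. -/
theorem AbcPair.Explicit.decomposes [DecidableEq κ] {ψ : Fock (ι ⊕ κ)}
    {A : Matrix (ι ⊕ κ) (ι ⊕ κ) ℂ} {b : ι ⊕ κ → ℂ} {c : ℂ} (hψ : ‖ψ‖ = 1) (h : IsKetAbc ψ A b c)
    {d : AbcPair ι κ} {Γ : Matrix ι ι ℂ} (hd : d.Explicit A b c Γ) : d.Decomposes ψ := by
  obtain ⟨hΓ, hAU, hbU, hcU, hAC, hbC, hcc⟩ := hd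
  obtain ⟨V, δ, hV, hδ, hx⟩ := exists_takagi_of_isKetAbc hψ h
  have hc := h.c_ne_zero hψ
  have hcU0 : d.cU ≠ 0 := left_ne_zero_of_mul (hcc.trans_ne hc)
  have hgram : gram A = conjGram A.toBlocks₁₁ := rfl
  obtain ⟨U, hU⟩ := exists_unitary_isUnitaryAbc hV hδ hx hΓ (b ∘ Sum.inl) (c := d.cU) hcU
  have hpos := posDef_gram hψ h
  have hΓu : IsUnit Γ.det := by
    have := (Matrix.isUnit_iff_isUnit_det _).1 hpos.isUnit
    rw [← hΓ, Matrix.det_mul] at this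
    exact isUnit_of_mul_isUnit_right this
  have hΓHu : IsUnit (Γᴴ).det := by
    rw [Matrix.det_conjTranspose]
    exact hΓu.star
  have hΓTu : IsUnit (Γᵀ).det := by rwa [Matrix.det_transpose]
  set x := A.toBlocks₁₁
  set R := A.toBlocks₂₁
  set u := b ∘ Sum.inl
  set t := x.map star *ᵥ u + star u with ht
  set s := -(Γᴴ⁻¹ * x.map star * Γᵀ) with hs
  obtain ⟨M, hM⟩ : ∃ M, M = R * Γ⁻¹ := ⟨_, rfl⟩
  rw [← hM] at hAC
  have hUG : IsGaussianUnitary U := by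
    refine isGaussianUnitary_of_isUnitaryAbc hU hΓ hΓu ?_ ?_
    · rw [hs, mul_neg, mul_assoc, ← mul_assoc, Matrix.mul_nonsing_inv _ hΓHu, one_mul]
    · rw [Matrix.mulVec_neg, Matrix.mulVec_mulVec, Matrix.mul_nonsing_inv _ hΓHu, Matrix.one_mulVec]
  have hsS : s.IsSymm := (Matrix.isSymm_fromBlocks_iff.1 hU.1).2.2.2
  have hHinv : (gram A)⁻¹ = Γ⁻¹ * Γᴴ⁻¹ := by rw [← hΓ, Matrix.mul_inv_rev]
  -- The correction to `y` in the core cancels the quadratic term that the input block `s` of `U`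
  -- contributes at the coherent vector `Mᵀ y`.
  have hMs : R * (gram A)⁻¹ * x.map star * Rᵀ = -(M * s * Mᵀ) := by
    have e : Mᵀ = (Γᵀ)⁻¹ * Rᵀ := by rw [hM, Matrix.transpose_mul, Matrix.transpose_nonsing_inv]
    rw [hHinv, hs, e, Matrix.mul_neg, Matrix.neg_mul, neg_neg]
    calc R * (Γ⁻¹ * Γᴴ⁻¹) * x.map star * Rᵀ
        = R * Γ⁻¹ * Γᴴ⁻¹ * x.map star * (Γᵀ * (Γᵀ)⁻¹) * Rᵀ := by
          rw [Matrix.mul_nonsing_inv _ hΓTu, Matrix.mul_one]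
          simp only [Matrix.mul_assoc]
      _ = _ := by simp only [Matrix.mul_assoc, hM]
  have hACs : d.AC.IsSymm := by
    rw [hAC, hMs]
    refine Matrix.IsSymm.fromBlocks Matrix.isSymm_zero (Matrix.transpose_transpose _) ?_
    refine Matrix.IsSymm.add ?_ (Matrix.IsSymm.neg ?_)
    · ext i j
      exact h.1.apply _ _
    · rw [Matrix.IsSymm, Matrix.transpose_mul, Matrix.transpose_mul, Matrix.transpose_transpose,
        hsS.eq, Matrix.mul_assoc]
  set core := applyFirst U.symm ψ with hcore
  have hcore1 : ‖core‖ = 1 := by rw [hcore, norm_applyFirst, hψ]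
  -- Both sides have Bargmann functions with quadratic part `x` and linear term `u + Rᵀ y`, because
  -- `Γᵀ Mᵀ = Rᵀ`; the scalar collects what depends on `y` alone.
  have hΦ : ∀ y : κ → ℂ, partialBargmann ψ y = (d.cC * Complex.exp
      (1 / 2 * (y ⬝ᵥ (d.AC.toBlocks₂₂ *ᵥ y)) + y ⬝ᵥ (d.bC ∘ Sum.inr))) •
        U (bargmannVector (Mᵀ *ᵥ y)) := by
    intro y
    refine (isBargmannFunction_partialBargmann h.2 y).ext fun z => ?_
    have h1 := (hU.2 (Mᵀ *ᵥ y) z).mul_left (d.cC * Complex.exp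
      (1 / 2 * (y ⬝ᵥ (d.AC.toBlocks₂₂ *ᵥ y)) + y ⬝ᵥ (d.bC ∘ Sum.inr)))
    have hΓM : Γᵀ *ᵥ (Mᵀ *ᵥ y) = Rᵀ *ᵥ y := by
      rw [Matrix.mulVec_mulVec, ← Matrix.transpose_mul, hM, Matrix.mul_assoc,
        Matrix.nonsing_inv_mul _ hΓu, Matrix.mul_one]
    have hq : (Mᵀ *ᵥ y) ⬝ᵥ (s *ᵥ (Mᵀ *ᵥ y)) = y ⬝ᵥ ((M * s * Mᵀ) *ᵥ y) := by
      rw [Matrix.mulVec_transpose, ← Matrix.dotProduct_mulVec, ← Matrix.mulVec_transpose,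
        Matrix.mulVec_mulVec, Matrix.mulVec_mulVec]
    have hl : (Mᵀ *ᵥ y) ⬝ᵥ (Γᴴ⁻¹ *ᵥ t) = y ⬝ᵥ (R *ᵥ ((gram A)⁻¹ *ᵥ t)) := by
      rw [Matrix.mulVec_transpose, ← Matrix.dotProduct_mulVec, hM, hHinv, Matrix.mulVec_mulVec,
        Matrix.mulVec_mulVec, Matrix.mul_assoc]
    convert! h1 using 1
    · funext j
      rw [← mul_assoc]
      rfl
    · beta_reduce
      rw [gaussian_sum A h.1, gaussian_sum _ hU.1, ← hcc, hAC, hbC, hMs]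
      simp only [Matrix.toBlocks_fromBlocks₁₁, Matrix.toBlocks_fromBlocks₂₁,
        Matrix.toBlocks_fromBlocks₂₂, Sum.elim_comp_inl, Sum.elim_comp_inr, hΓM, hq,
        Matrix.add_mulVec, Matrix.neg_mulVec, dotProduct_add, dotProduct_neg, hl]
      rw [mul_comm d.cU, mul_mul_mul_comm, ← Complex.exp_add]
      congr 2
      ring
  have hcoreK : IsKetAbc core d.AC d.bC d.cC := by
    refine ⟨hACs, hasExpansion_of_slices (fun l => (norm_apply_le _ _).trans hcore1.le)
      fun z y => ⟨U.symm (partialBargmann ψ y), fun j => ?_, ?_⟩⟩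
    · have h1 := ((evalCLM j).comp (U.symm.toContinuousLinearEquiv : Fock ι →L[ℂ] Fock ι)).hasSum
        (hasSum_partialBargmann ψ y)
      convert! h1 using 2 with k
      rw [map_smul, smul_eq_mul, mul_comm]
      rfl
    -- After `U⁻¹` a multiple of a coherent vector is left, with Bargmann function `exp(zᵀ Mᵀ y)`:
    -- no quadratic and no constant linear term in `z`.
    · rw [hΦ, map_smul, U.symm_apply_apply, gaussian_sum _ hACs]
      have h1 := (hasSum_bargmannVector (bargmannVector (Mᵀ *ᵥ y)) z).mul_left (d.cC * Complex.exp
        (1 / 2 * (y ⬝ᵥ (d.AC.toBlocks₂₂ *ᵥ y)) + y ⬝ᵥ (d.bC ∘ Sum.inr)))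
      rw [inner_bargmannVector_bargmannVector, star_star] at h1
      convert! h1 using 1
      · funext j
        rw [← mul_assoc]
        rfl
      · have e1 : d.AC.toBlocks₁₁ = 0 := by rw [hAC, Matrix.toBlocks_fromBlocks₁₁]
        have e2 : d.AC.toBlocks₂₁ = M := by rw [hAC, Matrix.toBlocks_fromBlocks₂₁]
        have e3 : d.bC ∘ Sum.inl = 0 := by rw [hbC, Sum.elim_comp_inl]
        rw [e1, e2, e3, Matrix.zero_mulVec, dotProduct_zero, mul_assoc,
          ← Complex.exp_add]
        congr 2
        ring
  refine ⟨U, core, ⟨hUG, ⟨hcore1, _, _, _, hcoreK⟩, (applyFirst_symm U ψ).symm,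
    hasSum_tensor_project core, fun j k => core (Sum.elim j k), fun k => ?_⟩, ?_, hcoreK⟩
  · rw [hAC, hbC] at hcoreK
    exact project_eq_sum_of_isKetAbc hcoreK k
  · rw [hAU, hbU]
    exact hU

theorem exists_explicit [DecidableEq κ] {A : Matrix (ι ⊕ κ) (ι ⊕ κ) ℂ} (b : ι ⊕ κ → ℂ)
    (c : ℂ) {Γ : Matrix ι ι ℂ} (hΓ : Γᴴ * Γ = gram A) (hpos : (gram A).PosDef) :
    ∃ d : AbcPair ι κ, d.Explicit A b c Γ := by
  set N : ℝ := Real.sqrt (Real.sqrt (gram A).det.re) * Real.exp (-(1 / 2) * ((b ∘ Sum.inl) ⬝ᵥ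
    ((gram A)⁻¹ *ᵥ (A.toBlocks₁₁.map star *ᵥ (b ∘ Sum.inl) + star (b ∘ Sum.inl)))).re) with hN
  have hN0 : 0 < N := by
    have := (Complex.pos_iff.1 hpos.det_pos).1
    positivity
  refine ⟨⟨_, _, (N : ℂ), _, _, c / N⟩, hΓ, rfl, rfl, ?_, rfl, rfl, ?_⟩
  · rw [Complex.norm_real, Real.norm_of_nonneg hN0.le]
  · exact mul_div_cancel₀ _ (Complex.ofReal_ne_zero.2 hN0.ne')

theorem exists_isStellarDecomposition [DecidableEq κ] {ψ : Fock (ι ⊕ κ)} (h : IsGaussianState ψ) :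
    ∃ U core, IsStellarDecomposition ψ U core := by
  obtain ⟨hψ, A, b, c, hA⟩ := h
  obtain ⟨Γ, hΓ, hΓΓ⟩ := exists_posDef_sqrt_gram hψ hA
  obtain ⟨d, hd⟩ := exists_explicit b c (Γ := Γ) (by rw [hΓ.isHermitian, hΓΓ]) (posDef_gram hψ hA)
  obtain ⟨U, core, hUc, -⟩ := hd.decomposes hψ hA
  exact ⟨U, core, hUc⟩

end

/-! ## Running programs -/

/-- All registers in the expression are below this number. -/
def IdxExpr.bound : IdxExpr → ℕ
  | lit _ => 0
  | reg r => r + 1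
  | add e f => max e.bound f.bound
  | sub e f => max e.bound f.bound

theorem IdxExpr.eval_congr {σ τ : Store} (e : IdxExpr) (h : ∀ r < e.bound, σ.reg r = τ.reg r) :
    e.eval σ = e.eval τ := by
  induction e with
  | lit q => rfl
  | reg r => exact h r (Nat.lt_succ_self r)
  | add e f he hf | sub e f he hf =>
    rw [IdxExpr.eval, IdxExpr.eval, he fun r hr => h r (lt_max_of_lt_left hr),
      hf fun r hr => h r (lt_max_of_lt_right hr)]

/-- All registers in the expression are below this number. -/
def NumExpr.bound : NumExpr → ℕ
  | lit _ => 0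
  | get _ i j => max i.bound j.bound
  | add e f => max e.bound f.bound
  | sub e f => max e.bound f.bound
  | mul e f => max e.bound f.bound
  | div e f => max e.bound f.bound
  | conj e => e.bound
  | sqrt e => e.bound
  | exp e => e.bound

/-- The arrays that occur in the expression. -/
def NumExpr.reads : NumExpr → List ℕ
  | lit _ => []
  | get a _ _ => [a]
  | add e f => e.reads ++ f.reads
  | sub e f => e.reads ++ f.reads
  | mul e f => e.reads ++ f.reads
  | div e f => e.reads ++ f.reads
  | conj e => e.reads
  | sqrt e => e.reads
  | exp e => e.reads

theorem NumExpr.eval_congr {σ τ : Store} (e : NumExpr) (h : ∀ r < e.bound, σ.reg r = τ.reg r)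
    (hm : ∀ a ∈ e.reads, σ.mem a = τ.mem a) : e.eval σ = e.eval τ := by
  induction e with
  | lit q => rfl
  | get a i j =>
    rw [NumExpr.eval, NumExpr.eval, i.eval_congr fun r hr => h r (lt_max_of_lt_left hr),
      j.eval_congr fun r hr => h r (lt_max_of_lt_right hr), hm a (List.mem_singleton_self a)]
  | add e f he hf | sub e f he hf | mul e f he hf | div e f he hf =>
    rw [NumExpr.eval, NumExpr.eval,
      he (fun r hr => h r (lt_max_of_lt_left hr)) fun a ha => hm a (List.mem_append_left _ ha),
      hf (fun r hr => h r (lt_max_of_lt_right hr)) fun a ha => hm a (List.mem_append_right _ ha)]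
  | conj e he | sqrt e he | exp e he => rw [NumExpr.eval, NumExpr.eval, he h hm]

/-- The invariant rule for loops, with a time bound `B` per iteration. The number of iterations is
fixed by the initial memory, so the body is free to change registers. -/
theorem Program.run_loop_induction {r : ℕ} {e : IdxExpr} {body : Program} {σ : Store}
    (I : ℕ → Store → Prop) (B : ℕ) (h0 : I 0 σ)
    (hs : ∀ i < e.eval σ, ∀ τ, I i τ →
      I (i + 1) (body.run (τ.setReg r i)).1 ∧ (body.run (τ.setReg r i)).2 ≤ B) :
    I (e.eval σ) ((loop r e body).run σ).1 ∧
      ((loop r e body).run σ).2 ≤ e.cost + 1 + e.eval σ * (B + 1) := by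
  rw [Program.run]
  generalize e.eval σ = N at hs
  induction N with
  | zero => exact ⟨h0, by simp⟩
  | succ N ih =>
    obtain ⟨h1, h2⟩ := ih fun i hi => hs i (hi.trans (Nat.lt_succ_self N))
    obtain ⟨h3, h4⟩ := hs N (Nat.lt_succ_self N) _ h1
    refine ⟨h3, ?_⟩
    rw [add_mul, one_mul]
    simp only at h2 ⊢
    omega

/-- The registers `0`, `1`, `2` contain `m`, `n`, `p`. -/
def Store.IsAt (σ : Store) (m n p : ℕ) : Prop :=
  σ.reg 0 = m ∧ σ.reg 1 = n ∧ σ.reg 2 = p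

/-- The first registers in the body of a pass: `i`, `j`, `k` are the loop counters. -/
def context (m n p i j k : ℕ) : ℕ → ℕ
  | 0 => m
  | 1 => n
  | 2 => p
  | 3 => i
  | 4 => j
  | _ => k

/-- A pass fills a block of the array `target`, of size `height × width`, with upper left corner
`(row, col)`: the entry `(i, j)` of the block becomes `init + ∑ k < depth, term`, where the
registers
`3`, `4`, `5` contain `i`, `j`, `k`. -/
structure Pass where
  target : ℕ
  row : IdxExpr
  col : IdxExpr
  height : IdxExpr
  width : IdxExpr
  depth : IdxExpr
  init : NumExpr
  term : NumExpr

namespace Pass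

/-- The program of a pass. -/
def program (P : Pass) : Program :=
  .loop 3 P.height (.loop 4 P.width (.seq
    (.store P.target (.add P.row (.reg 3)) (.add P.col (.reg 4)) P.init)
    (.loop 5 P.depth (.store P.target (.add P.row (.reg 3)) (.add P.col (.reg 4))
      (.add (.get P.target (.add P.row (.reg 3)) (.add P.col (.reg 4))) P.term)))))

/-- The expressions use the loop counters only where these are defined, and the pass does not read
the array that it writes. -/
def WellFormed (P : Pass) : Prop :=
  P.row.bound ≤ 3 ∧ P.col.bound ≤ 3 ∧ P.height.bound ≤ 3 ∧ P.width.bound ≤ 3 ∧ P.depth.bound ≤ 3 ∧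
    P.init.bound ≤ 5 ∧ P.term.bound ≤ 6 ∧ P.target ∉ P.init.reads ∧ P.target ∉ P.term.reads

/-- Well-formedness is syntactic and independent of `m` and `n`, so for the concrete passes it is
settled by evaluation. -/
instance (P : Pass) : Decidable P.WellFormed := by
  unfold WellFormed
  infer_instance

/-- The value of an index expression outside the loops of a pass. -/
def idx (m n p : ℕ) (e : IdxExpr) : ℕ :=
  e.eval ⟨context m n p 0 0 0, fun _ _ _ => 0⟩

theorem eval_eq_idx {σ : Store} {m n p : ℕ} (h : σ.IsAt m n p) {e : IdxExpr} (he : e.bound ≤ 3) :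
    e.eval σ = idx m n p e := by
  refine e.eval_congr fun r hr => ?_
  obtain ⟨h0, h1, h2⟩ := h
  have : r < 3 := hr.trans_le he
  interval_cases r <;> assumption

/-- The entry `(i, j)` of the block that is written. -/
def value (P : Pass) (m n p : ℕ) (μ : ℕ → ℕ → ℕ → ℂ) (i j : ℕ) : ℂ :=
  P.init.eval ⟨context m n p i j 0, μ⟩ +
    ∑ k ∈ Finset.range (idx m n p P.depth), P.term.eval ⟨context m n p i j k, μ⟩

/-- The block that is written. -/
def Covers (P : Pass) (m n p r s : ℕ) : Prop :=
  (idx m n p P.row ≤ r ∧ r < idx m n p P.row + idx m n p P.height) ∧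
    idx m n p P.col ≤ s ∧ s < idx m n p P.col + idx m n p P.width

/-- The effect of a pass on the arrays. -/
def effect (P : Pass) (m n p : ℕ) (μ : ℕ → ℕ → ℕ → ℂ) : ℕ → ℕ → ℕ → ℂ :=
  open Classical in
  fun a r s => if a = P.target ∧ P.Covers m n p r s then
    P.value m n p μ (r - idx m n p P.row) (s - idx m n p P.col) else μ a r s

/-- The target array is partly overwritten already, but `init` and `term` do not read it. Hence they
may be evaluated in the arrays `μ` from before the pass. -/
theorem run_depth {P : Pass} (hP : P.WellFormed) {m n p i j : ℕ} {σ : Store} {μ : ℕ → ℕ → ℕ → ℂ}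
    (hσ : σ.IsAt m n p) (hi : σ.reg 3 = i) (hj : σ.reg 4 = j)
    (hμ : ∀ a ≠ P.target, σ.mem a = μ a) :
    ∃ τ B, Program.run (.seq
      (.store P.target (.add P.row (.reg 3)) (.add P.col (.reg 4)) P.init)
      (.loop 5 P.depth (.store P.target (.add P.row (.reg 3)) (.add P.col (.reg 4))
        (.add (.get P.target (.add P.row (.reg 3)) (.add P.col (.reg 4))) P.term)))) σ = (τ, B) ∧
      τ.IsAt m n p ∧ τ.reg 3 = i ∧ τ.mem = (σ.setMem P.target (idx m n p P.row + i)
        (idx m n p P.col + j) (P.value m n p μ i j)).mem ∧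
      B ≤ (P.row.cost + P.col.cost + P.init.cost + P.depth.cost + 6) + idx m n p P.depth *
        (2 * P.row.cost + 2 * P.col.cost + P.term.cost + 12) := by
  obtain ⟨hr, hc, -, -, hd, hb, hb', ht, ht'⟩ := hP
  set I := idx m n p P.row
  set J := idx m n p P.col
  have key := Program.run_loop_induction (r := 5) (e := P.depth)
    (body := .store P.target (.add P.row (.reg 3)) (.add P.col (.reg 4))
      (.add (.get P.target (.add P.row (.reg 3)) (.add P.col (.reg 4))) P.term))
    (σ := (Program.run (.store P.target (.add P.row (.reg 3)) (.add P.col (.reg 4)) P.init) σ).1)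
    -- Invariant: the entry holds `init` plus the first `k` summands.
    (fun k τ => τ.IsAt m n p ∧ τ.reg 3 = i ∧ τ.reg 4 = j ∧
      τ.mem = (σ.setMem P.target (I + i) (J + j) (P.init.eval ⟨context m n p i j 0, μ⟩ +
        ∑ q ∈ Finset.range k, P.term.eval ⟨context m n p i j q, μ⟩)).mem)
    (2 * P.row.cost + 2 * P.col.cost + P.term.cost + 11) ?_ ?_
  · have he : P.depth.eval (Program.run (.store P.target (.add P.row (.reg 3))
        (.add P.col (.reg 4)) P.init) σ).1 = idx m n p P.depth :=
      eval_eq_idx (σ := σ.setMem _ _ _ _) hσ hd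
    rw [he] at key
    obtain ⟨⟨h1, h2, h3, h4⟩, h5⟩ := key
    refine ⟨_, _, rfl, h1, h2, h4, ?_⟩
    refine (Nat.add_le_add le_rfl h5).trans ?_
    change P.row.cost + 1 + 1 + (P.col.cost + 1 + 1) + P.init.cost + 1 + _ ≤ _
    ring_nf
    omega
  · refine ⟨hσ, hi, hj, ?_⟩
    have e1 : P.init.eval σ = P.init.eval ⟨context m n p i j 0, μ⟩ := by
      refine P.init.eval_congr (fun r hr => ?_) fun a ha => hμ a (ne_of_mem_of_not_mem ha ht)
      have : r < 5 := hr.trans_le hb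
      obtain ⟨h0, h1, h2⟩ := hσ
      interval_cases r <;> assumption
    simp only [Program.run, IdxExpr.eval, eval_eq_idx hσ hr, eval_eq_idx hσ hc, hi, hj, e1,
      Finset.range_zero, Finset.sum_empty, add_zero]
    rfl
  · rintro k - τ ⟨hτ, hi', hj', hm⟩
    have hτ' : (τ.setReg 5 k).IsAt m n p := hτ
    have hi'' : (τ.setReg 5 k).reg 3 = i := hi'
    have hj'' : (τ.setReg 5 k).reg 4 = j := hj'
    have e1 : P.term.eval (τ.setReg 5 k) = P.term.eval ⟨context m n p i j k, μ⟩ := by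
      refine P.term.eval_congr (fun r hr => ?_) fun a ha => ?_
      · have : r < 6 := hr.trans_le hb'
        obtain ⟨h0, h1, h2⟩ := hτ
        interval_cases r <;> first | assumption | rfl
      · have ha' := ne_of_mem_of_not_mem ha ht'
        have : (τ.setReg 5 k).mem a = τ.mem a := rfl
        rw [this, hm]
        refine Eq.trans ?_ (hμ a ha')
        simp [Store.setMem, ha']
    refine ⟨⟨hτ, hi', hj', ?_⟩, ?_⟩
    · simp only [Program.run, IdxExpr.eval, NumExpr.eval, eval_eq_idx hτ' hr, eval_eq_idx hτ' hc,
        hi'', hj'', e1, Finset.sum_range_succ, ← add_assoc]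
      have hm' : (τ.setReg 5 k).mem = τ.mem := rfl
      funext a r s
      simp only [Store.setMem, hm', hm]
      split_ifs <;> simp_all [I, J]
    · simp only [Program.run, IdxExpr.cost, NumExpr.cost]
      omega

/-- A bound for the time of a pass per entry of its loops. -/
def rate (P : Pass) : ℕ :=
  3 * P.row.cost + 3 * P.col.cost + P.init.cost + P.depth.cost + P.term.cost + P.width.cost +
    P.height.cost + 22

theorem run_program {P : Pass} (hP : P.WellFormed) {m n p : ℕ} {σ : Store} (hσ : σ.IsAt m n p) :
    (P.program.run σ).1.IsAt m n p ∧ (P.program.run σ).1.mem = P.effect m n p σ.mem ∧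
      (P.program.run σ).2 ≤ P.rate * (1 + idx m n p P.height) * (1 + idx m n p P.width) *
        (1 + idx m n p P.depth) := by
  classical
  have hP' := hP
  obtain ⟨hr, hc, hh, hw, hd, -⟩ := hP'
  set I := idx m n p P.row with hI
  set J := idx m n p P.col with hJ
  set W := idx m n p P.width with hW
  set D := idx m n p P.depth with hD
  set B₀ := (P.row.cost + P.col.cost + P.init.cost + P.depth.cost + 6) + D *
        (2 * P.row.cost + 2 * P.col.cost + P.term.cost + 12) with hB₀
  have key := Program.run_loop_induction (r := 3) (e := P.height) (σ := σ)
    (body := .loop 4 P.width (.seq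
    (.store P.target (.add P.row (.reg 3)) (.add P.col (.reg 4)) P.init)
    (.loop 5 P.depth (.store P.target (.add P.row (.reg 3)) (.add P.col (.reg 4))
      (.add (.get P.target (.add P.row (.reg 3)) (.add P.col (.reg 4))) P.term)))))
    (fun i τ => τ.IsAt m n p ∧ τ.mem = fun a r s =>
      if a = P.target ∧ (I ≤ r ∧ r < I + i) ∧ J ≤ s ∧ s < J + W then
        P.value m n p σ.mem (r - I) (s - J) else σ.mem a r s)
    (P.width.cost + 1 + W * (B₀ + 1)) ⟨hσ, ?_⟩ ?_
  · rw [eval_eq_idx hσ hh] at key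
    obtain ⟨⟨h1, h2⟩, h3⟩ := key
    refine ⟨h1, ?_, h3.trans ?_⟩
    · rw [program, h2]
      funext a r s
      exact if_congr Iff.rfl rfl rfl
    · generalize idx m n p P.height = H
      set κ := 3 * P.row.cost + 3 * P.col.cost + P.init.cost + P.depth.cost + P.term.cost +
        P.width.cost + P.height.cost + 22 with hκ
      have hmul : ∀ {a b N q : ℕ}, a ≤ q → b ≤ q → a + N * b ≤ q * (1 + N) := fun h1 h2 => by
        rw [mul_add, mul_one, mul_comm]
        exact add_le_add h1 (Nat.mul_le_mul_right _ h2)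
      -- The constant `κ` is spent level by level: each enclosing loop keeps back what it needs for
      -- evaluating its own bound and counting its iterations.
      have e1 : B₀ + 1 ≤ (κ - P.width.cost - P.height.cost - 3) * (1 + D) := by
        rw [hB₀, add_right_comm]
        exact hmul (by omega) (by omega)
      have e2 : P.width.cost + 1 + W * (B₀ + 1) + 1 ≤
          (κ - P.height.cost - 1) * (1 + D) * (1 + W) := by
        rw [add_right_comm]
        refine hmul ?_ (e1.trans (Nat.mul_le_mul_right _ (by omega)))
        exact le_trans (by omega) (Nat.le_mul_of_pos_right _ (by omega))
      calc _ ≤ κ * (1 + D) * (1 + W) * (1 + H) := by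
            refine hmul ?_ (e2.trans ?_)
            · refine le_trans ?_ (Nat.le_mul_of_pos_right _ (by omega))
              exact le_trans (by omega) (Nat.le_mul_of_pos_right _ (by omega))
            · exact Nat.mul_le_mul_right _ (Nat.mul_le_mul_right _ (by omega))
        _ = _ := by
          rw [rate, ← hκ]
          ring
  · funext a r s
    rw [if_neg]
    omega
  · rintro i hi τ ⟨hτ, hm⟩
    have key2 := Program.run_loop_induction (r := 4) (e := P.width) (σ := τ.setReg 3 i)
      (body := .seq
      (.store P.target (.add P.row (.reg 3)) (.add P.col (.reg 4)) P.init)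
      (.loop 5 P.depth (.store P.target (.add P.row (.reg 3)) (.add P.col (.reg 4))
        (.add (.get P.target (.add P.row (.reg 3)) (.add P.col (.reg 4))) P.term))))
      (fun j υ => υ.IsAt m n p ∧ υ.reg 3 = i ∧ υ.mem = fun a r s =>
        if a = P.target ∧ r = I + i ∧ J ≤ s ∧ s < J + j then
          P.value m n p σ.mem i (s - J) else τ.mem a r s)
      B₀ ⟨hτ, rfl, ?_⟩ ?_
    · rw [eval_eq_idx (σ := τ.setReg 3 i) hτ hw] at key2
      obtain ⟨⟨h1, h2, h3⟩, h4⟩ := key2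
      refine ⟨⟨h1, ?_⟩, h4⟩
      rw [h3, hm]
      funext a r s
      by_cases ha : a = P.target
      · subst ha
        by_cases h5 : r = I + i
        · subst h5
          simp only [true_and, Nat.add_sub_cancel_left]
          split_ifs <;> first | rfl | omega
        · simp only [true_and, h5, false_and, if_false]
          congr 1
          simp only [eq_iff_iff]
          omega
      · simp [ha]
    · funext a r s
      rw [if_neg]
      · rfl
      · omega
    · rintro j - υ ⟨hυ, hi', hm'⟩
      obtain ⟨ω, B, hrun, h1, h2, h3, h4⟩ := run_depth hP (m := m) (n := n) (p := p) (i := i)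
        (j := j) (σ := υ.setReg 4 j) (μ := σ.mem) hυ hi' rfl (fun a ha => by
          have e : (υ.setReg 4 j).mem = υ.mem := rfl
          rw [e, hm', hm]
          simp [ha])
      rw [hrun]
      refine ⟨⟨h1, h2, ?_⟩, h4⟩
      have e : (υ.setReg 4 j).mem = υ.mem := rfl
      rw [h3]
      funext a r s
      simp only [Store.setMem, e, hm']
      by_cases ha : a = P.target
      · subst ha
        by_cases h5 : r = I + i
        · subst h5
          simp only [true_and]
          by_cases h6 : s = J + j
          · subst h6
            rw [if_pos ⟨hI ▸ rfl, hJ ▸ rfl⟩, if_pos (by omega), Nat.add_sub_cancel_left]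
          · rw [if_neg fun h => h6 h.2]
            congr 1
            simp only [eq_iff_iff]
            omega
        · simp [h5, hI.symm]
      · simp [ha]

end Pass

/-! ### Sequences of passes -/

namespace Pass

/-- The program that executes the passes one after the other. -/
def programs (l : List Pass) : Program :=
  l.foldr (fun P Q => .seq P.program Q) (.assign 5 (.lit 0))

/-- The effect of the passes on the arrays. -/
def effects (m n p : ℕ) (l : List Pass) (μ : ℕ → ℕ → ℕ → ℂ) : ℕ → ℕ → ℕ → ℂ :=
  l.foldl (fun μ P => P.effect m n p μ) μ

theorem run_programs {l : List Pass} (hl : ∀ P ∈ l, P.WellFormed) {m n p C : ℕ}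
    (hC : ∀ P ∈ l, (1 + idx m n p P.height) * (1 + idx m n p P.width) *
      (1 + idx m n p P.depth) ≤ C) {σ : Store} (hσ : σ.IsAt m n p) :
    ((programs l).run σ).1.IsAt m n p ∧
      ((programs l).run σ).1.mem = effects m n p l σ.mem ∧
      ((programs l).run σ).2 ≤ (l.map rate).sum * C + 2 := by
  induction l generalizing σ with
  | nil => exact ⟨hσ, rfl, le_add_left le_rfl⟩
  | cons P l ih =>
    obtain ⟨h1, h2, h3⟩ := run_program (hl P List.mem_cons_self) hσ
    obtain ⟨h4, h5, h6⟩ := ih (fun Q hQ => hl Q (List.mem_cons_of_mem _ hQ))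
      (fun Q hQ => hC Q (List.mem_cons_of_mem _ hQ)) h1
    rw [h2] at h5
    refine ⟨h4, h5, (Nat.add_le_add h3 h6).trans ?_⟩
    rw [List.map_cons, List.sum_cons, add_mul, mul_assoc, mul_assoc, add_assoc, ← mul_assoc (1 + _)]
    gcongr
    exact hC P List.mem_cons_self

theorem effect_of_ne (P : Pass) (m n p : ℕ) (μ : ℕ → ℕ → ℕ → ℂ) {a : ℕ} (h : a ≠ P.target) :
    P.effect m n p μ a = μ a := by
  funext r s
  exact if_neg fun h1 => h h1.1

theorem effects_of_forall_ne {m n p : ℕ} {l : List Pass} {a : ℕ} (h : ∀ P ∈ l, a ≠ P.target)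
    (μ : ℕ → ℕ → ℕ → ℂ) : effects m n p l μ a = μ a := by
  induction l generalizing μ with
  | nil => rfl
  | cons P l ih =>
    exact (ih (fun Q hQ => h Q (List.mem_cons_of_mem _ hQ)) _).trans
      (effect_of_ne P m n p μ (h P List.mem_cons_self))

theorem effects_of_forall_not_covers {m n p : ℕ} {l : List Pass} {a r s : ℕ}
    (h : ∀ P ∈ l, P.target = a → ¬ P.Covers m n p r s) (μ : ℕ → ℕ → ℕ → ℂ) :
    effects m n p l μ a r s = μ a r s := by
  induction l generalizing μ with
  | nil => rfl
  | cons P l ih =>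
    exact (ih (fun Q hQ => h Q (List.mem_cons_of_mem _ hQ)) _).trans
      (if_neg fun h1 => h P List.mem_cons_self h1.1.symm h1.2)

/-- The arrays `μ` are what the pass would write. -/
def Holds (P : Pass) (m n p : ℕ) (μ : ℕ → ℕ → ℕ → ℂ) : Prop :=
  ∀ i < idx m n p P.height, ∀ j < idx m n p P.width,
    μ P.target (idx m n p P.row + i) (idx m n p P.col + j) = P.value m n p μ i j

theorem value_congr {P : Pass} {m n p : ℕ} {μ ν : ℕ → ℕ → ℕ → ℂ}
    (h : ∀ a ∈ P.init.reads ++ P.term.reads, μ a = ν a) (i j : ℕ) :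
    P.value m n p μ i j = P.value m n p ν i j :=
  congrArg₂ (· + ·) (P.init.eval_congr (fun _ _ => rfl) fun a ha => h a (List.mem_append_left _ ha))
    (Finset.sum_congr rfl fun _ _ =>
      P.term.eval_congr (fun _ _ => rfl) fun a ha => h a (List.mem_append_right _ ha))

theorem effect_apply (P : Pass) {m n p i j : ℕ} (hi : i < idx m n p P.height)
    (hj : j < idx m n p P.width) (μ : ℕ → ℕ → ℕ → ℂ) :
    P.effect m n p μ P.target (idx m n p P.row + i) (idx m n p P.col + j) =
      P.value m n p μ i j := by
  refine (if_pos ⟨rfl, ⟨Nat.le_add_right _ _, Nat.add_lt_add_left hi _⟩, Nat.le_add_right _ _,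
    Nat.add_lt_add_left hj _⟩).trans ?_
  rw [Nat.add_sub_cancel_left, Nat.add_sub_cancel_left]

/-- A syntactic sufficient criterion for `r + h ≤ q`. -/
def endsBefore : IdxExpr → IdxExpr → IdxExpr → Bool
  | .lit 0, .lit a, .lit b => a ≤ b
  | .lit 0, .reg a, .reg b => a = b
  | _, _, _ => false

theorem le_of_endsBefore {r h q : IdxExpr} (e : endsBefore r h q) (m n p : ℕ) :
    idx m n p r + idx m n p h ≤ idx m n p q := by
  unfold endsBefore at e
  split at e <;> simp_all [idx, IdxExpr.eval]

/-- The pass `Q`, executed later, destroys neither the result of `P` nor what `P` has read. -/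
def Precedes (P Q : Pass) : Prop :=
  Q.target ∉ P.init.reads ++ P.term.reads ∧ (Q.target = P.target →
    endsBefore P.row P.height Q.row ∨ endsBefore P.col P.width Q.col)

instance : DecidableRel Precedes := fun P Q => by
  unfold Precedes
  infer_instance

theorem Precedes.not_covers {P Q : Pass} (h : P.Precedes Q) (hQ : Q.target = P.target)
    {m n p r s : ℕ} (hP : P.Covers m n p r s) : ¬ Q.Covers m n p r s := by
  rintro ⟨⟨h1, -⟩, h2, -⟩
  obtain ⟨⟨-, h3⟩, -, h4⟩ := hP
  rcases h.2 hQ with h5 | h5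
  · exact (h3.trans_le (le_of_endsBefore h5 m n p)).not_ge h1
  · exact (h4.trans_le (le_of_endsBefore h5 m n p)).not_ge h2

/-- No later pass touches the block written by `P` or an array read by `P`, so the defining equation
of `P` is still true at the end. The final memory thus satisfies all equations at once, and no
intermediate memory has to be described. -/
theorem holds_effects {m n p : ℕ} {l : List Pass} (hl : ∀ P ∈ l, P.WellFormed)
    (h : l.Pairwise Precedes)
    (μ : ℕ → ℕ → ℕ → ℂ) : ∀ P ∈ l, P.Holds m n p (effects m n p l μ) := by
  induction l generalizing μ with
  | nil => simp
  | cons P l ih =>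
    obtain ⟨h1, h2⟩ := List.pairwise_cons.1 h
    intro R hR
    rcases List.mem_cons.1 hR with rfl | hR
    · intro i hi j hj
      have hc : R.Covers m n p (idx m n p R.row + i) (idx m n p R.col + j) :=
        ⟨⟨Nat.le_add_right _ _, Nat.add_lt_add_left hi _⟩, Nat.le_add_right _ _,
          Nat.add_lt_add_left hj _⟩
      obtain ⟨-, -, -, -, -, -, -, ht, ht'⟩ := hl R List.mem_cons_self
      refine (effects_of_forall_not_covers (fun Q hQ e => (h1 Q hQ).not_covers e hc) _).trans ?_
      refine (R.effect_apply hi hj μ).trans ?_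
      refine value_congr (fun a ha => ?_) i j
      refine ((effects_of_forall_ne (l := l) (fun Q hQ e => (h1 Q hQ).1 (e ▸ ha)) _).trans
        (effect_of_ne R m n p μ fun e => ?_)).symm
      rcases List.mem_append.1 (e ▸ ha) with ha | ha
      · exact ht ha
      · exact ht' ha
    · exact ih (fun Q hQ => hl Q (List.mem_cons_of_mem _ hQ)) h2 _ R hR

end Pass

/-! ## The Cholesky factorization, row by row -/

/-- The row `q` of the Schur complement of `M` with respect to the first `q` rows of `G`. -/
def schurRow (M G : ℕ → ℕ → ℂ) (q j : ℕ) : ℂ :=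
  M q j + ∑ r ∈ Finset.range q, (0 - star (G r q) * G r j)

/-- The first `p` rows of `G`, with `w` columns, are those of the Cholesky factor of `M`. -/
def IsCholesky (M G : ℕ → ℕ → ℂ) (p w : ℕ) : Prop :=
  ∀ q < p, ∀ j < w,
    G q j = schurRow M G q j / ((Real.sqrt (schurRow M G q q).re : ℝ) : ℂ)

theorem schurRow_congr {M G G' : ℕ → ℕ → ℂ} {q j : ℕ} (hq : ∀ r < q, G r q = G' r q)
    (hj : ∀ r < q, G r j = G' r j) : schurRow M G q j = schurRow M G' q j := by
  rw [schurRow, schurRow]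
  congr 1
  refine Finset.sum_congr rfl fun r hr => ?_
  rw [hq r (Finset.mem_range.1 hr), hj r (Finset.mem_range.1 hr)]

/-! ### Correctness of the Cholesky recursion -/

section

variable {M G : ℕ → ℕ → ℂ} {m w : ℕ}

theorem IsCholesky.mul_self (h : IsCholesky M G m w) (hmw : m ≤ w) {q : ℕ} (hq : q < m)
    (hpos : 0 < schurRow M G q q) :
    star (G q q) = G q q ∧ G q q ≠ 0 ∧ ∀ j < w, G q q * G q j = schurRow M G q j := by
  obtain ⟨h1, h2⟩ := Complex.pos_iff.1 hpos
  have e : schurRow M G q q = ((schurRow M G q q).re : ℂ) := Complex.ext rfl h2.symm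
  have h3 : ((Real.sqrt (schurRow M G q q).re : ℝ) : ℂ) ≠ 0 :=
    Complex.ofReal_ne_zero.2 (Real.sqrt_pos.2 h1).ne'
  have h4 : ((Real.sqrt (schurRow M G q q).re : ℝ) : ℂ) *
      ((Real.sqrt (schurRow M G q q).re : ℝ) : ℂ)
      = schurRow M G q q := by
    rw [← Complex.ofReal_mul, Real.mul_self_sqrt h1.le, ← e]
  have h5 : G q q = ((Real.sqrt (schurRow M G q q).re : ℝ) : ℂ) := by
    rw [h q hq q (hq.trans_le hmw), div_eq_iff h3, h4]
  refine ⟨?_, h5 ▸ h3, fun j hj => ?_⟩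
  · rw [h5]
    exact Complex.conj_ofReal _
  · rw [h5, h q hq j hj, mul_div_cancel₀ _ h3]

theorem IsCholesky.row_eq (h : IsCholesky M G m w) (hmw : m ≤ w) {q : ℕ} (hq : q < m)
    (hpos : 0 < schurRow M G q q) {j : ℕ} (hj : j < w) :
    M q j = ∑ r ∈ Finset.range (q + 1), star (G r q) * G r j := by
  obtain ⟨h1, -, h2⟩ := h.mul_self hmw hq hpos
  rw [Finset.sum_range_succ, h1, h2 j hj, schurRow]
  simp

/-- Strong induction on the row. Once the earlier rows are triangular with nonzero diagonal, they
reproduce the first `q` rows of `M`, and by Hermitian symmetry the first `q` columns. So the next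
row vanishes left of the diagonal, and positive definiteness of the leading block forces the next
pivot to be positive. -/
theorem IsCholesky.pos_and_eq_zero (h : IsCholesky M G m w) (hmw : m ≤ w)
    (hM : (Matrix.of fun i j : Fin m => M i j).PosDef) (q : ℕ) (hq : q < m) :
    0 < schurRow M G q q ∧ ∀ j < q, G q j = 0 := by
  have hherm : ∀ i < m, ∀ j < m, star (M j i) = M i j := fun i hi j hj =>
    hM.isHermitian.apply ⟨i, hi⟩ ⟨j, hj⟩
  induction q using Nat.strong_induction_on with
  | _ q ih =>
  have hrow : ∀ i < q, ∀ j < w, M i j = ∑ r ∈ Finset.range q, star (G r i) * G r j := by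
    intro i hi j hj
    rw [h.row_eq hmw (hi.trans hq) (ih i hi (hi.trans hq)).1 hj]
    refine Finset.sum_subset (Finset.range_subset_range.2 hi) fun r hr hri => ?_
    rw [Finset.mem_range] at hr hri
    rw [(ih r hr (hr.trans hq)).2 i (by omega), star_zero, zero_mul]
  have hcol : ∀ i < m, ∀ j < q, M i j = ∑ r ∈ Finset.range q, star (G r i) * G r j := by
    intro i hi j hj
    rw [← hherm i hi j (hj.trans hq), hrow j hj i (hi.trans_le hmw), star_sum]
    refine Finset.sum_congr rfl fun r _ => ?_
    rw [star_mul', star_star, mul_comm]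
  have hdiag : M q q = ∑ r ∈ Finset.range q, star (G r q) * G r q + schurRow M G q q := by
    simp [schurRow]
  refine ⟨?_, fun j hj => ?_⟩
  -- The first `q` rows of `L` are those of `G` and the last is a unit vector. Then the leading
  -- block of `M` is `Lᴴ D L` with `D = diag(1, …, 1, pivot)`, and congruence by the invertible `L`
  -- preserves positivity.
  · let L : Matrix (Fin (q + 1)) (Fin (q + 1)) ℂ :=
      Fin.snoc (α := fun _ => Fin (q + 1) → ℂ) (fun r j => G r j) (Pi.single (Fin.last q) 1)
    let D : Fin (q + 1) → ℂ := Fin.snoc (α := fun _ => ℂ) (fun _ => 1) (schurRow M G q q)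
    have hL1 : ∀ (r : Fin q) (j : Fin (q + 1)), L r.castSucc j = G r j := fun r j => by
      simp [L]
    have hL2 : L (Fin.last q) = Pi.single (Fin.last q) 1 := by simp [L]
    have hLt : L.BlockTriangular id := by
      intro r j hjr
      induction r using Fin.lastCases with
      | last => rw [hL2, Pi.single_eq_of_ne (show j ≠ Fin.last q from hjr.ne)]
      | cast r => rw [hL1, (ih r r.2 (r.2.trans hq)).2 j hjr]
    have hLu : IsUnit L := by
      rw [Matrix.isUnit_iff_isUnit_det, Matrix.det_of_isUpperTriangular hLt, isUnit_iff_ne_zero,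
        Finset.prod_ne_zero_iff]
      intro r _
      induction r using Fin.lastCases with
      | last => simp [hL2]
      | cast r =>
        rw [hL1]
        exact (h.mul_self hmw (r.2.trans hq) (ih r r.2 (r.2.trans hq)).1).2.1
    have hLD : Lᴴ * Matrix.diagonal D * L = (Matrix.of fun i j : Fin m => M i j).submatrix
        (Fin.castLE hq) (Fin.castLE hq) := by
      ext i j
      rw [Matrix.mul_apply, Fin.sum_univ_castSucc]
      simp only [Matrix.mul_diagonal, Matrix.conjTranspose_apply, hL1, hL2, D, Fin.snoc_castSucc,
        Fin.snoc_last, mul_one, Matrix.submatrix_apply, Matrix.of_apply, Fin.val_castLE]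
      rw [Fin.sum_univ_eq_sum_range fun r => star (G r i) * G r j]
      induction i using Fin.lastCases with
      | last =>
        induction j using Fin.lastCases with
        | last => simp [hdiag]
        | cast j => simp [hcol q hq j j.2, Fin.castSucc_ne_last]
      | cast i =>
        simp [hrow i i.2 j (j.2.trans_le (hq.trans_le hmw)), Fin.castSucc_ne_last]
    have hpd := hM.submatrix (Fin.castLE_injective (Nat.succ_le_of_lt hq))
    rw [← hLD, ← Matrix.star_eq_conjTranspose, Matrix.IsUnit.posDef_star_left_conjugate_iff hLu,
      Matrix.posDef_diagonal_iff] at hpd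
    simpa [D] using hpd (Fin.last q)
  · rw [h q hq j (hj.trans (hq.trans_le hmw)), schurRow, hcol q hq j hj]
    simp

/-- The column `j` may lie beyond the square part. For `M = [H, 1]` the extra columns of `G`
therefore form a right inverse of `Γᴴ`. -/
theorem IsCholesky.row_eq_sum (h : IsCholesky M G m w) (hmw : m ≤ w)
    (hM : (Matrix.of fun i j : Fin m => M i j).PosDef) (i : Fin m) {j : ℕ} (hj : j < w) :
    M i j = ∑ r : Fin m, star (G r i) * G r j := by
  rw [h.row_eq hmw i.2 (h.pos_and_eq_zero hmw hM i i.2).1 hj,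
    Fin.sum_univ_eq_sum_range fun r => star (G r i) * G r j]
  refine Finset.sum_subset (Finset.range_subset_range.2 i.2) fun r hr hri => ?_
  rw [Finset.mem_range] at hr hri
  rw [(h.pos_and_eq_zero hmw hM r hr).2 i (by omega), star_zero, zero_mul]

theorem IsCholesky.conjTranspose_mul_self (h : IsCholesky M G m w) (hmw : m ≤ w)
    (hM : (Matrix.of fun i j : Fin m => M i j).PosDef) :
    (Matrix.of fun i j : Fin m => G i j)ᴴ * (Matrix.of fun i j : Fin m => G i j) =
      Matrix.of fun i j : Fin m => M i j := by
  ext i j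
  rw [Matrix.mul_apply]
  exact (h.row_eq_sum hmw hM i (j.2.trans_le hmw)).symm

theorem IsCholesky.det_eq (h : IsCholesky M G m w) (hmw : m ≤ w)
    (hM : (Matrix.of fun i j : Fin m => M i j).PosDef) :
    (Matrix.of fun i j : Fin m => M i j).det = ∏ q ∈ Finset.range m, schurRow M G q q := by
  have ht : (Matrix.of fun i j : Fin m => G i j).BlockTriangular id := fun i j hji =>
    (h.pos_and_eq_zero hmw hM i i.2).2 j hji
  rw [← h.conjTranspose_mul_self hmw hM, Matrix.det_mul, Matrix.det_conjTranspose,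
    Matrix.det_of_isUpperTriangular ht, star_prod, ← Finset.prod_mul_distrib,
    ← Fin.prod_univ_eq_prod_range fun q => schurRow M G q q]
  refine Finset.prod_congr rfl fun q _ => ?_
  obtain ⟨h1, -, h2⟩ := h.mul_self hmw q.2 (h.pos_and_eq_zero hmw hM q q.2).1
  rw [Matrix.of_apply, h1, h2 q (q.2.trans_le hmw)]

end

/-! ## The program -/

namespace Pass

/-- The Kronecker delta of the registers `3` and `4`, as an entry of the array `9`. -/
def delta : NumExpr :=
  .get 9 (.add (.sub (.reg 3) (.reg 4)) (.sub (.reg 4) (.reg 3))) (.lit 0)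

/-- Preparation: the array `9` becomes the first column of the unit matrix, `10` the matrix
`[H, 1]`, and `11` the number `1`. -/
def setup : List Pass :=
  [⟨9, .lit 0, .lit 0, .lit 1, .lit 1, .lit 0, .lit 1, .lit 0⟩,
    ⟨9, .lit 1, .lit 0, .reg 0, .lit 1, .lit 0, .lit 0, .lit 0⟩,
    ⟨10, .lit 0, .lit 0, .reg 0, .reg 0, .reg 0, delta,
      .sub (.lit 0) (.mul (.conj (.get 0 (.reg 3) (.reg 5))) (.get 0 (.reg 5) (.reg 4)))⟩,
    ⟨10, .lit 0, .reg 0, .reg 0, .reg 0, .lit 0, delta, .lit 0⟩,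
    ⟨11, .lit 0, .lit 0, .lit 1, .lit 1, .lit 0, .lit 1, .lit 0⟩]

/-- The row `p` of the Cholesky factor `[Γ, (Γᴴ)⁻¹]` in the array `12`, where the register `2`
contains `p`. The array `11` contains the product of the pivots. -/
def choleskyRow : List Pass :=
  [⟨13, .lit 0, .lit 0, .lit 1, .add (.reg 0) (.reg 0), .reg 2, .get 10 (.reg 2) (.reg 4),
      .sub (.lit 0) (.mul (.conj (.get 12 (.reg 5) (.reg 2))) (.get 12 (.reg 5) (.reg 4)))⟩,
    ⟨12, .reg 2, .lit 0, .lit 1, .add (.reg 0) (.reg 0), .lit 0,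
      .div (.get 13 (.lit 0) (.reg 4)) (.sqrt (.get 13 (.lit 0) (.reg 2))), .lit 0⟩,
    -- A pass may not read its own target, so the product of pivots is updated by way of the array
    -- `14`.
    ⟨14, .lit 0, .lit 0, .lit 1, .lit 1, .lit 0,
      .mul (.get 11 (.lit 0) (.lit 0)) (.get 13 (.lit 0) (.reg 2)), .lit 0⟩,
    ⟨11, .lit 0, .lit 0, .lit 1, .lit 1, .lit 0, .get 14 (.lit 0) (.lit 0), .lit 0⟩]

/-- The output `A_U`, `b_U`, `c_U`. -/
def unitaryPart : List Pass :=
  [⟨15, .lit 0, .lit 0, .reg 0, .reg 0, .reg 0, .lit 0,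
      .mul (.get 12 (.reg 3) (.add (.reg 0) (.reg 5))) (.conj (.get 0 (.reg 5) (.reg 4)))⟩,
    ⟨3, .lit 0, .lit 0, .reg 0, .reg 0, .lit 0, .get 0 (.reg 3) (.reg 4), .lit 0⟩,
    ⟨3, .lit 0, .reg 0, .reg 0, .reg 0, .lit 0, .get 12 (.reg 4) (.reg 3), .lit 0⟩,
    ⟨3, .reg 0, .lit 0, .reg 0, .reg 0, .lit 0, .get 12 (.reg 3) (.reg 4), .lit 0⟩,
    ⟨3, .reg 0, .reg 0, .reg 0, .reg 0, .reg 0, .lit 0,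
      .sub (.lit 0) (.mul (.get 15 (.reg 3) (.reg 5)) (.get 12 (.reg 4) (.reg 5)))⟩,
    ⟨16, .lit 0, .lit 0, .reg 0, .lit 1, .reg 0, .conj (.get 1 (.reg 3) (.lit 0)),
      .mul (.conj (.get 0 (.reg 3) (.reg 5))) (.get 1 (.reg 5) (.lit 0))⟩,
    ⟨17, .lit 0, .lit 0, .reg 0, .lit 1, .reg 0, .lit 0,
      .mul (.get 12 (.reg 3) (.add (.reg 0) (.reg 5))) (.get 16 (.reg 5) (.lit 0))⟩,
    ⟨4, .lit 0, .lit 0, .reg 0, .lit 1, .lit 0, .get 1 (.reg 3) (.lit 0), .lit 0⟩,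
    ⟨4, .reg 0, .lit 0, .reg 0, .lit 1, .lit 0, .sub (.lit 0) (.get 17 (.reg 3) (.lit 0)), .lit 0⟩,
    ⟨18, .lit 0, .lit 0, .reg 0, .lit 1, .reg 0, .lit 0,
      .mul (.conj (.get 12 (.reg 3) (.add (.reg 0) (.reg 5)))) (.get 1 (.reg 5) (.lit 0))⟩,
    ⟨19, .lit 0, .lit 0, .lit 1, .lit 1, .reg 0, .lit 0,
      .mul (.get 18 (.reg 5) (.lit 0)) (.get 17 (.reg 5) (.lit 0))⟩,
    ⟨5, .lit 0, .lit 0, .lit 1, .lit 1, .lit 0, .mul (.sqrt (.sqrt (.get 11 (.lit 0) (.lit 0))))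
      (.exp (.div (.sub (.lit 0) (.get 19 (.lit 0) (.lit 0))) (.lit 2))), .lit 0⟩]

/-- The output `A_core`, `b_core`, `c_core`. -/
def corePart : List Pass :=
  [⟨8, .lit 0, .lit 0, .lit 1, .lit 1, .lit 0,
      .div (.get 2 (.lit 0) (.lit 0)) (.get 5 (.lit 0) (.lit 0)), .lit 0⟩,
    ⟨20, .lit 0, .lit 0, .reg 1, .reg 0, .reg 0, .lit 0,
      .mul (.get 0 (.add (.reg 0) (.reg 3)) (.reg 5))
        (.conj (.get 12 (.reg 4) (.add (.reg 0) (.reg 5))))⟩,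
    ⟨21, .lit 0, .lit 0, .reg 0, .reg 1, .reg 0, .lit 0,
      .mul (.get 15 (.reg 3) (.reg 5)) (.get 0 (.add (.reg 0) (.reg 4)) (.reg 5))⟩,
    ⟨6, .lit 0, .lit 0, .reg 0, .reg 0, .lit 0, .lit 0, .lit 0⟩,
    ⟨6, .lit 0, .reg 0, .reg 0, .reg 1, .lit 0, .get 20 (.reg 4) (.reg 3), .lit 0⟩,
    ⟨6, .reg 0, .lit 0, .reg 1, .reg 0, .lit 0, .get 20 (.reg 3) (.reg 4), .lit 0⟩,
    ⟨6, .reg 0, .reg 0, .reg 1, .reg 1, .reg 0,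
      .get 0 (.add (.reg 0) (.reg 3)) (.add (.reg 0) (.reg 4)),
      .mul (.get 20 (.reg 3) (.reg 5)) (.get 21 (.reg 5) (.reg 4))⟩,
    ⟨7, .lit 0, .lit 0, .reg 0, .lit 1, .lit 0, .lit 0, .lit 0⟩,
    ⟨7, .reg 0, .lit 0, .reg 1, .lit 1, .reg 0, .get 1 (.add (.reg 0) (.reg 3)) (.lit 0),
      .mul (.get 20 (.reg 3) (.reg 5)) (.get 17 (.reg 5) (.lit 0))⟩]

theorem wellFormed_setup : ∀ P ∈ setup, P.WellFormed := by
  decide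

theorem wellFormed_choleskyRow : ∀ P ∈ choleskyRow, P.WellFormed := by
  decide

theorem wellFormed_output : ∀ P ∈ unitaryPart ++ corePart, P.WellFormed := by
  decide

end Pass

/-- The program that computes a stellar decomposition. -/
def stellarProgram : Program :=
  .seq (Pass.programs Pass.setup) (.seq (.loop 2 (.reg 0) (Pass.programs Pass.choleskyRow))
    (Pass.programs (Pass.unitaryPart ++ Pass.corePart)))

/-! ### Verification of the passes -/

namespace Pass

section

variable {m n p : ℕ} (μ : ℕ → ℕ → ℕ → ℂ)

theorem holds_setup : ∀ P ∈ setup, P.Holds m n p (effects m n p setup μ) := by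
  exact holds_effects wellFormed_setup (by decide) μ

theorem holds_output : ∀ P ∈ unitaryPart ++ corePart,
    P.Holds m n p (effects m n p (unitaryPart ++ corePart) μ) := by
  exact holds_effects wellFormed_output (by decide) μ

/-- These passes overwrite arrays read earlier in the same round, so `holds_effects` does not apply;
the four effects are composed explicitly. -/
theorem effects_choleskyRow (hp : p < m) :
    (∀ a ∉ [11, 12, 13, 14], effects m n p choleskyRow μ a = μ a) ∧
    (∀ r ≠ p, effects m n p choleskyRow μ 12 r = μ 12 r) ∧
    (∀ j < m + m, effects m n p choleskyRow μ 12 p j = schurRow (μ 10) (μ 12) p j /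
      ((Real.sqrt (schurRow (μ 10) (μ 12) p p).re : ℝ) : ℂ)) ∧
    effects m n p choleskyRow μ 11 0 0 = μ 11 0 0 * schurRow (μ 10) (μ 12) p p := by
  refine ⟨fun a ha => ?_, fun r hr => ?_, fun j hj => ?_, ?_⟩
  · refine effects_of_forall_ne ?_ μ
    simp at ha
    simp [choleskyRow, ha]
  · funext s
    simp [effects, choleskyRow, effect, Covers, idx, IdxExpr.eval, context, value, NumExpr.eval]
    omega
  · have hp' : p < m + m := by omega
    simp [effects, choleskyRow, effect, Covers, idx, IdxExpr.eval, context, value, NumExpr.eval,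
      schurRow, hj, hp']
  · have hp' : p < m + m := by omega
    simp [effects, choleskyRow, effect, Covers, idx, IdxExpr.eval, context, value, NumExpr.eval,
      schurRow, hp']

end

end Pass

namespace Pass

theorem run_choleskyRows {m n : ℕ} {σ : Store} {p₀ : ℕ} (hσ : σ.IsAt m n p₀)
    (h1 : σ.mem 11 0 0 = 1) :
    (∃ p, ((Program.loop 2 (.reg 0) (programs choleskyRow)).run σ).1.IsAt m n p) ∧
    (∀ a ∉ [11, 12, 13, 14],
      ((Program.loop 2 (.reg 0) (programs choleskyRow)).run σ).1.mem a = σ.mem a) ∧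
    IsCholesky (σ.mem 10)
      (((Program.loop 2 (.reg 0) (programs choleskyRow)).run σ).1.mem 12) m (m + m) ∧
    ((Program.loop 2 (.reg 0) (programs choleskyRow)).run σ).1.mem 11 0 0 =
      ∏ q ∈ Finset.range m, schurRow (σ.mem 10)
        (((Program.loop 2 (.reg 0) (programs choleskyRow)).run σ).1.mem 12) q q ∧
    ((Program.loop 2 (.reg 0) (programs choleskyRow)).run σ).2 ≤
      2 + m * ((choleskyRow.map rate).sum * (2 * (1 + 2 * m) * (1 + m)) + 3) := by
  have key := Program.run_loop_induction (r := 2) (e := .reg 0) (body := programs choleskyRow)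
    (σ := σ) (fun p τ => (∃ p, τ.IsAt m n p) ∧ (∀ a ∉ [11, 12, 13, 14], τ.mem a = σ.mem a) ∧
      IsCholesky (σ.mem 10) (τ.mem 12) p (m + m) ∧
      τ.mem 11 0 0 = ∏ q ∈ Finset.range p, schurRow (σ.mem 10) (τ.mem 12) q q)
    ((choleskyRow.map rate).sum * (2 * (1 + 2 * m) * (1 + m)) + 2)
    ⟨⟨p₀, hσ⟩, fun _ _ => rfl, fun q hq => absurd hq (Nat.not_lt_zero q), by simpa using h1⟩ ?_
  · rw [IdxExpr.eval, hσ.1] at key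
    obtain ⟨⟨h2, h3, h4, h5⟩, h6⟩ := key
    exact ⟨h2, h3, h4, h5, h6⟩
  · intro p hp τ hτ
    obtain ⟨⟨p', hat⟩, hfr, hch, hdet⟩ := hτ
    replace hp : p < m := hp.trans_eq hσ.1
    have hat' : (τ.setReg 2 p).IsAt m n p := ⟨hat.1, hat.2.1, rfl⟩
    obtain ⟨h2, h3, h4⟩ := run_programs wellFormed_choleskyRow
      (C := 2 * (1 + 2 * m) * (1 + m)) (by
        have e : 2 * (1 + 2 * m) ≤ 2 * (1 + 2 * m) * (1 + m) :=
          Nat.le_mul_of_pos_right _ (by omega)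
        have e' : 2 * (1 + 2 * m) * (1 + p) ≤ 2 * (1 + 2 * m) * (1 + m) :=
          Nat.mul_le_mul_left _ (by omega)
        simp only [choleskyRow, List.forall_mem_cons, idx, IdxExpr.eval, context]
        rw [← two_mul m]
        refine ⟨e', by omega, by omega, by omega, by simp⟩) hat'
    obtain ⟨h5, h6, h7, h8⟩ := effects_choleskyRow (n := n) τ.mem hp
    have hm : (τ.setReg 2 p).mem = τ.mem := rfl
    rw [hm] at h3
    rw [← h3] at h5 h6 h7 h8
    have h10 : τ.mem 10 = σ.mem 10 := hfr 10 (by decide)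
    rw [h10] at h7 h8
    generalize ((programs choleskyRow).run (τ.setReg 2 p)).1 = υ at *
    -- The Schur complement for row `q` involves only the rows before `q`, and the current round
    -- changes nothing but row `p`.
    have hsame : ∀ q ≤ p, ∀ j, schurRow (σ.mem 10) (υ.mem 12) q j =
        schurRow (σ.mem 10) (τ.mem 12) q j := fun q hq j =>
      schurRow_congr (fun r hr => by rw [h6 r (by omega)]) fun r hr => by rw [h6 r (by omega)]
    refine ⟨⟨⟨p, h2⟩, fun a ha => (h5 a ha).trans (hfr a ha), fun q hq j hj => ?_, ?_⟩, h4⟩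
    · rw [hsame q (by omega), hsame q (by omega)]
      rcases (Nat.lt_succ_iff_lt_or_eq.1 hq) with hq | rfl
      · rw [h6 q hq.ne]
        exact hch q hq j hj
      · exact h7 j hj
    · rw [h8, hdet, Finset.prod_range_succ, hsame p le_rfl]
      congr 1
      exact Finset.prod_congr rfl fun q hq => (hsame q (Finset.mem_range.1 hq).le q).symm

end Pass

/-! ### The whole program: running time and output -/

/-- The constant in the bound for the running time. -/
def stellarRate : ℕ :=
  27 * (Pass.setup.map Pass.rate).sum + 18 * (Pass.choleskyRow.map Pass.rate).sum +
    27 * ((Pass.unitaryPart ++ Pass.corePart).map Pass.rate).sum + 9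

/-- All conclusions refer to the final memory, because no stage destroys what the later argument
uses. The exception is the initial `1` in the array `11`, which the pivots replace. -/
theorem run_stellarProgram {m n : ℕ} {σ τ : Store} {B : ℕ} (h0 : σ.reg 0 = m) (h1 : σ.reg 1 = n)
    (hrun : stellarProgram.run σ = (τ, B)) :
    (∀ a < 3, τ.mem a = σ.mem a) ∧
    (∃ p, ∀ P ∈ Pass.setup, P.target ≠ 11 → P.Holds m n p τ.mem) ∧
    IsCholesky (τ.mem 10) (τ.mem 12) m (m + m) ∧
    τ.mem 11 0 0 = ∏ q ∈ Finset.range m, schurRow (τ.mem 10) (τ.mem 12) q q ∧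
    (∃ p, ∀ P ∈ Pass.unitaryPart ++ Pass.corePart, P.Holds m n p τ.mem) ∧
    (0 < m + n → B ≤ stellarRate * (m + n) ^ 3) := by
  have hat : σ.IsAt m n (σ.reg 2) := ⟨h0, h1, rfl⟩
  have hC : ∀ p, ∀ P ∈ Pass.setup ++ (Pass.unitaryPart ++ Pass.corePart),
      (1 + Pass.idx m n p P.height) * (1 + Pass.idx m n p P.width) *
        (1 + Pass.idx m n p P.depth) ≤ (m + n + 2) ^ 3 := by
    intro p P hP
    have h : Pass.idx m n p P.height ≤ m + n + 1 ∧ Pass.idx m n p P.width ≤ m + n + 1 ∧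
        Pass.idx m n p P.depth ≤ m + n + 1 := by
      revert P
      simp only [Pass.setup, Pass.unitaryPart, Pass.corePart, List.cons_append, List.nil_append,
        List.forall_mem_cons, Pass.idx, IdxExpr.eval, context]
      simp
      omega
    obtain ⟨h2, h3, h4⟩ := h
    rw [pow_three']
    exact Nat.mul_le_mul (Nat.mul_le_mul (by omega) (by omega)) (by omega)
  obtain ⟨h2, h3, h4⟩ := Pass.run_programs Pass.wellFormed_setup
    (fun P hP => hC _ P (List.mem_append_left _ hP)) hat
  have hs := Pass.holds_setup (m := m) (n := n) (p := σ.reg 2) σ.mem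
  have hs' : ∀ a ∉ [9, 10, 11],
      ((Pass.programs Pass.setup).run σ).1.mem a = σ.mem a := fun a ha => by
    rw [h3]
    refine Pass.effects_of_forall_ne ?_ _
    simp at ha
    simp [Pass.setup, ha]
  rw [← h3] at hs
  rw [stellarProgram, Program.run, Program.run] at hrun
  generalize (Pass.programs Pass.setup).run σ = σ₁ at *
  obtain ⟨⟨p, h5⟩, h6, h7, h8, h9⟩ := Pass.run_choleskyRows h2 (by
    simpa [Pass.Holds, Pass.idx, IdxExpr.eval, Pass.value, NumExpr.eval] using
      hs ⟨11, .lit 0, .lit 0, .lit 1, .lit 1, .lit 0, .lit 1, .lit 0⟩ (by simp [Pass.setup]))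
  generalize (Program.loop 2 (.reg 0) (Pass.programs Pass.choleskyRow)).run σ₁.1 = σ₂ at *
  obtain ⟨h10, h11, h12⟩ := Pass.run_programs Pass.wellFormed_output
    (fun P hP => hC _ P (List.mem_append_right _ hP)) h5
  have ho := Pass.holds_output (m := m) (n := n) (p := p) σ₂.1.mem
  have ho' : ∀ a ∈ [0, 1, 2, 9, 10, 11, 12],
      ((Pass.programs (Pass.unitaryPart ++ Pass.corePart)).run σ₂.1).1.mem a = σ₂.1.mem a := by
    intro a ha
    rw [h11]
    refine Pass.effects_of_forall_ne ?_ _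
    revert a
    decide
  rw [← h11] at ho
  generalize (Pass.programs (Pass.unitaryPart ++ Pass.corePart)).run σ₂.1 = σ₃ at *
  obtain ⟨rfl, rfl⟩ := Prod.mk.inj hrun
  have h10' : σ₃.1.mem 10 = σ₁.1.mem 10 := (ho' 10 (by decide)).trans (h6 10 (by decide))
  refine ⟨fun a ha => ?_, ⟨σ.reg 2, fun P hP hP' i hi j hj => ?_⟩, ?_, ?_, ⟨p, ho⟩, fun hmn => ?_⟩
  · have e : a ∈ [0, 1, 2, 9, 10, 11, 12] ∧ a ∉ [11, 12, 13, 14] ∧ a ∉ [9, 10, 11] := by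
      interval_cases a <;> decide
    rw [ho' a e.1, h6 a e.2.1, hs' a e.2.2]
  · have e : ∀ a ∈ [0, 9, 10], σ₃.1.mem a = σ₁.1.mem a := fun a ha => by
      have e : a ∈ [0, 1, 2, 9, 10, 11, 12] ∧ a ∉ [11, 12, 13, 14] := by
        revert a
        decide
      rw [ho' a e.1, h6 a e.2]
    have e' : ∀ P ∈ Pass.setup, P.target ≠ 11 → P.target ∈ [0, 9, 10] ∧
        ∀ a ∈ P.init.reads ++ P.term.reads, a ∈ [0, 9, 10] := by
      decide
    rw [e _ (e' P hP hP').1, hs P hP i hi j hj]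
    exact Pass.value_congr (fun a ha => (e a ((e' P hP hP').2 a ha)).symm) i j
  · rw [h10', ho' 12 (by decide)]
    exact h7
  · rw [h10', ho' 12 (by decide), ho' 11 (by decide)]
    exact h8
  · rw [stellarRate]
    generalize (Pass.setup.map Pass.rate).sum = k₁ at *
    generalize (Pass.choleskyRow.map Pass.rate).sum = k₂ at *
    generalize ((Pass.unitaryPart ++ Pass.corePart).map Pass.rate).sum = k₃ at *
    -- For `m + n ≥ 1` the shift by two is absorbed in a factor three, hence `27 = 3³`.
    have hs1 : (m + n + 2) ^ 3 ≤ 27 * (m + n) ^ 3 :=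
      (Nat.pow_le_pow_left (show m + n + 2 ≤ 3 * (m + n) by omega) 3).trans_eq (by ring)
    have hs2 : 1 ≤ (m + n) ^ 3 := Nat.one_le_pow _ _ hmn
    have hs3 : m * (2 * (1 + 2 * m) * (1 + m)) ≤ 18 * (m + n) ^ 3 :=
      calc m * (2 * (1 + 2 * m) * (1 + m)) ≤
            (m + n) * (2 * (3 * (m + n)) * (3 * (m + n))) := by
            refine Nat.mul_le_mul (by omega) (Nat.mul_le_mul (Nat.mul_le_mul le_rfl ?_) ?_) <;>
              omega
        _ = 18 * (m + n) ^ 3 := by ring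
    have hs4 : m ≤ (m + n) ^ 3 := (Nat.le_add_right m n).trans (Nat.le_self_pow (by omega) _)
    have e1 := Nat.mul_le_mul_left k₁ hs1
    have e2 := Nat.mul_le_mul_left k₂ hs3
    have e3 := Nat.mul_le_mul_left k₃ hs1
    simp only at h4 h9 h12 ⊢
    calc _ ≤ k₁ * (27 * (m + n) ^ 3) + 2 + ((2 + (k₂ * (18 * (m + n) ^ 3) + 3 * (m + n) ^ 3)) +
          (k₃ * (27 * (m + n) ^ 3) + 2)) := by
          refine Nat.add_le_add (h4.trans (by omega)) (Nat.add_le_add (h9.trans ?_)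
            (h12.trans (by omega)))
          rw [mul_add, mul_left_comm, mul_comm m 3]
          omega
      _ ≤ _ := by
          ring_nf at hs2 ⊢
          omega

/-- The two halves of the array `12` are `Γ` and `X = (Γᴴ)⁻¹`. Every inverse in the formulas is a
product of `X` and its adjoint, namely `Γ⁻¹ = Xᴴ` and `H⁻¹ = Xᴴ X`, so matching the stored sums with
the formulas only requires reassociating products. -/
theorem explicit_output {m n : ℕ} {τ : Store} {A : Matrix (Fin m ⊕ Fin n) (Fin m ⊕ Fin n) ℂ}
    {b : Fin m ⊕ Fin n → ℂ} {c : ℂ} (hA : τ.matrix 0 m n = A) (hb : τ.vector 1 m n = b)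
    (hc : τ.mem 2 0 0 = c) (hpos : (gram A).PosDef) {p q : ℕ}
    (hs : ∀ P ∈ Pass.setup, P.target ≠ 11 → P.Holds m n p τ.mem)
    (hG : IsCholesky (τ.mem 10) (τ.mem 12) m (m + m))
    (hdet : τ.mem 11 0 0 = ∏ q ∈ Finset.range m, schurRow (τ.mem 10) (τ.mem 12) q q)
    (ho : ∀ P ∈ Pass.unitaryPart ++ Pass.corePart, P.Holds m n q τ.mem) :
    ∃ Γ, (τ.output m n).Explicit A b c Γ := by
  simp [Pass.setup, Pass.Holds, Pass.idx, IdxExpr.eval, context, Pass.value, NumExpr.eval,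
    Finset.sum_range, Pass.delta, -Complex.star_def, -RCLike.star_def] at hs
  simp [Pass.unitaryPart, Pass.corePart, Pass.Holds, Pass.idx, IdxExpr.eval, context, Pass.value,
    NumExpr.eval, Finset.sum_range, -Complex.star_def, -RCLike.star_def] at ho
  obtain ⟨hE0, hE1, hM1, hM2⟩ := hs
  obtain ⟨hN, hAU11, hAU12, hAU21, hAU22, ht, ht', hbU1, hbU2, hf, he, hcU, hcC, hP, hQ, hAC11,
    hAC12, hAC21, hAC22, hbC1, hbC2⟩ := ho
  set x := A.toBlocks₁₁ with hx
  set R := A.toBlocks₂₁ with hR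
  set u : Fin m → ℂ := b ∘ Sum.inl with hu
  set t : Fin m → ℂ := x.map star *ᵥ u + star u with htt
  have hx' : ∀ i j : Fin m, τ.mem 0 i j = x i j := fun i j => by rw [hx, ← hA]; rfl
  have hR' : ∀ (i : Fin n) (j : Fin m), τ.mem 0 (m + i) j = R i j := fun i j => by
    rw [hR, ← hA]; rfl
  have hu' : ∀ i : Fin m, τ.mem 1 i 0 = u i := fun i => by rw [hu, ← hb]; rfl
  let Γ : Matrix (Fin m) (Fin m) ℂ := Matrix.of fun i j => τ.mem 12 i j
  let X : Matrix (Fin m) (Fin m) ℂ := Matrix.of fun i j => τ.mem 12 i (m + j)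
  -- With truncated subtraction the index `(i - j) + (j - i)` is `|i - j|`, which is zero exactly on
  -- the diagonal.
  have hδ : ∀ i j : Fin m, τ.mem 9 (i - j + (j - i)) 0 = (1 : Matrix (Fin m) (Fin m) ℂ) i j := by
    intro i j
    rcases eq_or_ne i j with rfl | hij
    · simpa using hE0
    · have := Fin.val_ne_of_ne hij
      rw [Matrix.one_apply_ne hij, ← hE1 ((i : ℕ) - j + (j - i) - 1) (by omega)]
      exact congrArg (fun q => τ.mem 9 q 0) (by omega)
  have hM : (Matrix.of fun i j : Fin m => τ.mem 10 i j) = gram A := by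
    ext i j
    rw [Matrix.of_apply, hM1 i i.2 j j.2, hδ, gram, Matrix.sub_apply, sub_eq_add_neg,
      Matrix.mul_apply]
    simp only [hx', ← hx, Matrix.map_apply]
    rfl
  rw [← hM] at hpos
  have hmm : m ≤ m + m := Nat.le_add_left m m
  have hΓ : Γᴴ * Γ = gram A := (hG.conjTranspose_mul_self hmm hpos).trans hM
  have hX : Γᴴ * X = 1 := by
    ext i j
    rw [← hδ, ← hM2 i i.2 j j.2, hG.row_eq_sum hmm hpos i (Nat.add_lt_add_left j.2 m),
      Matrix.mul_apply]
    rfl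
  have hdet' : τ.mem 11 0 0 = (gram A).det := by
    rw [hdet, ← hG.det_eq hmm hpos, hM]
  have hX' : Γᴴ⁻¹ = X := Matrix.inv_eq_right_inv hX
  have hXΓ : Γ⁻¹ = Xᴴ := by
    rw [← hX', Matrix.conjTranspose_nonsing_inv, Matrix.conjTranspose_conjTranspose]
  have hH : (gram A)⁻¹ = Xᴴ * X := by rw [← hΓ, Matrix.mul_inv_rev, hX', hXΓ]
  have hN' : ∀ i j : Fin m, τ.mem 15 i j = (X * x.map star) i j := fun i j => by
    rw [hN i i.2 j j.2, Matrix.mul_apply]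
    simp only [hx', Matrix.map_apply]
    rfl
  have ht1 : ∀ i : Fin m, τ.mem 16 i 0 = t i := fun i => by
    rw [ht i i.2, htt, Pi.add_apply, add_comm, Pi.star_apply, hu']
    simp only [hx', hu']
    rfl
  have ht2 : ∀ i : Fin m, τ.mem 17 i 0 = (X *ᵥ t) i := fun i => by
    rw [ht' i i.2]
    simp only [ht1]
    rfl
  have hP' : ∀ (i : Fin n) (j : Fin m), τ.mem 20 i j = (R * Xᴴ) i j := fun i j => by
    rw [hP i i.2 j j.2, Matrix.mul_apply]
    simp only [hR']
    rfl
  have hQ' : ∀ (i : Fin m) (j : Fin n), τ.mem 21 i j = (X * x.map star * Rᵀ) i j := fun i j => by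
    rw [hQ i i.2 j j.2, Matrix.mul_apply]
    simp only [hR', hN', Matrix.transpose_apply]
    rfl
  -- The program computes the bilinear form as `(X* u)ᵀ (X t)`, since `H⁻¹ = Xᴴ X`.
  have he' : τ.mem 19 0 0 = u ⬝ᵥ ((gram A)⁻¹ *ᵥ t) := by
    rw [he, hH, ← Matrix.mulVec_mulVec, Matrix.dotProduct_mulVec]
    refine Finset.sum_congr rfl fun i _ => ?_
    rw [ht2, hf i i.2]
    congr 1
    refine Finset.sum_congr rfl fun k _ => ?_
    rw [hu', mul_comm]
    rfl
  have hcU' : ‖τ.mem 5 0 0‖ = Real.sqrt (Real.sqrt (gram A).det.re) *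
      Real.exp (-(1 / 2) * (u ⬝ᵥ ((gram A)⁻¹ *ᵥ t)).re) := by
    rw [hcU, norm_mul, Complex.norm_real, Real.norm_of_nonneg (Real.sqrt_nonneg _),
      Complex.norm_exp, hdet', he']
    congr 2
    simp
    ring
  have hcU0 : τ.mem 5 0 0 ≠ 0 := by
    rw [← norm_ne_zero_iff, hcU']
    have := (Complex.pos_iff.1 (hM ▸ hpos).det_pos).1
    positivity
  refine ⟨Γ, hΓ, ?_, ?_, hcU', ?_, ?_, ?_⟩
  · rw [hX']
    ext (i | i) (j | j)
    · exact (hAU11 i i.2 j j.2).trans (hx' i j)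
    · exact hAU12 i i.2 j j.2
    · exact hAU21 i i.2 j j.2
    · refine (hAU22 i i.2 j j.2).trans ?_
      simp only [hN']
      rfl
  · rw [hX']
    funext i
    rcases i with i | i
    · exact (hbU1 i i.2).trans (hu' i)
    · exact (hbU2 i i.2).trans (congrArg Neg.neg (ht2 i))
  · rw [hXΓ, hH]
    ext (i | i) (j | j)
    · exact hAC11 i i.2 j j.2
    · exact (hAC12 i i.2 j j.2).trans (hP' j i)
    · exact (hAC21 i i.2 j j.2).trans (hP' i j)
    · refine (hAC22 i i.2 j j.2).trans ?_
      have e : R * (Xᴴ * X) * x.map star * Rᵀ = R * Xᴴ * (X * x.map star * Rᵀ) := by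
        simp only [Matrix.mul_assoc]
      rw [e, Matrix.fromBlocks_apply₂₂, Matrix.add_apply, Matrix.mul_apply]
      simp only [hP', hQ']
      congr 1
      rw [← hA]
      rfl
  · rw [hH]
    funext i
    rcases i with i | i
    · exact hbC1 i i.2
    · refine (hbC2 i i.2).trans ?_
      simp only [hP', ht2, Sum.elim_inr, Pi.add_apply]
      congr 1
      · rw [← hb]
        rfl
      · rw [← Matrix.mulVec_mulVec, Matrix.mulVec_mulVec]
        rfl
  · refine Eq.trans ?_ hc
    change τ.mem 5 0 0 * τ.mem 8 0 0 = _
    rw [hcC, mul_div_cancel₀ _ hcU0]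

theorem explicit_run_stellarProgram {m n : ℕ} {ψ : Fock (Fin m ⊕ Fin n)}
    {A : Matrix (Fin m ⊕ Fin n) (Fin m ⊕ Fin n) ℂ} {b : Fin m ⊕ Fin n → ℂ} {c : ℂ} {σ : Store}
    (hψ : ‖ψ‖ = 1) (h : IsKetAbc ψ A b c) (hσ : σ.HoldsInput m n A b c) :
    ∃ Γ, ((stellarProgram.run σ).1.output m n).Explicit A b c Γ := by
  obtain ⟨h0, h1, hA, hb, hc⟩ := hσ
  obtain ⟨hin, ⟨p, hs⟩, hG, hdet, ⟨q, ho⟩, -⟩ :=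
    run_stellarProgram (τ := (stellarProgram.run σ).1) (B := (stellarProgram.run σ).2) h0 h1 rfl
  refine explicit_output ?_ ?_ ?_ (posDef_gram hψ h) hs hG hdet ho
  · rw [← hA]
    funext i j
    rw [Store.matrix, hin 0 (by decide)]
    rfl
  · rw [← hb]
    funext i
    rw [Store.vector, hin 1 (by decide)]
    rfl
  · rw [← hc, hin 2 (by decide)]

end Stellar

end

theorem mainTheorem1 :
    (∀ (m n : ℕ) (ψ : Stellar.Fock (Fin m ⊕ Fin n)), Stellar.IsGaussianState ψ →
      ∃ U core, Stellar.IsStellarDecomposition ψ U core) ∧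
    (∀ (m n : ℕ) (ψ : Stellar.Fock (Fin m ⊕ Fin n))
        (A : Matrix (Fin m ⊕ Fin n) (Fin m ⊕ Fin n) ℂ) (b : Fin m ⊕ Fin n → ℂ) (c : ℂ),
      ‖ψ‖ = 1 → Stellar.IsKetAbc ψ A b c →
        (∃ Γ : Matrix (Fin m) (Fin m) ℂ, Γ.PosDef ∧ Γ * Γ = Stellar.gram A) ∧
        ∀ (Γ : Matrix (Fin m) (Fin m) ℂ) (d : Stellar.AbcPair (Fin m) (Fin n)),
          d.Explicit A b c Γ → d.Decomposes ψ) ∧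
    (∃ (P : Stellar.Program) (K : ℕ),
      ∀ (m n : ℕ) (ψ : Stellar.Fock (Fin m ⊕ Fin n))
        (A : Matrix (Fin m ⊕ Fin n) (Fin m ⊕ Fin n) ℂ) (b : Fin m ⊕ Fin n → ℂ) (c : ℂ)
        (σ : Stellar.Store),
      ‖ψ‖ = 1 → Stellar.IsKetAbc ψ A b c → σ.HoldsInput m n A b c →
        ((P.run σ).1.output m n).Decomposes ψ ∧
        (∃ Γ : Matrix (Fin m) (Fin m) ℂ, ((P.run σ).1.output m n).Explicit A b c Γ) ∧
        (0 < m + n → (P.run σ).2 ≤ K * (m + n) ^ 3)) := by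
  refine ⟨fun m n ψ h => Stellar.exists_isStellarDecomposition h, fun m n ψ A b c hψ h =>
    ⟨Stellar.exists_posDef_sqrt_gram hψ h, fun Γ d hd => hd.decomposes hψ h⟩,
    Stellar.stellarProgram, Stellar.stellarRate, fun m n ψ A b c σ hψ h hσ => ?_⟩
  obtain ⟨Γ, hΓ⟩ := Stellar.explicit_run_stellarProgram hψ h hσ
  exact ⟨hΓ.decomposes hψ h, ⟨Γ, hΓ⟩,
    (Stellar.run_stellarProgram hσ.1 hσ.2.1 rfl).2.2.2.2.2⟩
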